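/- **Setting.** Let $n\ge 1$ and $a$ be integers. Let $\boldsymbol G=\boldsymbol G^n_1$ be the grading datum $$\mathbb Z\xrightarrow{\ f\ } Y:=\bigl(\mathbb Z\oplus\mathbb Z\langle y_1,\dots,y_n\rangle\bigr)/\bigl(2(1-n),\,y_1+\dots+y_n\bigr)\xrightarrow{\ \sigma\ }\mathbb Z/2,\qquad f(j)=(j,0),\quad \sigma(j,y)=j \bmod 2 .$$ Let $A=\Lambda^*(\mathbb C^n)$ be the exterior algebra on generators $\theta_1,\dots,\theta_n$ of degree $(-1,y_j)$, and let $R=R_a=\mathbb C[r_1,\dots,r_n]$ with $\deg r_j=(2-2a,\,a\,y_j)$; so $A\otimes R$ is $Y$-graded. Write $\mathfrak m=(r_1,\dots,r_n)$, and $\mathcal O(r^k)$ for elements of $\mathfrak m^k(A\otimes R)$. A cochain $\varphi=(\varphi^s)_{s\ge0}$ consists of $R$-multilinear maps $\varphi^s:(A\otimes R)^{s}\to A\otimes R$; it has degree $d$ if $\varphi^s$ changes the $Y$-degree by $f(d-s)$ for every $s$. Put $\sigma'=\sigma+1$. A (non-curved) $\boldsymbol G$-graded $A_\infty$ algebra $(A\otimes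 R,\mu)$ over $R$ is a cochain $\mu$ of degree $2$ with $\mu^0=0$ and $\mu\circ\mu=0$, where for $\psi$ of even degree and homogeneous $a_1,\dots,a_s$ $$(\varphi\circ\psi)^s(a_s,\dots,a_1)=\sum_{i+j+k=s}(-1)^{\sigma'(a_1)+\dots+\sigma'(a_i)}\varphi^{i+k+1}\bigl(a_s,\dots,\psi^j(a_{i+j},\dots,a_{i+1}),a_i,\dots,a_1\bigr).$$ The Hochschild–Kostant–Rosenberg map is $\Phi(\varphi)=\sum_s\varphi^s(\mathbf u,\dots,\mathbf u)$ with $\mathbf u=\sum_j u_j\theta_j$, where $u_1,\dots,u_n$ are commuting variables over which $\varphi$ is extended linearly. Put $$\tilde Z^n_a=-u_1\cdots u_n+\sum_{j=1}^n r_ju_j^a .$$ The $A_\infty$ algebra $(A\otimes R,\mu)$ has *type $\mathrm A^n_a$* if its product agrees with the exterior product at order $0$, i.e. $(-1)^{\sigma(x_1)}\mu^2(x_2,x_1)=x_2\wedge x_1+\mathcal O(r)$ for all $x_2$ and homogeneous $x_1$, and if $\Phi(\mu)=\tilde Z^n_a+\mathcal O(r^2)$. A $\boldsymbol G$-graded formal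 diffeomorphism over $R$ is a cochain $F$ of degree $1$ with $F^0=0$, $F^1$ bijective and $F^1=\mathrm{id}+\mathcal O(r)$. One writes $\mu=F_*\eta$ if $F$ is an $A_\infty$ homomorphism from $(A\otimes R,\eta)$ to $(A\otimes R,\mu)$, i.e. for all $s\ge 0$ and homogeneous $a_1,\dots,a_s$ $$\sum_{k\ge0}\ \sum_{\substack{s_1+\dots+s_k=s\\ s_i\ge1}}\mu^k\bigl(F^{s_k}(a_s,\dots),\dots,F^{s_1}(a_{s_1},\dots,a_1)\bigr)=(F\circ\eta)^s(a_s,\dots,a_1).$$ **Theorem.** Let $n\ge4$ and $n-1\ge a\ge2$, and let $\mathscr A_1=(A\otimes R,\mu)$ and $\mathscr A_2=(A\otimes R,\eta)$ be two (non-curved) $\boldsymbol G$-graded $A_\infty$ algebras over $R$ of type $\mathrm A^n_a$. Then there exists a $\boldsymbol G$-graded formal diffeomorphism $F$ over $R$ with $\mathscr A_1=F_*\mathscr A_2$. -/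

import Mathlib

open scoped TensorProduct

namespace AInf

/-- A grading datum: an abelian group `Y` with homomorphisms `ℤ → Y → ℤ/2` whose composite is the
reduction map. -/
structure GradingDatum where
  Y : Type
  [grp : AddCommGroup Y]
  f : ℤ →+ Y
  σ : Y →+ ZMod 2
  σ_f : ∀ j : ℤ, σ (f j) = (j : ZMod 2)

attribute [instance] GradingDatum.grp

/-- `(-1)^z` for a parity `z`. -/
def sgn (z : ZMod 2) : ℤ := if z = 0 then 1 else -1

section General

variable {R M : Type} [CommRing R] [AddCommGroup M] [Module R M]

/-- Hochschild cochains of an `R`-module `M`: all lengths `s ≥ 0` at once (a product, not a sum).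
The tuple `a : Fin s → M` with entries `a 0, …, a (s-1)` stands for the input
`φ^s(a_s, …, a_1)` with `a_{k+1} = a k`. -/
abbrev Cochain (R M : Type) [CommRing R] [AddCommGroup M] [Module R M] : Type :=
  (s : ℕ) → MultilinearMap R (fun _ : Fin s => M) M

/-- The cochain `φ` lies in the degree-`d` part of the `G`-graded Hochschild complex: its
length-`s` component changes the degree by `f(d - s)`. -/
def HasDegree (G : GradingDatum) (gr : G.Y → AddSubgroup M) (d : ℤ) (φ : Cochain R M) : Prop :=
  ∀ (s : ℕ) (y : Fin s → G.Y) (a : Fin s → M), (∀ k, a k ∈ gr (y k)) →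
    φ s a ∈ gr (∑ k, y k + G.f (d - s))

/-- The sequence `a_1, …, a_i, x, a_{i+j+1}, a_{i+j+2}, …` (written with indices from `0`). -/
def replaceBlock (a : ℕ → M) (i j : ℕ) (x : M) : ℕ → M :=
  fun m => if m < i then a m else if m = i then x else a (m + j - 1)

/-- The Gerstenhaber product `φ ∘ ψ` with a cochain `ψ` of even degree (so `σ'(ψ) = 1`), evaluated
on homogeneous elements `a_1, …, a_s` of degrees `y_1, …, y_s` (the first `s` entries of `a`, `y`):
`∑_{i+j+k=s} (-1)^{σ'(a_1) + ⋯ + σ'(a_i)} φ(a_s, …, ψ^j(a_{i+j}, …, a_{i+1}), a_i, …, a_1)`,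
where `σ' = σ + 1`. -/
def gerstenhaber (G : GradingDatum) (φ ψ : Cochain R M) (s : ℕ) (y : ℕ → G.Y) (a : ℕ → M) : M :=
  ∑ p ∈ Finset.HasAntidiagonal.antidiagonal s, ∑ q ∈ Finset.HasAntidiagonal.antidiagonal p.2,
    sgn (∑ k ∈ Finset.range p.1, (G.σ (y k) + 1)) •
      φ (p.1 + q.2 + 1) (fun m =>
        replaceBlock a p.1 q.1 (ψ q.1 (fun l => a (p.1 + l))) m)

/-- A non-curved `G`-graded `A_∞` structure over `R`: a cochain of degree `2` with no length-zero
part and `μ ∘ μ = 0`. -/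
structure IsAInfinity (G : GradingDatum) (gr : G.Y → AddSubgroup M) (μ : Cochain R M) : Prop where
  degree : HasDegree G gr 2 μ
  noncurved : μ 0 = 0
  relation : ∀ (s : ℕ) (y : ℕ → G.Y) (a : ℕ → M), (∀ k, a k ∈ gr (y k)) →
    gerstenhaber G μ μ s y a = 0

/-- A `G`-graded formal diffeomorphism over `R`, where `m` is the ideal of elements of positive
order of `R`: a cochain of degree `1` with no length-zero part, whose linear part is invertible and
is the identity at order zero. -/
structure IsFormalDiffeo (G : GradingDatum) (gr : G.Y → AddSubgroup M) (m : Ideal R)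
    (F : Cochain R M) : Prop where
  degree : HasDegree G gr 1 F
  truncated : F 0 = 0
  order_zero : ∀ x : M, F 1 (fun _ => x) - x ∈ (m • ⊤ : Submodule R M)
  bijective : Function.Bijective (fun x : M => F 1 (fun _ => x))

/-- `μ = F_* η`: the cochain `F` is an `A_∞` homomorphism from `(M, η)` to `(M, μ)`, that is
`∑_{s_1+⋯+s_k=s} μ^k(F^{s_k}(a_s, …), …, F^{s_1}(a_{s_1}, …, a_1))
  = ∑ (-1)^{σ'(a_1)+⋯+σ'(a_i)} F(a_s, …, η^j(a_{i+j}, …, a_{i+1}), a_i, …, a_1)`.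
If `F` is a formal diffeomorphism, this determines `μ` from `F` and `η`. -/
def IsPushforward (G : GradingDatum) (gr : G.Y → AddSubgroup M) (F η μ : Cochain R M) : Prop :=
  ∀ (s : ℕ) (y : ℕ → G.Y) (a : ℕ → M), (∀ k, a k ∈ gr (y k)) →
    ∑ c : Composition s, μ c.length (fun k =>
        F (c.blocksFun k) (fun l => a (c.sizeUpTo k + l))) =
      gerstenhaber G F η s y a

end General

noncomputable section

/-- The relation `(2(a - n), y_1 + ⋯ + y_n)`. -/
def relator (n : ℕ) (a : ℤ) : ℤ × (Fin n → ℤ) := (2 * (a - n), fun _ => 1)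

/-- The grading datum `G^n_a`: `Y = (ℤ ⊕ ℤ⟨y_1, …, y_n⟩) / (2(a - n), y_1 + ⋯ + y_n)`,
`f(j) = (j, 0)` and `σ(j, y) = j mod 2`. -/
def gradingDatum (n : ℕ) (a : ℤ) : GradingDatum where
  Y := (ℤ × (Fin n → ℤ)) ⧸ AddSubgroup.zmultiples (relator n a)
  f := (QuotientAddGroup.mk' _).comp (AddMonoidHom.inl ℤ (Fin n → ℤ))
  σ := QuotientAddGroup.lift _ ((Int.castAddHom (ZMod 2)).comp (AddMonoidHom.fst ℤ (Fin n → ℤ)))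
    (by
      rw [AddSubgroup.zmultiples_le]
      have h : (2 : ZMod 2) = 0 := by decide
      simp [AddMonoidHom.mem_ker, relator, h])
  σ_f := fun j => by simp

/-- The grading datum `G = G^n_1` used throughout. -/
abbrev G (n : ℕ) : GradingDatum := gradingDatum n 1

/-- The class of `(j, v)` in the group `Y` of `G^n_1`. -/
def deg (n : ℕ) (j : ℤ) (v : Fin n → ℤ) : (G n).Y := QuotientAddGroup.mk (j, v)

/-- The coefficient ring `R_a = ℂ[r_1, …, r_n]` (its `G`-grading, which depends on `a`, enters
through `grading`). -/
abbrev coeffRing (n : ℕ) : Type := MvPolynomial (Fin n) ℂ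

/-- `A = Λ^* U` with `U = ℂ^n`. -/
abbrev extAlg (n : ℕ) : Type := ExteriorAlgebra ℂ (Fin n → ℂ)

/-- `A ⊗ R_a`. -/
abbrev extAlgR (n : ℕ) : Type := coeffRing n ⊗[ℂ] extAlg n

/-- The generators `θ_1, …, θ_n` of `A`. -/
def θ (n : ℕ) (j : Fin n) : extAlg n := ExteriorAlgebra.ι ℂ (Pi.single j 1)

/-- `deg(θ_j) = (-1, y_j)`. -/
def degTheta (n : ℕ) (j : Fin n) : (G n).Y := deg n (-1) (Pi.single j 1)

/-- `deg(r_j) = (2 - 2a, a y_j)`. -/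
def degR (n a : ℕ) (j : Fin n) : (G n).Y := deg n (2 - 2 * a) (Pi.single j (a : ℤ))

/-- The `G`-grading of `A ⊗ R_a`: the part of degree `y` is the complex span of the elements
`r^c θ_{l_1} ∧ ⋯ ∧ θ_{l_k}` of degree `y`. -/
def grading (n a : ℕ) (y : (G n).Y) : AddSubgroup (extAlgR n) :=
  (Submodule.span ℂ {x : extAlgR n | ∃ (c : Fin n →₀ ℕ) (l : List (Fin n)),
    ∑ j, c j • degR n a j + (l.map (degTheta n)).sum = y ∧
    x = MvPolynomial.monomial c 1 ⊗ₜ (l.map (θ n)).prod}).toAddSubgroup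

/-- The ideal `(r_1, …, r_n)`; its `k`-th power consists of the elements of order at least `k`. -/
def maxIdeal (n : ℕ) : Ideal (coeffRing n) := Ideal.span (Set.range MvPolynomial.X)

/-- The elements `O(r^k)` of `A ⊗ R_a`. -/
def bigO (n k : ℕ) : Submodule (coeffRing n) (extAlgR n) := maxIdeal n ^ k • ⊤

/-- The Hochschild-Kostant-Rosenberg map `Φ(φ) = ∑_s φ^s(u, …, u)` with `u = ∑_j u_j θ_j`, where
`φ` is extended linearly over the commuting variables `u_1, …, u_n`. It is written as a power
series in the `u_j` with coefficients in `A ⊗ R_a`: the coefficient of `u^b` is the sum of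
`φ^s(θ_{i_s}, …, θ_{i_1})` over all `i` with `u_{i_1} ⋯ u_{i_s} = u^b`. -/
def hkr (n : ℕ) (φ : Cochain (coeffRing n) (extAlgR n)) : MvPowerSeries (Fin n) (extAlgR n) :=
  fun b => ∑ i : Fin b.degree → Fin n with ∑ k, Finsupp.single (i k) 1 = b,
    φ b.degree (fun k => 1 ⊗ₜ θ n (i k))

/-- `Z̃^n_a = - u_1 ⋯ u_n + ∑_j r_j u_j^a`, in `S_a = R_a[u_1, …, u_n]`. -/
def potential (n a : ℕ) : MvPolynomial (Fin n) (coeffRing n) :=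
  - ∏ j, MvPolynomial.X j +
    ∑ j, MvPolynomial.C (MvPolynomial.X j) * MvPolynomial.X j ^ a

/-- `Z̃^n_a` regarded as a power series in the `u_j` with coefficients in `A ⊗ R_a`. -/
def potentialSeries (n a : ℕ) : MvPowerSeries (Fin n) (extAlgR n) :=
  MvPowerSeries.map (algebraMap (coeffRing n) (extAlgR n))
    (potential n a : MvPowerSeries (Fin n) (coeffRing n))

/-- The (non-curved) `G`-graded `A_∞` algebra `(A ⊗ R_a, μ)` over `R_a` has type `A^n_a`. -/
structure IsTypeA (n a : ℕ) (μ : Cochain (coeffRing n) (extAlgR n)) : Prop where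
  ainf : IsAInfinity (G n) (grading n a) μ
  /-- at order zero, the product `x₂ · x₁ = (-1)^{σ(x₁)} μ²(x₂, x₁)` is the exterior product -/
  product : ∀ (y : (G n).Y) (x₁ x₂ : extAlgR n), x₁ ∈ grading n a y →
    sgn ((G n).σ y) • μ 2 ![x₁, x₂] - x₂ * x₁ ∈ bigO n 1
  /-- `Φ(μ) = Z̃^n_a + O(r²)` -/
  hkr_eq : ∀ b : Fin n →₀ ℕ,
    MvPowerSeries.coeff b (hkr n μ - potentialSeries n a) ∈ bigO n 2

end

end AInf

/-!
The theorem is an instance of obstruction theory, with obstructions computed by the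
Hochschild-Kostant-Rosenberg theorem for the exterior algebra and controlled by the grading.

A cochain on `A ⊗ R` is determined by its matrix coefficients on words `l` in the basis elements
`θ_I`, a family `F : List X → X → R` with `X = Finset (Fin n)`. On functionals `List X → R` such a
family acts in two ways: as a coderivation of the bar construction (`dstar`), which gives the
Gerstenhaber product, and as a map of bar constructions (`push`), which gives the left-hand side of
the equation of an `A_∞` homomorphism. The difference of the two sides is the `defect` of `F`; one
looks for a homogeneous `F`, close to the identity, with vanishing defect.

Such an `F` is built from the identity by successive corrections (`IsStage.exists_succ`). The
monomial `r^c` in the component `θ_K` of the value on a word `l` is given the weight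
`2 |c| + length l`, and monomials are corrected in the order of increasing weight and, within one
weight, of increasing `|K|`. With this ordering a value of the defect multiplied by a letter
contributes to the leading terms only through the augmentation `A → ℂ` of that letter, so the
coefficients of the defect of lowest rank form a cocycle of the bar complex of `A` with trivial
coefficients `ℂ` (`barDiff_coeff_defect`, a consequence of the identity
`defectStar_add_dstar_defect`), and a change of `F` in one weight lower changes them by a coboundary
(`coeff_defect_sub_defect`).

A cocycle with trivial coefficients is a coboundary as soon as its symmetrization on words of
generators vanishes (`exists_eq_barDiff`). This is proved by normalizing the cocycle
(`exists_normalized`), by the contraction of the Koszul complex `ℂ[u] ⊗ A` (`exists_koszul_step`),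
and by Euler's identity `∑_j θ_j ∂_j = |I|` on `θ_I`.

The grading leaves no room for the symmetrization of the leading coefficients of the defect except
in the terms of the potential: `u_1 ⋯ u_n` at order zero and `r_j u^b` with `|b| = a` at order one
(`classify_of_degMon_eq`). There, again for degree reasons, `F` is the identity up to terms of
higher order on all shorter words, so the defect agrees with `μ - η`, whose symmetrization vanishes
at these orders because both structures have the same image under the
Hochschild-Kostant-Rosenberg map modulo `O(r²)` (`IsStage.symSum_eq_zero`).

Finally, the grading bounds the order in `r` of each component of a homogeneous cochain on words of
a given length (`degree_le_orderBound`, which uses `a < n`). Hence the corrections become stationary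
on each word and the limit exists over the polynomial ring (`exists_defect_eq_zero`), and `F¹ - id`
is nilpotent (`exists_pow_eq_zero_of_isHomog`), which makes `F¹` bijective.
-/

namespace AInf

/-! ### Functionals on words and the bar construction -/

section Words

variable {X R : Type*} [CommRing R]

/-- The sum of `f a b` over all ways `l = a ++ b` of cutting the word `l` in two. -/
def splitSum {N : Type*} [AddCommMonoid N] (f : List X → List X → N) (l : List X) : N :=
  ∑ i ∈ Finset.range (l.length + 1), f (l.take i) (l.drop i)

theorem splitSum_nil {N : Type*} [AddCommMonoid N] (f : List X → List X → N) :
    splitSum f [] = f [] [] := by simp [splitSum]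

theorem splitSum_cons {N : Type*} [AddCommMonoid N] (f : List X → List X → N) (x : X)
    (l : List X) :
    splitSum f (x :: l) = f [] (x :: l) + splitSum (fun a b => f (x :: a) b) l := by
  unfold splitSum
  rw [List.length_cons, Finset.sum_range_succ', add_comm]
  simp

theorem splitSum_congr {N : Type*} [AddCommMonoid N] {f g : List X → List X → N} {l : List X}
    (h : ∀ a b, a ++ b = l → f a b = g a b) : splitSum f l = splitSum g l :=
  Finset.sum_congr rfl fun _ _ => h _ _ (List.take_append_drop _ _)

theorem splitSum_add {N : Type*} [AddCommMonoid N] (f g : List X → List X → N) (l : List X) :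
    splitSum (fun a b => f a b + g a b) l = splitSum f l + splitSum g l :=
  Finset.sum_add_distrib

theorem splitSum_sub {N : Type*} [AddCommGroup N] (f g : List X → List X → N) (l : List X) :
    splitSum (fun a b => f a b - g a b) l = splitSum f l - splitSum g l :=
  Finset.sum_sub_distrib _ _

theorem splitSum_zero {N : Type*} [AddCommMonoid N] (l : List X) :
    splitSum (fun _ _ => (0 : N)) l = 0 :=
  Finset.sum_const_zero

theorem mul_splitSum (r : R) (f : List X → List X → R) (l : List X) :
    r * splitSum f l = splitSum (fun a b => r * f a b) l :=
  Finset.mul_sum _ _ _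

theorem splitSum_mul (r : R) (f : List X → List X → R) (l : List X) :
    splitSum f l * r = splitSum (fun a b => f a b * r) l :=
  Finset.sum_mul _ _ _

theorem splitSum_sum {ι : Type*} (s : Finset ι) (f : ι → List X → List X → R) (l : List X) :
    splitSum (fun a b => ∑ i ∈ s, f i a b) l = ∑ i ∈ s, splitSum (f i) l :=
  Finset.sum_comm

/-- Cutting a word into three pieces does not depend on the order of the two cuts. -/
theorem splitSum_assoc {N : Type*} [AddCommMonoid N] (g : List X → List X → List X → N)
    (l : List X) :
    splitSum (fun w c => splitSum (fun a b => g a b c) w) l =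
      splitSum (fun a w => splitSum (fun b c => g a b c) w) l := by
  induction l generalizing g with
  | nil => simp [splitSum_nil]
  | cons x l ih =>
    rw [splitSum_cons, splitSum_cons]
    simp only [splitSum_cons, splitSum_nil]
    rw [splitSum_add, ih, add_assoc]

theorem splitSum_induction {N : Type*} [AddCommMonoid N] {p : N → Prop} (h0 : p 0)
    (hadd : ∀ x y, p x → p y → p (x + y)) {f : List X → List X → N} {l : List X}
    (h : ∀ a b, a ++ b = l → p (f a b)) : p (splitSum f l) :=
  Finset.sum_induction _ p hadd h0 fun _ _ => h _ _ (List.take_append_drop _ _)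

variable [Fintype X]

/-- Precomposition of a functional `Ψ` on words with the coderivation of the bar construction
determined by the cochain `η`: the sum of all `± Ψ(…, η(block), …)`, with sign `t` of every letter
in front of the block. If `Ψ` is a coordinate of a cochain, this is a coordinate of the
Gerstenhaber product `Ψ ∘ η`. -/
def dstar (t : X → R) (η : List X → X → R) : (List X → R) → List X → R
  | _, [] => 0
  | Ψ, x :: l => splitSum (fun a b => ∑ K, η (x :: a) K * Ψ (K :: b)) l +
      t x * dstar t η (fun w => Ψ (x :: w)) l

/-- Auxiliary recursion for `push`; `acc` is the part of the current block already read. -/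
def pushAux (F : List X → X → R) : (List X → R) → List X → List X → R
  | Ψ, [], [] => Ψ []
  | _, _ :: _, [] => 0
  | Ψ, acc, x :: l => ∑ K, F (acc ++ [x]) K * pushAux F (fun w => Ψ (K :: w)) [] l +
      pushAux F Ψ (acc ++ [x]) l

/-- Precomposition of a functional `Ψ` on words with the coalgebra map of the bar construction
determined by the cochain `F`: the sum of `Ψ(F(block), …, F(block))` over all ways of cutting a
word into nonempty blocks. -/
def push (F : List X → X → R) (Ψ : List X → R) (l : List X) : R := pushAux F Ψ [] l

theorem push_nil (F : List X → X → R) (Ψ : List X → R) : push F Ψ [] = Ψ [] := by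
  simp [push, pushAux]

theorem pushAux_cons (F : List X → X → R) (Ψ : List X → R) (acc : List X) (x : X) (l : List X) :
    pushAux F Ψ acc (x :: l) =
      splitSum (fun a b => ∑ K, F (acc ++ x :: a) K * push F (fun w => Ψ (K :: w)) b) l := by
  induction l generalizing acc x with
  | nil =>
    rw [splitSum_nil, pushAux.eq_3]
    cases acc <;> simp [push, pushAux]
  | cons y l ih =>
    rw [splitSum_cons, pushAux.eq_3, ih]
    simp [push]

theorem push_cons (F : List X → X → R) (Ψ : List X → R) (x : X) (l : List X) :
    push F Ψ (x :: l) =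
      splitSum (fun a b => ∑ K, F (x :: a) K * push F (fun w => Ψ (K :: w)) b) l :=
  pushAux_cons F Ψ [] x l

section Linear

variable (t : X → R) (η F : List X → X → R)

theorem dstar_add (Ψ Ψ' : List X → R) (l : List X) :
    dstar t η (fun w => Ψ w + Ψ' w) l = dstar t η Ψ l + dstar t η Ψ' l := by
  induction l generalizing Ψ Ψ' with
  | nil => simp [dstar]
  | cons x l ih =>
    simp only [dstar, ih, mul_add, Finset.sum_add_distrib, splitSum_add]
    ring

theorem dstar_mul_left (r : R) (Ψ : List X → R) (l : List X) :
    dstar t η (fun w => r * Ψ w) l = r * dstar t η Ψ l := by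
  induction l generalizing Ψ with
  | nil => simp [dstar]
  | cons x l ih =>
    simp only [dstar, ih, mul_add, mul_splitSum, Finset.mul_sum, mul_left_comm]

theorem dstar_mul_right (r : R) (Ψ : List X → R) (l : List X) :
    dstar t η (fun w => Ψ w * r) l = dstar t η Ψ l * r := by
  simp only [mul_comm _ r, dstar_mul_left]

theorem dstar_zero (l : List X) : dstar t η (fun _ => 0) l = 0 := by
  simpa using dstar_mul_left t η 0 (fun _ => 0) l

theorem dstar_sub (Ψ Ψ' : List X → R) (l : List X) :
    dstar t η (fun w => Ψ w - Ψ' w) l = dstar t η Ψ l - dstar t η Ψ' l := by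
  have h := dstar_add t η (fun w => Ψ w - Ψ' w) Ψ' l
  simp only [sub_add_cancel] at h
  exact eq_sub_of_add_eq h.symm

theorem dstar_sum {ι : Type*} (s : Finset ι) (Ψ : ι → List X → R) (l : List X) :
    dstar t η (fun w => ∑ i ∈ s, Ψ i w) l = ∑ i ∈ s, dstar t η (Ψ i) l := by
  classical
  induction s using Finset.induction_on with
  | empty => simp [dstar_zero]
  | insert i s hi ih => simp [Finset.sum_insert hi, dstar_add, ih]

theorem push_add (Ψ Ψ' : List X → R) (l : List X) :
    push F (fun w => Ψ w + Ψ' w) l = push F Ψ l + push F Ψ' l := by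
  induction h : l.length using Nat.strong_induction_on generalizing Ψ Ψ' l with
  | _ k ih =>
    cases l with
    | nil => simp [push_nil]
    | cons x l =>
      rw [push_cons, push_cons, push_cons, ← splitSum_add]
      refine splitSum_congr fun a b hab => ?_
      rw [← Finset.sum_add_distrib]
      refine Finset.sum_congr rfl fun K _ => ?_
      rw [ih b.length _ _ _ b rfl, mul_add]
      subst hab h
      grind

theorem push_mul_left (r : R) (Ψ : List X → R) (l : List X) :
    push F (fun w => r * Ψ w) l = r * push F Ψ l := by
  induction h : l.length using Nat.strong_induction_on generalizing Ψ l with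
  | _ k ih =>
    cases l with
    | nil => simp [push_nil]
    | cons x l =>
      rw [push_cons, push_cons, mul_splitSum]
      refine splitSum_congr fun a b hab => ?_
      rw [Finset.mul_sum]
      refine Finset.sum_congr rfl fun K _ => ?_
      rw [ih b.length _ _ b rfl, mul_left_comm]
      subst hab h
      grind

theorem push_mul_right (r : R) (Ψ : List X → R) (l : List X) :
    push F (fun w => Ψ w * r) l = push F Ψ l * r := by
  simp only [mul_comm _ r, push_mul_left]

theorem push_zero (l : List X) : push F (fun _ => 0) l = 0 := by
  simpa using push_mul_left F 0 (fun _ => 0) l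

theorem push_sub (Ψ Ψ' : List X → R) (l : List X) :
    push F (fun w => Ψ w - Ψ' w) l = push F Ψ l - push F Ψ' l := by
  have h := push_add F (fun w => Ψ w - Ψ' w) Ψ' l
  simp only [sub_add_cancel] at h
  exact eq_sub_of_add_eq h.symm

theorem push_sum {ι : Type*} (s : Finset ι) (Ψ : ι → List X → R) (l : List X) :
    push F (fun w => ∑ i ∈ s, Ψ i w) l = ∑ i ∈ s, push F (Ψ i) l := by
  classical
  induction s using Finset.induction_on with
  | empty => simp [push_zero]
  | insert i s hi ih => simp [Finset.sum_insert hi, push_add, ih]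

end Linear

section Identities

variable (t : X → R) (η F μ : List X → X → R)

/-- The map of bar constructions determined by `F` is compatible with cutting words in two. -/
theorem push_splitSum (f : List X → List X → R) (l : List X) :
    push F (fun w => splitSum f w) l =
      splitSum (fun a b => push F (fun w => push F (f w) b) a) l := by
  induction h : l.length using Nat.strong_induction_on generalizing f l with
  | _ k ih =>
    cases l with
    | nil => simp [push_nil, splitSum_nil]
    | cons x l =>
      have key : ∀ b : List X, b.length < k → ∀ K, push F (fun w => splitSum f (K :: w)) b =
          push F (f [] ∘ (K :: ·)) b +
            splitSum (fun a c => push F (fun w => push F (f (K :: w)) c) a) b := by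
        intro b hb K
        simp only [splitSum_cons]
        rw [push_add, ih b.length hb _ b rfl]
        rfl
      rw [push_cons, splitSum_cons]
      simp only [push_nil, push_cons, splitSum_sum]
      rw [← Finset.sum_add_distrib]
      refine Finset.sum_congr rfl fun K _ => ?_
      rw [splitSum_assoc (fun a b c => F (x :: a) K *
        push F (fun w => push F (f (K :: w)) c) b), ← splitSum_add]
      refine splitSum_congr fun a b hab => ?_
      rw [key b (by subst hab h; grind), mul_add, mul_splitSum]
      rfl

/-- The map determined by `η` is a coderivation. -/
theorem dstar_splitSum (f : List X → List X → R) (l : List X) :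
    dstar t η (fun w => splitSum f w) l =
      splitSum (fun a b => dstar t η (fun w => f w b) a) l +
        splitSum (fun a b => (a.map t).prod * dstar t η (f a) b) l := by
  induction l generalizing f with
  | nil => simp [dstar, splitSum_nil]
  | cons x l ih =>
    simp only [dstar, splitSum_cons, dstar_add, ih, mul_add, Finset.sum_add_distrib, splitSum_add,
      List.map_nil, List.prod_nil, one_mul, List.map_cons, List.prod_cons, mul_splitSum, zero_add]
    have h := splitSum_assoc (fun a b c => ∑ K, η (x :: a) K * f (K :: b) c) l
    simp only [splitSum_sum] at h ⊢
    rw [h]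
    simp only [mul_assoc]
    abel

/-- An `A_∞` structure makes the bar construction a complex. -/
theorem dstar_dstar
    (hη : ∀ l K, (l.map t).prod * η l K = - (t K * η l K))
    (hrel : ∀ K l, dstar t η (fun w => η w K) l = 0) (Ψ : List X → R) (l : List X) :
    dstar t η (fun w => dstar t η Ψ w) l = 0 := by
  induction l generalizing Ψ with
  | nil => simp [dstar]
  | cons x l ih =>
    have hr : ∀ K a, splitSum (fun a b => ∑ J, η (x :: a) J * η (J :: b) K) a +
        t x * dstar t η (fun w => η (x :: w) K) a = 0 := fun K a => by
      simpa [dstar] using hrel K (x :: a)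
    simp only [dstar, dstar_add, dstar_splitSum, dstar_mul_left, ih, dstar_sum, dstar_mul_right,
      mul_zero, add_zero, mul_add, Finset.sum_add_distrib, splitSum_add]
    have h := splitSum_assoc (fun a b c => ∑ J, ∑ K, η (x :: a) J * (η (J :: b) K * Ψ (K :: c))) l
    simp only [Finset.mul_sum, splitSum_sum, mul_splitSum] at h ⊢
    rw [← h]
    have e1 : ∑ J, ∑ K, splitSum (fun w c => splitSum (fun a b =>
          η (x :: a) J * (η (J :: b) K * Ψ (K :: c))) w) l +
        ∑ K, splitSum (fun a b => t x * (dstar t η (fun w => η (x :: w) K) a * Ψ (K :: b))) l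
          = 0 := by
      rw [Finset.sum_comm, ← Finset.sum_add_distrib]
      refine Finset.sum_eq_zero fun K _ => ?_
      rw [← splitSum_sum, ← splitSum_add, ← splitSum_zero l]
      refine splitSum_congr fun a b _ => ?_
      have := congrArg (· * Ψ (K :: b)) (hr K a)
      simp only [add_mul, zero_mul, splitSum_mul, Finset.sum_mul, mul_assoc, splitSum_sum] at this
      exact this
    have e2 : ∑ K, splitSum (fun a b => η (x :: a) K *
          (t K * dstar t η (fun w => Ψ (K :: w)) b)) l +
        ∑ K, splitSum (fun a b => t x * ((a.map t).prod *
          (η (x :: a) K * dstar t η (fun w => Ψ (K :: w)) b))) l = 0 := by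
      rw [← Finset.sum_add_distrib]
      refine Finset.sum_eq_zero fun K _ => ?_
      rw [← splitSum_add, ← splitSum_zero l]
      refine splitSum_congr fun a b _ => ?_
      have := hη (x :: a) K
      simp only [List.map_cons, List.prod_cons] at this
      linear_combination dstar t η (fun w => Ψ (K :: w)) b * this
    linear_combination e1 + e2

/-- The failure of the family `F` to intertwine `η` and `μ`. -/
def defect (K : X) (l : List X) : R :=
  push F (fun w => μ w K) l - dstar t η (fun w => F w K) l

/-- The failure of the map of bar constructions determined by `F` to be a chain map, precomposed
to a functional `Ψ`. -/
def defectStar (Ψ : List X → R) (l : List X) : R :=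
  push F (fun w => dstar t μ Ψ w) l - dstar t η (fun w => push F Ψ w) l

theorem defectStar_nil (Ψ : List X → R) : defectStar t η F μ Ψ [] = 0 := by
  simp [defectStar, push_nil, dstar]

/-- The first half of `defectStar_cons`; its first sum consists of the terms in which `μ` reads the
value of `F` on the first block. -/
theorem push_dstar_cons (Ψ : List X → R) (x : X) (l : List X) :
    push F (fun w => dstar t μ Ψ w) (x :: l) =
      splitSum (fun a b => ∑ K, push F (fun w => μ w K) (x :: a) *
        push F (fun w => Ψ (K :: w)) b) l +
      splitSum (fun a b => ∑ K, t K * F (x :: a) K *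
        push F (fun w => dstar t μ (fun w => Ψ (K :: w)) w) b) l := by
  simp only [push_cons, dstar, push_add, push_mul_left, push_splitSum, push_sum, push_mul_right,
    mul_add, Finset.sum_add_distrib, splitSum_add]
  congr 1
  · have h := splitSum_assoc (fun a b c => ∑ L, ∑ K, F (x :: a) L * (push F (fun w => μ (L :: w) K)
      b * push F (fun w => Ψ (K :: w)) c)) l
    simp only [Finset.mul_sum, Finset.sum_mul, splitSum_sum, mul_splitSum, splitSum_mul,
      mul_assoc] at h ⊢
    rw [← h, Finset.sum_comm]
  · simp only [splitSum_sum, mul_left_comm, mul_assoc]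

/-- The second half of `defectStar_cons`; the hypothesis on `F` says that `F` preserves parity. -/
theorem dstar_push_cons (hF : ∀ l K, (l.map t).prod * F l K = t K * F l K)
    (Ψ : List X → R) (x : X) (l : List X) :
    dstar t η (fun w => push F Ψ w) (x :: l) =
      splitSum (fun a b => ∑ K, dstar t η (fun w => F w K) (x :: a) *
        push F (fun w => Ψ (K :: w)) b) l +
      splitSum (fun a b => ∑ K, t K * F (x :: a) K *
        dstar t η (fun w => push F (fun w => Ψ (K :: w)) w) b) l := by
  simp only [dstar, push_cons, dstar_splitSum, dstar_sum, dstar_mul_left, dstar_mul_right,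
    mul_add, add_mul, Finset.sum_add_distrib, splitSum_add]
  have h := splitSum_assoc (fun a b c => ∑ L, ∑ K, η (x :: a) L * (F (L :: b) K *
      push F (fun w => Ψ (K :: w)) c)) l
  have e : ∀ a b : List X, ∑ K, t K * F (x :: a) K *
        dstar t η (fun w => push F (fun w => Ψ (K :: w)) w) b = ∑ K, t x * ((a.map t).prod *
        (F (x :: a) K * dstar t η (fun w => push F (fun w => Ψ (K :: w)) w) b)) := by
    intro a b
    refine Finset.sum_congr rfl fun K _ => ?_
    have := hF (x :: a) K
    simp only [List.map_cons, List.prod_cons] at this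
    rw [← this]
    ring
  simp only [e]
  simp only [Finset.mul_sum, Finset.sum_mul, splitSum_sum, mul_splitSum, splitSum_mul,
      mul_assoc] at h ⊢
  rw [← h, Finset.sum_comm, add_assoc]

/-- The failure to be a chain map is a coderivation along the map determined by `F`. -/
theorem defectStar_cons (hF : ∀ l K, (l.map t).prod * F l K = t K * F l K)
    (Ψ : List X → R) (x : X) (l : List X) :
    defectStar t η F μ Ψ (x :: l) =
      splitSum (fun a b => ∑ K, defect t η F μ K (x :: a) * push F (fun w => Ψ (K :: w)) b) l +
      splitSum (fun a b => ∑ K, t K * F (x :: a) K *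
        defectStar t η F μ (fun w => Ψ (K :: w)) b) l := by
  simp only [defectStar, defect, push_dstar_cons, dstar_push_cons t η F hF, sub_mul, mul_sub,
    Finset.sum_sub_distrib, splitSum_sub]
  ring

/-- The defect of a family satisfies a cocycle equation. -/
theorem defectStar_add_dstar_defect
    (hη : ∀ l K, (l.map t).prod * η l K = - (t K * η l K))
    (hrel : ∀ K l, dstar t η (fun w => η w K) l = 0)
    (hrel' : ∀ K l, dstar t μ (fun w => μ w K) l = 0) (K : X) (l : List X) :
    defectStar t η F μ (fun w => μ w K) l + dstar t η (defect t η F μ K) l = 0 := by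
  have h1 : push F (fun w => dstar t μ (fun w => μ w K) w) l = 0 := by
    simp only [hrel', push_zero]
  have h2 : dstar t η (defect t η F μ K) l = dstar t η (fun w => push F (fun w => μ w K) w) l := by
    unfold defect
    rw [dstar_sub, dstar_dstar t η hη hrel, sub_zero]
  rw [defectStar, h1, h2]
  ring

end Identities

end Words

/-! ### The exterior algebra in coordinates -/

section ExteriorAlgebra

variable {n : ℕ}

/-- The basis of `Λ^* ℂ^n` by the ordered monomials `θ_I`. -/
noncomputable def extBasis (n : ℕ) : Module.Basis (Finset (Fin n)) ℂ (extAlg n) :=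
  (Pi.basisFun ℂ (Fin n)).ExteriorAlgebra

theorem extBasis_apply (I : Finset (Fin n)) :
    extBasis n I = ((I.sort (· ≤ ·)).map (θ n)).prod := by
  have : extBasis n I = (List.ofFn fun i => θ n (I.orderEmbOfFin rfl i)).prod := by
    rw [extBasis, ExteriorAlgebra.basis_apply_ofCard _ rfl, ExteriorAlgebra.ιMulti_family,
      ExteriorAlgebra.ιMulti_apply]
    congr 2
    funext i
    simp only [θ, Function.comp, Pi.basisFun_apply]
    rfl
  rw [this]
  congr 1
  refine List.ext_getElem (by simp) fun i h1 h2 => ?_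
  rw [List.getElem_ofFn, List.getElem_map, Finset.orderEmbOfFin_apply]
  rfl

theorem extBasis_empty : extBasis n ∅ = 1 := by simp [extBasis_apply]

theorem extBasis_singleton (j : Fin n) : extBasis n {j} = θ n j := by simp [extBasis_apply]

/-- The product of two basis elements, up to a sign that is left unspecified. -/
theorem extBasis_mul (I J : Finset (Fin n)) :
    (¬ Disjoint I J ∧ extBasis n I * extBasis n J = 0) ∨
      (Disjoint I J ∧ ∃ u : ℤˣ, extBasis n I * extBasis n J = u • extBasis n (I ∪ J)) := by
  by_cases h : Disjoint I J
  · right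
    have h1 := ExteriorAlgebra.basis_mul_of_disjoint (Pi.basisFun ℂ (Fin n))
      (Set.powersetCard.ofCard (s := I) rfl) (Set.powersetCard.ofCard (s := J) rfl) h
    have h2 : (Set.powersetCard.disjUnion (s := Set.powersetCard.ofCard (s := I) rfl)
      (t := Set.powersetCard.ofCard (s := J) rfl) h : Finset (Fin n)) = I ∪ J := by
      simp [Set.powersetCard.disjUnion, Set.powersetCard.ofCard]
    rw [h2] at h1
    exact ⟨h, _, h1⟩
  · left
    exact ⟨h, ExteriorAlgebra.basis_mul_of_not_disjoint (Pi.basisFun ℂ (Fin n))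
      (Set.powersetCard.ofCard (s := I) rfl) (Set.powersetCard.ofCard (s := J) rfl) h⟩

theorem repr_mul_ne_zero {I J K : Finset (Fin n)}
    (h : (extBasis n).repr (extBasis n I * extBasis n J) K ≠ 0) :
    Disjoint I J ∧ K = I ∪ J := by
  rcases extBasis_mul I J with ⟨_, h0⟩ | ⟨hd, u, h0⟩
  · simp [h0] at h
  · refine ⟨hd, ?_⟩
    by_contra hK
    rcases Int.units_eq_one_or u with rfl | rfl <;> simp [h0, Ne.symm hK] at h

theorem repr_mul_left (y : extAlg n) (I K : Finset (Fin n)) :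
    (extBasis n).repr (y * extBasis n I) K =
      ∑ L, (extBasis n).repr y L * (extBasis n).repr (extBasis n L * extBasis n I) K := by
  conv_lhs => rw [← (extBasis n).sum_repr y, Finset.sum_mul]
  simp [Finsupp.finsetSum_apply]

theorem repr_mul_right (y : extAlg n) (I K : Finset (Fin n)) :
    (extBasis n).repr (extBasis n I * y) K =
      ∑ L, (extBasis n).repr y L * (extBasis n).repr (extBasis n I * extBasis n L) K := by
  conv_lhs => rw [← (extBasis n).sum_repr y, Finset.mul_sum]
  simp [Finsupp.finsetSum_apply]

theorem θ_mul_θ (j k : Fin n) : θ n j * θ n k = - (θ n k * θ n j) :=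
  eq_neg_of_add_eq_zero_left (ExteriorAlgebra.ι_add_mul_swap _ _)

theorem list_prod_mul_θ (l : List (Fin n)) (k : Fin n) :
    (l.map (θ n)).prod * θ n k = (-1 : ℂ) ^ l.length • (θ n k * (l.map (θ n)).prod) := by
  induction l with
  | nil => simp
  | cons j l ih =>
    rw [List.map_cons, List.prod_cons, mul_assoc, ih, mul_smul_comm, ← mul_assoc, θ_mul_θ j k,
      List.length_cons, pow_succ, mul_neg_one, neg_smul, neg_mul, smul_neg, mul_assoc]

theorem extBasis_mul_θ (I : Finset (Fin n)) (k : Fin n) :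
    extBasis n I * θ n k = (-1 : ℂ) ^ I.card • (θ n k * extBasis n I) := by
  rw [extBasis_apply, list_prod_mul_θ, Finset.length_sort]

/-- Interior multiplication with the `j`-th coordinate function. -/
noncomputable def contract (j : Fin n) : extAlg n →ₗ[ℂ] extAlg n :=
  CliffordAlgebra.contractLeft (Q := (0 : QuadraticForm ℂ (Fin n → ℂ))) (LinearMap.proj j)

theorem contract_θ_mul (j k : Fin n) (y : extAlg n) :
    contract j (θ n k * y) = (if j = k then y else 0) - θ n k * contract j y := by
  have := CliffordAlgebra.contractLeft_ι_mul (Q := (0 : QuadraticForm ℂ (Fin n → ℂ)))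
    (d := LinearMap.proj j) (Pi.single k 1) y
  refine this.trans ?_
  congr 1
  by_cases h : j = k
  · subst h; simp
  · simp [h]

theorem contract_one (j : Fin n) : contract j (1 : extAlg n) = 0 :=
  CliffordAlgebra.contractLeft_one (Q := (0 : QuadraticForm ℂ (Fin n → ℂ))) _

theorem sum_θ_mul_contract (l : List (Fin n)) :
    ∑ j, θ n j * contract j (l.map (θ n)).prod = (l.length : ℂ) • (l.map (θ n)).prod := by
  induction l with
  | nil => simp [contract_one]
  | cons k l ih =>
    simp only [List.map_cons, List.prod_cons, contract_θ_mul, mul_sub, Finset.sum_sub_distrib]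
    have : ∀ j, θ n j * (θ n k * contract j (l.map (θ n)).prod) =
        - (θ n k * (θ n j * contract j (l.map (θ n)).prod)) := fun j => by
      rw [← mul_assoc, θ_mul_θ, neg_mul, mul_assoc]
    simp only [this, Finset.sum_neg_distrib, ← Finset.mul_sum, ih]
    simp [add_smul, add_comm]

theorem repr_contract_ne_zero_list {j : Fin n} (l : List (Fin n)) {K : Finset (Fin n)}
    (h : (extBasis n).repr (contract j (l.map (θ n)).prod) K ≠ 0) : K.card + 1 = l.length := by
  have hprod : ∀ (l : List (Fin n)) (K : Finset (Fin n)),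
      (extBasis n).repr (l.map (θ n)).prod K ≠ 0 → K.card = l.length := by
    intro l
    induction l with
    | nil =>
      intro K h
      simp only [List.map_nil, List.prod_nil, ← extBasis_empty, Module.Basis.repr_self] at h
      rw [Finsupp.single_apply_ne_zero] at h
      simp [h.1]
    | cons k l ih =>
      intro K h
      rw [List.map_cons, List.prod_cons, ← extBasis_singleton, repr_mul_right] at h
      obtain ⟨L, -, hL⟩ := Finset.exists_ne_zero_of_sum_ne_zero h
      have h1 := ih L (left_ne_zero_of_mul hL)
      obtain ⟨hd, rfl⟩ := repr_mul_ne_zero (right_ne_zero_of_mul hL)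
      rw [Finset.card_union_of_disjoint hd, h1]
      simp [add_comm]
  induction l generalizing K with
  | nil => simp [contract_one] at h
  | cons k l ih =>
    rw [List.map_cons, List.prod_cons, contract_θ_mul, map_sub, Finsupp.sub_apply] at h
    by_cases h1 : (extBasis n).repr (θ n k * contract j (l.map (θ n)).prod) K = 0
    · rw [h1, sub_zero] at h
      split_ifs at h with hjk
      · simp [hprod _ _ h]
      · simp at h
    · rw [← extBasis_singleton, repr_mul_right] at h1
      obtain ⟨L, -, hL⟩ := Finset.exists_ne_zero_of_sum_ne_zero h1
      have h1 := ih (left_ne_zero_of_mul hL)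
      obtain ⟨hd, rfl⟩ := repr_mul_ne_zero (right_ne_zero_of_mul hL)
      rw [Finset.card_union_of_disjoint hd]
      simp; omega

/-- The structure constants of the exterior product in the sign convention of `A_∞` algebras:
`m²(θ_J, θ_I) = (-1)^{|I|} θ_J ∧ θ_I = ∑_K extMul I J K • θ_K`. -/
noncomputable def extMul (I J K : Finset (Fin n)) : ℂ :=
  (-1) ^ I.card * (extBasis n).repr (extBasis n J * extBasis n I) K

/-- The matrix of interior multiplication, with the sign that makes it anticommute with
`extMul`. -/
noncomputable def extCtr (j : Fin n) (I K : Finset (Fin n)) : ℂ :=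
  (-1) ^ I.card * (extBasis n).repr (contract j (extBasis n I)) K

/-- The parity of the basis element `θ_I`, shifted by one, as a sign in the ring `R`. -/
def sgnShift (R : Type*) [CommRing R] (I : Finset (Fin n)) : R := (-1) ^ (I.card + 1)

theorem extMul_ne_zero {I J K : Finset (Fin n)} (h : extMul I J K ≠ 0) :
    Disjoint I J ∧ K = I ∪ J := by
  obtain ⟨h1, h2⟩ := repr_mul_ne_zero (right_ne_zero_of_mul h)
  exact ⟨h1.symm, by rw [h2, Finset.union_comm]⟩

theorem card_of_extMul_ne_zero {I J K : Finset (Fin n)} (h : extMul I J K ≠ 0) :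
    K.card = I.card + J.card := by
  obtain ⟨h1, rfl⟩ := extMul_ne_zero h
  exact Finset.card_union_of_disjoint h1

theorem extMul_empty_left (J K : Finset (Fin n)) :
    extMul ∅ J K = if J = K then 1 else 0 := by
  simp [extMul, extBasis_empty, Finsupp.single_apply]

theorem extMul_empty_right (I K : Finset (Fin n)) :
    extMul I ∅ K = if I = K then (-1) ^ I.card else 0 := by
  simp [extMul, extBasis_empty, Finsupp.single_apply]

theorem extMul_singleton_left (k : Fin n) (I K : Finset (Fin n)) :
    extMul {k} I K = (-1) ^ (I.card + 1) * (extBasis n).repr (θ n k * extBasis n I) K := by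
  rw [extMul, extBasis_singleton, extBasis_mul_θ]
  simp [pow_succ]

theorem extMul_singleton_singleton (j k : Fin n) (K : Finset (Fin n)) :
    extMul {j} {k} K + extMul {k} {j} K = 0 := by
  simp only [extMul, extBasis_singleton, Finset.card_singleton]
  rw [θ_mul_θ k j]
  simp

theorem neg_one_pow_mul_self {R : Type*} [CommRing R] (k : ℕ) : (-1 : R) ^ k * (-1) ^ k = 1 := by
  rw [← mul_pow]; simp

/-- The signed exterior product satisfies the `A_∞` relation. -/
theorem extMul_assoc (I J K N : Finset (Fin n)) :
    ∑ L, extMul I J L * extMul L K N +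
      sgnShift ℂ I * ∑ L, extMul J K L * extMul I L N = 0 := by
  have h1 : ∑ L, extMul I J L * extMul L K N =
      (-1) ^ J.card * (extBasis n).repr (extBasis n K * (extBasis n J * extBasis n I)) N := by
    rw [repr_mul_right, Finset.mul_sum]
    refine Finset.sum_congr rfl fun L _ => ?_
    by_cases h : extMul I J L = 0
    · have : (extBasis n).repr (extBasis n J * extBasis n I) L = 0 := by simpa [extMul] using h
      simp [h, this]
    · rw [extMul, extMul, card_of_extMul_ne_zero h, pow_add]
      linear_combination ((-1) ^ J.card * (extBasis n).repr (extBasis n J * extBasis n I) L *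
        (extBasis n).repr (extBasis n K * extBasis n L) N) * neg_one_pow_mul_self (R := ℂ) I.card
  have h2 : ∑ L, extMul J K L * extMul I L N =
      (-1) ^ J.card * (-1) ^ I.card *
        (extBasis n).repr (extBasis n K * (extBasis n J * extBasis n I)) N := by
    rw [← mul_assoc, repr_mul_left, Finset.mul_sum]
    refine Finset.sum_congr rfl fun L _ => ?_
    rw [extMul, extMul]
    ring
  rw [h1, h2, sgnShift, pow_succ]
  linear_combination (-(-1) ^ J.card * (extBasis n).repr (extBasis n K * (extBasis n J *
    extBasis n I)) N) * neg_one_pow_mul_self (R := ℂ) I.card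

theorem extCtr_ne_zero {j : Fin n} {I K : Finset (Fin n)} (h : extCtr j I K ≠ 0) :
    K.card + 1 = I.card := by
  have := right_ne_zero_of_mul h
  rw [extBasis_apply] at this
  simpa using repr_contract_ne_zero_list _ this

/-- Interior multiplication and exterior multiplication generate a Clifford algebra. -/
theorem extMul_extCtr (j k : Fin n) (I K : Finset (Fin n)) :
    ∑ L, extMul {k} I L * extCtr j L K + ∑ L, extCtr j I L * extMul {k} L K =
      if j = k ∧ I = K then 1 else 0 := by
  have h1 : ∑ L, extMul {k} I L * extCtr j L K =
      (extBasis n).repr (contract j (θ n k * extBasis n I)) K := by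
    conv_rhs => rw [← (extBasis n).sum_repr (θ n k * extBasis n I)]
    simp only [map_sum, map_smul, Finsupp.finsetSum_apply, Finsupp.smul_apply, smul_eq_mul]
    refine Finset.sum_congr rfl fun L _ => ?_
    by_cases h : extMul {k} I L = 0
    · have : (extBasis n).repr (θ n k * extBasis n I) L = 0 := by
        simpa [extMul_singleton_left] using h
      simp [h, this]
    · have hc := card_of_extMul_ne_zero h
      rw [extMul_singleton_left, extCtr, hc, Finset.card_singleton, add_comm 1]
      linear_combination ((extBasis n).repr (θ n k * extBasis n I) L * (extBasis n).repr
        (contract j (extBasis n L)) K) * neg_one_pow_mul_self (R := ℂ) (I.card + 1)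
  have h2 : ∑ L, extCtr j I L * extMul {k} L K =
      (extBasis n).repr (θ n k * contract j (extBasis n I)) K := by
    rw [← extBasis_singleton, repr_mul_right]
    refine Finset.sum_congr rfl fun L _ => ?_
    by_cases h : extCtr j I L = 0
    · have : (extBasis n).repr (contract j (extBasis n I)) L = 0 := by
        simpa [extCtr] using h
      simp [h, this]
    · rw [extMul_singleton_left, extCtr, extCtr_ne_zero h, extBasis_singleton]
      linear_combination ((extBasis n).repr (contract j (extBasis n I)) L * (extBasis n).repr
        (θ n k * extBasis n L) K) * neg_one_pow_mul_self (R := ℂ) I.card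
  rw [h1, h2, ← Finsupp.add_apply, ← map_add, contract_θ_mul, sub_add_cancel]
  by_cases hjk : j = k <;> simp [hjk, Finsupp.single_apply]

/-- Euler's identity `∑_j θ_j ∂_j = |I|` on `θ_I`. -/
theorem sum_extCtr_extMul (I K : Finset (Fin n)) :
    ∑ j, ∑ L, extCtr j I L * extMul {j} L K = if I = K then (I.card : ℂ) else 0 := by
  have h2 : ∀ j, ∑ L, extCtr j I L * extMul {j} L K =
      (extBasis n).repr (θ n j * contract j (extBasis n I)) K := fun j => by
    rw [← extBasis_singleton, repr_mul_right]
    refine Finset.sum_congr rfl fun L _ => ?_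
    by_cases h : extCtr j I L = 0
    · have : (extBasis n).repr (contract j (extBasis n I)) L = 0 := by
        simpa [extCtr] using h
      simp [h, this]
    · rw [extMul_singleton_left, extCtr, extCtr_ne_zero h, extBasis_singleton]
      linear_combination ((extBasis n).repr (contract j (extBasis n I)) L * (extBasis n).repr
        (θ n j * extBasis n L) K) * neg_one_pow_mul_self (R := ℂ) I.card
  have h3 := sum_θ_mul_contract (I.sort (· ≤ ·))
  rw [← extBasis_apply, Finset.length_sort] at h3
  simp only [h2]
  rw [← Finsupp.finsetSum_apply, ← map_sum, h3]
  simp [Finsupp.single_apply]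

end ExteriorAlgebra

/-! ### The bar complex with trivial coefficients -/

section BarComplex

variable {n : ℕ} {V V' : Type*} [AddCommGroup V] [AddCommGroup V']

/-- The part of the bar differential that applies the augmentation to the first letter. -/
def headAug (φ : List (Finset (Fin n)) → V) : List (Finset (Fin n)) → V
  | [] => 0
  | x :: l => if x = ∅ then φ l else 0

theorem headAug_eq_zero {φ : List (Finset (Fin n)) → V} {l : List (Finset (Fin n))}
    (h : ∀ w, w.length + 1 = l.length → φ w = 0) : headAug φ l = 0 := by
  cases l with
  | nil => rfl
  | cons x l => simp [headAug, h l (by simp)]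

theorem headAug_add (φ ψ : List (Finset (Fin n)) → V) (l : List (Finset (Fin n))) :
    headAug (fun w => φ w + ψ w) l = headAug φ l + headAug ψ l := by
  cases l with
  | nil => simp [headAug]
  | cons x l => simp only [headAug]; split_ifs <;> simp

theorem headAug_neg (φ : List (Finset (Fin n)) → V) (l : List (Finset (Fin n))) :
    headAug (fun w => - φ w) l = - headAug φ l := by
  cases l with
  | nil => simp [headAug]
  | cons x l => simp only [headAug]; split_ifs <;> simp

variable [Module ℂ V] [Module ℂ V']

/-- Multiplication of the letter `x` into the first letter of a word, precomposed to a functional;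
on the empty word, `x` acts on the trivial module through the augmentation. -/
noncomputable def consMul (φ : List (Finset (Fin n)) → V) (x : Finset (Fin n)) :
    List (Finset (Fin n)) → V
  | [] => if x = ∅ then φ [] else 0
  | y :: l => ∑ K, extMul x y K • φ (K :: l)

/-- The part of `barDiff` that multiplies neighbouring letters or applies the augmentation to the
last letter. -/
noncomputable def barStar : (List (Finset (Fin n)) → V) → List (Finset (Fin n)) → V
  | _, [] => 0
  | φ, x :: l => consMul φ x l + sgnShift ℂ x • barStar (fun w => φ (x :: w)) l

/-- The differential of Hochschild cochains of the exterior algebra with coefficients in a trivial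
bimodule, on functionals on words of basis elements. -/
noncomputable def barDiff (φ : List (Finset (Fin n)) → V) (l : List (Finset (Fin n))) : V :=
  barStar φ l - headAug φ l

theorem barStar_eq_zero {φ : List (Finset (Fin n)) → V} {l : List (Finset (Fin n))}
    (h : ∀ w, w.length + 1 = l.length → φ w = 0) : barStar φ l = 0 := by
  induction l generalizing φ with
  | nil => rfl
  | cons x l ih =>
    rw [barStar, ih (fun w hw => h _ (by simp [hw])), smul_zero, add_zero]
    cases l with
    | nil => simp [consMul, h [] (by simp)]
    | cons y l => exact Finset.sum_eq_zero fun K _ => by rw [h _ (by simp), smul_zero]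

theorem barDiff_eq_zero {φ : List (Finset (Fin n)) → V} {l : List (Finset (Fin n))}
    (h : ∀ w, w.length + 1 = l.length → φ w = 0) : barDiff φ l = 0 := by
  rw [barDiff, barStar_eq_zero h, headAug_eq_zero h, sub_zero]

theorem consMul_map (f : V →ₗ[ℂ] V') (φ : List (Finset (Fin n)) → V) (x : Finset (Fin n))
    (l : List (Finset (Fin n))) : consMul (fun w => f (φ w)) x l = f (consMul φ x l) := by
  cases l with
  | nil => simp only [consMul]; split_ifs <;> simp
  | cons y l => simp [consMul]

theorem barStar_map (f : V →ₗ[ℂ] V') (φ : List (Finset (Fin n)) → V)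
    (l : List (Finset (Fin n))) : barStar (fun w => f (φ w)) l = f (barStar φ l) := by
  induction l generalizing φ with
  | nil => simp [barStar]
  | cons x l ih => simp [barStar, ih, consMul_map]

theorem consMul_add (φ ψ : List (Finset (Fin n)) → V) (x : Finset (Fin n))
    (l : List (Finset (Fin n))) :
    consMul (fun w => φ w + ψ w) x l = consMul φ x l + consMul ψ x l := by
  cases l with
  | nil => simp only [consMul]; split_ifs <;> simp
  | cons y l => simp [consMul, Finset.sum_add_distrib]

theorem barStar_add (φ ψ : List (Finset (Fin n)) → V) (l : List (Finset (Fin n))) :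
    barStar (fun w => φ w + ψ w) l = barStar φ l + barStar ψ l := by
  induction l generalizing φ ψ with
  | nil => simp [barStar]
  | cons x l ih => simp only [barStar, ih, consMul_add, smul_add]; abel

theorem barStar_neg (φ : List (Finset (Fin n)) → V) (l : List (Finset (Fin n))) :
    barStar (fun w => - φ w) l = - barStar φ l :=
  barStar_map (-LinearMap.id) φ l

theorem barStar_smul (c : ℂ) (φ : List (Finset (Fin n)) → V) (l : List (Finset (Fin n))) :
    barStar (fun w => c • φ w) l = c • barStar φ l :=
  barStar_map (c • LinearMap.id) φ l

theorem barStar_sum {ι : Type*} (s : Finset ι) (φ : ι → List (Finset (Fin n)) → V)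
    (l : List (Finset (Fin n))) :
    barStar (fun w => ∑ i ∈ s, φ i w) l = ∑ i ∈ s, barStar (φ i) l := by
  classical
  induction s using Finset.induction_on with
  | empty => simpa using barStar_eq_zero (φ := fun _ => (0 : V)) (l := l) (by simp)
  | insert i s hi ih => simp [Finset.sum_insert hi, barStar_add, ih]

theorem barStar_zero (l : List (Finset (Fin n))) : barStar (fun _ => (0 : V)) l = 0 :=
  barStar_eq_zero (by simp)

theorem barDiff_add (φ ψ : List (Finset (Fin n)) → V) (l : List (Finset (Fin n))) :
    barDiff (fun w => φ w + ψ w) l = barDiff φ l + barDiff ψ l := by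
  simp only [barDiff, barStar_add, headAug_add]; abel

theorem barDiff_sub (φ ψ : List (Finset (Fin n)) → V) (l : List (Finset (Fin n))) :
    barDiff (fun w => φ w - ψ w) l = barDiff φ l - barDiff ψ l := by
  simp only [sub_eq_add_neg, barDiff_add]
  simp only [barDiff, barStar_neg, headAug_neg]; abel

theorem barDiff_congr {φ ψ : List (Finset (Fin n)) → V} {l : List (Finset (Fin n))}
    (h : ∀ w, w.length + 1 = l.length → φ w = ψ w) : barDiff φ l = barDiff ψ l := by
  rw [← sub_eq_zero, ← barDiff_sub]
  exact barDiff_eq_zero fun w hw => sub_eq_zero.2 (h w hw)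

theorem sgnShift_of_extMul_ne_zero {x y K : Finset (Fin n)} (h : extMul x y K ≠ 0) :
    sgnShift ℂ K = - (sgnShift ℂ x * sgnShift ℂ y) := by
  rw [sgnShift, sgnShift, sgnShift, card_of_extMul_ne_zero h]
  ring

theorem extMul_smul_sgnShift (x y K : Finset (Fin n)) (v : V) :
    extMul x y K • sgnShift ℂ K • v = - (sgnShift ℂ x • sgnShift ℂ y • extMul x y K • v) := by
  by_cases h : extMul x y K = 0
  · simp [h]
  · rw [sgnShift_of_extMul_ne_zero h]
    module

theorem extMul_apply_empty (x y : Finset (Fin n)) :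
    extMul x y ∅ = if x = ∅ ∧ y = ∅ then 1 else 0 := by
  split_ifs with h
  · rw [h.1, h.2, extMul_empty_left]; simp
  · by_contra h0
    have := card_of_extMul_ne_zero h0
    simp only [Finset.card_empty] at this
    exact h ⟨Finset.card_eq_zero.1 (by omega), Finset.card_eq_zero.1 (by omega)⟩

theorem consMul_consMul (φ : List (Finset (Fin n)) → V) (x y : Finset (Fin n))
    (l : List (Finset (Fin n))) :
    ∑ K, extMul x y K • consMul φ K l + sgnShift ℂ x • consMul (consMul φ x) y l = 0 := by
  cases l with
  | nil =>
    simp only [consMul, smul_ite, smul_zero, Finset.sum_ite_eq', Finset.mem_univ, if_true,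
      extMul_apply_empty]
    by_cases hx : x = ∅ <;> by_cases hy : y = ∅ <;> simp [hx, hy, sgnShift]
  | cons z l =>
    simp only [consMul, Finset.smul_sum, smul_smul]
    rw [Finset.sum_comm, Finset.sum_comm (s := Finset.univ) (t := Finset.univ)
      (f := fun K N => (sgnShift ℂ x * (extMul y z K * extMul x K N)) • φ (N :: l)),
      ← Finset.sum_add_distrib]
    refine Finset.sum_eq_zero fun N _ => ?_
    rw [← Finset.sum_smul, ← Finset.sum_smul, ← add_smul, ← Finset.mul_sum, extMul_assoc, zero_smul]

theorem consMul_barStar (φ : List (Finset (Fin n)) → V) (x : Finset (Fin n))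
    (l : List (Finset (Fin n))) :
    consMul (barStar φ) x l + sgnShift ℂ x • barStar (consMul φ x) l = 0 := by
  cases l with
  | nil => simp [consMul, barStar]
  | cons y l =>
    have h := consMul_consMul φ x y l
    have e : barStar (fun w => consMul φ x (y :: w)) l =
        ∑ K, extMul x y K • barStar (fun w => φ (K :: w)) l := by
      simp only [consMul, barStar_sum, barStar_smul]
    rw [consMul, barStar, e]
    simp only [barStar, smul_add, Finset.sum_add_distrib, extMul_smul_sgnShift,
      Finset.smul_sum, Finset.sum_neg_distrib]
    rw [← h]; abel

theorem barStar_barStar (φ : List (Finset (Fin n)) → V) (l : List (Finset (Fin n))) :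
    barStar (barStar φ) l = 0 := by
  induction l generalizing φ with
  | nil => rfl
  | cons x l ih =>
    have h := consMul_barStar φ x l
    have h2 := ih (fun w => φ (x :: w))
    simp only [barStar, barStar_add, barStar_smul, smul_add]
    rw [h2, smul_zero, smul_zero, add_zero, h]

theorem barDiff_barDiff (φ : List (Finset (Fin n)) → V) (l : List (Finset (Fin n))) :
    barDiff (barDiff φ) l = 0 := by
  have h : headAug (barStar φ) l + barStar (headAug φ) l = headAug (headAug φ) l := by
    cases l with
    | nil => simp [headAug, barStar]
    | cons x l =>
      have h1 : barStar (fun w => headAug φ (x :: w)) l =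
          if x = ∅ then barStar φ l else 0 := by
        by_cases hx : x = ∅
        · simp [headAug, hx]
        · simpa [headAug, hx] using barStar_zero l
      have h2 : consMul (headAug φ) x l = if x = ∅ then headAug φ l else 0 := by
        cases l with
        | nil => simp [consMul, headAug]
        | cons y l =>
          simp only [consMul, headAug, smul_ite, smul_zero, Finset.sum_ite_eq', Finset.mem_univ,
            if_true, extMul_apply_empty]
          by_cases hx : x = ∅ <;> by_cases hy : y = ∅ <;> simp [hx, hy]
      rw [barStar, h1, h2, headAug, headAug]
      by_cases hx : x = ∅ <;> simp [hx, sgnShift]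
  have e1 : barDiff (barDiff φ) l = barDiff (barStar φ) l - barDiff (headAug φ) l :=
    barDiff_sub _ _ l
  rw [e1, barDiff, barDiff, barStar_barStar, ← h]
  abel

/-- If `φ` vanishes on words with the letter `1` just before the position `|a|`, only the terms of
the differential to the right of that position survive. -/
theorem barDiff_append_empty (φ : List (Finset (Fin n)) → V) (a b : List (Finset (Fin n)))
    (h : ∀ a' c, a'.length + 1 = a.length → φ (a' ++ ∅ :: c) = 0) :
    barDiff φ (a ++ ∅ :: b) =
      - (a.map (sgnShift ℂ)).prod • barStar (fun w => φ (a ++ ∅ :: w)) b := by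
  have hcons : ∀ (φ : List (Finset (Fin n)) → V) (b : List (Finset (Fin n))),
      consMul φ ∅ b = φ b := by
    intro φ b
    cases b <;> simp [consMul, extMul_empty_left]
  cases a with
  | nil => simp [barDiff, barStar, headAug, hcons, sgnShift]
  | cons x a =>
    have key : ∀ (x : Finset (Fin n)) (a : List (Finset (Fin n)))
        (φ : List (Finset (Fin n)) → V)
        (_ : ∀ a' c, a'.length = a.length → φ (a' ++ ∅ :: c) = 0),
        barStar φ (x :: (a ++ ∅ :: b)) =
        - ((x :: a).map (sgnShift ℂ)).prod • barStar (fun w => φ (x :: (a ++ ∅ :: w))) b := by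
      intro x a
      induction a generalizing x with
      | nil =>
        intro φ h
        simp only [List.nil_append, barStar, hcons]
        simp only [consMul, extMul_empty_right, ite_smul, zero_smul, Finset.sum_ite_eq,
          Finset.mem_univ, if_true, List.map_cons, List.map_nil, List.prod_cons, List.prod_nil,
          smul_add, smul_smul, mul_one]
        simp [sgnShift, pow_succ]
      | cons y a ih =>
        intro φ h
        rw [List.cons_append, barStar, ih y (fun w => φ (x :: w))
          (fun a' c ha' => h (x :: a') c (by simp [ha']))]
        have : consMul φ x (y :: (a ++ ∅ :: b)) = 0 :=
          Finset.sum_eq_zero fun K _ => by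
            rw [← List.cons_append, h (K :: a) b (by simp), smul_zero]
        rw [this, zero_add, List.map_cons, List.prod_cons, smul_smul, mul_neg]
        rfl
    have h0 : headAug φ (x :: a ++ ∅ :: b) = 0 := by
      simp [headAug, h a b (by simp)]
    rw [barDiff, h0, sub_zero]
    exact key x a φ fun a' c h' => h a' c (by simp [h'])

/-- A cocycle is cohomologous to one that vanishes on all words containing the letter `1`. -/
theorem exists_normalized (s : ℕ) (φ : List (Finset (Fin n)) → ℂ) (hφ : ∀ l, barDiff φ l = 0)
    (hs : ∀ l, l.length ≠ s → φ l = 0) :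
    ∃ ψ : List (Finset (Fin n)) → ℂ, (∀ l, l.length + 1 ≠ s → ψ l = 0) ∧
      ∀ a b, φ (a ++ ∅ :: b) - barDiff ψ (a ++ ∅ :: b) = 0 := by
  -- Make the cocycle vanish on words with the letter `1` at one of the first `i` positions, by
  -- induction on `i`.
  suffices H : ∀ i, i ≤ s → ∃ ψ : List (Finset (Fin n)) → ℂ,
      (∀ l, l.length + 1 ≠ s → ψ l = 0) ∧
      ∀ a b, a.length < i → φ (a ++ ∅ :: b) - barDiff ψ (a ++ ∅ :: b) = 0 by
    obtain ⟨ψ, h1, h2⟩ := H s le_rfl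
    refine ⟨ψ, h1, fun a b => ?_⟩
    by_cases h : a.length < s
    · exact h2 a b h
    · rw [hs _ (by simp; omega), barDiff_eq_zero, sub_zero]
      intro w hw
      refine h1 w ?_
      simp at hw; omega
  intro i
  induction i with
  | zero =>
    intro _
    exact ⟨fun _ => 0, fun _ _ => rfl, fun a b h => absurd h (by simp)⟩
  | succ i ih =>
    intro hi
    obtain ⟨ψ, h1, h2⟩ := ih (by omega)
    set φ' : List (Finset (Fin n)) → ℂ := fun l => φ l - barDiff ψ l with hφ'
    have h3 : ∀ a b, a.length < i → φ' (a ++ ∅ :: b) = 0 := h2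
    have hc : ∀ l, barDiff φ' l = 0 := fun l => by
      have := barDiff_sub φ (barDiff ψ) l
      rw [hφ, barDiff_barDiff, sub_zero] at this
      exact this
    have hs' : ∀ l, l.length ≠ s → φ' l = 0 := fun l hl => by
      simp only [hφ']
      rw [hs l hl, barDiff_eq_zero, sub_zero]
      intro w hw
      exact h1 w (by omega)
    -- The correction inserts the letter `1` at position `i`, up to sign. It still vanishes on words
    -- with `1` at an earlier position, so earlier corrections are not disturbed.
    set χ : List (Finset (Fin n)) → ℂ := fun w =>
      - ((w.take i).map (sgnShift ℂ)).prod * φ' (w.take i ++ ∅ :: w.drop i) with hχ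
    have hχa : ∀ a w : List (Finset (Fin n)), a.length = i →
        χ (a ++ w) = - (a.map (sgnShift ℂ)).prod * φ' (a ++ ∅ :: w) := by
      intro a w ha
      simp [hχ, ← ha]
    have hχ0 : ∀ a b : List (Finset (Fin n)), a.length < i → χ (a ++ ∅ :: b) = 0 := by
      intro a b ha
      obtain ⟨k, hk⟩ := Nat.exists_eq_add_of_lt ha
      have : (a ++ ∅ :: b).take i = a ++ ∅ :: b.take k := by
        rw [List.take_append, List.take_of_length_le ha.le,
          show i - a.length = k + 1 by omega, List.take_succ_cons]
      simp only [hχ]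
      rw [this, List.append_assoc, List.cons_append, h3 _ _ ha, mul_zero]
    have hχs : ∀ l, l.length + 1 ≠ s → χ l = 0 := by
      intro l hl
      simp only [hχ]
      rw [hs', mul_zero]
      simp; omega
    refine ⟨fun l => ψ l + χ l, fun l hl => by simp only [h1 l hl, hχs l hl, add_zero], ?_⟩
    intro a b hab
    rw [barDiff_add, ← sub_sub]
    change φ' (a ++ ∅ :: b) - _ = 0
    rw [barDiff_append_empty χ a b fun a' c ha' => hχ0 a' c (by omega)]
    rcases Nat.lt_succ_iff_lt_or_eq.1 hab with hlt | heq
    · rw [h3 a b hlt]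
      simp only [hχ0 a _ hlt, barStar_zero, smul_zero, sub_zero]
    -- Evaluate the cocycle equation of `φ'` on the word with the letter `1` doubled.
    · have e1 := hc (a ++ ∅ :: ∅ :: b)
      rw [barDiff_append_empty φ' a (∅ :: b) fun a' c ha' => h3 a' c (by omega)] at e1
      have hsq : (a.map (sgnShift ℂ)).prod * (a.map (sgnShift ℂ)).prod = 1 := by
        rw [← List.prod_map_mul]
        simp [sgnShift, neg_one_pow_mul_self]
      have e2 : barStar (fun w => φ' (a ++ ∅ :: w)) (∅ :: b) =
          φ' (a ++ ∅ :: b) - barStar (fun w => φ' (a ++ ∅ :: ∅ :: w)) b := by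
        rw [barStar]
        cases b <;> simp [consMul, extMul_empty_left, sgnShift, sub_eq_add_neg]
      have e3 : barStar (fun w => χ (a ++ ∅ :: w)) b =
          - (a.map (sgnShift ℂ)).prod • barStar (fun w => φ' (a ++ ∅ :: ∅ :: w)) b := by
        rw [← barStar_smul]
        congr 1
        funext w
        rw [hχa a _ heq, smul_eq_mul]
      rw [e3]
      rw [e2] at e1
      simp only [smul_eq_mul] at e1 ⊢
      linear_combination (-(a.map (sgnShift ℂ)).prod) * e1 +
        (-φ' (a ++ ∅ :: b)) * hsq

end BarComplex

/-! ### Generic vectors and the Koszul homotopy -/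

section HKR

variable {n : ℕ}

open MvPolynomial

/-- Insertion of the generic vector `u = ∑_j u_j θ_j` in front of a word, where the `u_j` are the
variables of the polynomial ring. -/
noncomputable def genOp (φ : List (Finset (Fin n)) → MvPolynomial (Fin n) ℂ)
    (l : List (Finset (Fin n))) : MvPolynomial (Fin n) ℂ :=
  ∑ j, X j * φ ({j} :: l)

/-- Multiplication of the generic vector `u` into the first letter of a word. -/
noncomputable def genMul (φ : List (Finset (Fin n)) → MvPolynomial (Fin n) ℂ)
    (l : List (Finset (Fin n))) : MvPolynomial (Fin n) ℂ :=
  ∑ j, X j * consMul φ {j} l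

theorem genMul_nil (φ : List (Finset (Fin n)) → MvPolynomial (Fin n) ℂ) : genMul φ [] = 0 := by
  simp [genMul, consMul]

theorem genOp_barStar (φ : List (Finset (Fin n)) → MvPolynomial (Fin n) ℂ) :
    genOp (barStar φ) = fun l => genMul φ l + barStar (genOp φ) l := by
  funext l
  have h : barStar (genOp φ) l = ∑ j, X j * barStar (fun w => φ ({j} :: w)) l := by
    unfold genOp
    rw [barStar_sum]
    exact Finset.sum_congr rfl fun j _ =>
      barStar_map (LinearMap.mulLeft ℂ (X j)) (fun w => φ ({j} :: w)) l
  rw [h, genMul, ← Finset.sum_add_distrib]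
  refine Finset.sum_congr rfl fun j _ => ?_
  rw [barStar, mul_add]
  simp [sgnShift]

/-- The square of the generic vector is zero. -/
theorem genOp_genMul (φ : List (Finset (Fin n)) → MvPolynomial (Fin n) ℂ) :
    genOp (genMul φ) = fun _ => 0 := by
  funext l
  simp only [genOp, genMul, consMul, Finset.mul_sum]
  have h : ∀ f : Fin n → Fin n → MvPolynomial (Fin n) ℂ,
      (∀ j k, f j k + f k j = 0) → ∑ j, ∑ k, f j k = 0 := by
    intro f hf
    have : ∑ j, ∑ k, f j k + ∑ j, ∑ k, f j k = 0 := by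
      conv_lhs => enter [2]; rw [Finset.sum_comm]
      simp [← Finset.sum_add_distrib, hf]
    simpa [← two_mul] using this
  refine h _ fun j k => ?_
  rw [← Finset.sum_add_distrib]
  refine Finset.sum_eq_zero fun K _ => ?_
  rw [eq_neg_of_add_eq_zero_left (extMul_singleton_singleton j k K)]
  simp only [neg_smul, mul_neg, mul_smul_comm, mul_left_comm (X j) (X k)]
  simp

theorem genOp_zero : genOp (fun _ : List (Finset (Fin n)) => 0) = fun _ => 0 := by
  funext l
  simp [genOp]

theorem genOp_add (φ ψ : List (Finset (Fin n)) → MvPolynomial (Fin n) ℂ) :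
    genOp (fun l => φ l + ψ l) = fun l => genOp φ l + genOp ψ l := by
  funext l
  simp [genOp, mul_add, Finset.sum_add_distrib]

theorem genOp_iterate_sub (p : ℕ) (φ ψ : List (Finset (Fin n)) → MvPolynomial (Fin n) ℂ) :
    genOp^[p] (fun l => φ l - ψ l) = fun l => genOp^[p] φ l - genOp^[p] ψ l := by
  induction p generalizing φ ψ with
  | zero => rfl
  | succ p ih =>
    rw [Function.iterate_succ_apply, Function.iterate_succ_apply, Function.iterate_succ_apply, ← ih]
    congr 1
    funext l
    simp [genOp, mul_sub]

theorem genOp_iterate_zero (p : ℕ) :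
    genOp^[p] (fun _ : List (Finset (Fin n)) => 0) = fun _ => 0 :=
  Function.iterate_fixed genOp_zero p

/-- Products of two generic vectors vanish, so inserting `p + 1` of them into a differential leaves
only the product of the last one with the letter that follows. -/
theorem genOp_iterate_barStar (p : ℕ) (φ : List (Finset (Fin n)) → MvPolynomial (Fin n) ℂ) :
    genOp^[p + 1] (barStar φ) =
      fun l => genMul (genOp^[p] φ) l + barStar (genOp^[p + 1] φ) l := by
  induction p with
  | zero => exact genOp_barStar φ
  | succ p ih =>
    rw [Function.iterate_succ_apply', ih, genOp_add, genOp_genMul, genOp_barStar,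
      Function.iterate_succ_apply' _ (p + 1)]
    simp

theorem genOp_headAug (φ : List (Finset (Fin n)) → MvPolynomial (Fin n) ℂ) :
    genOp (headAug φ) = fun _ => 0 := by
  funext l
  simp [genOp, headAug]

/-- The augmentation vanishes on the generic vector. -/
theorem genOp_iterate_barDiff (p : ℕ) (φ : List (Finset (Fin n)) → MvPolynomial (Fin n) ℂ) :
    genOp^[p + 1] (barDiff φ) =
      fun l => genMul (genOp^[p] φ) l + barStar (genOp^[p + 1] φ) l := by
  have h := genOp_iterate_sub (p + 1) (barStar φ) (headAug φ)
  have h2 : genOp^[p + 1] (headAug φ) = fun _ => 0 := by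
    rw [Function.iterate_succ_apply, genOp_headAug, genOp_iterate_zero]
  rw [genOp_iterate_barStar, h2] at h
  refine Eq.trans ?_ (h.trans ?_)
  · rfl
  · simp

theorem barDiff_map {V V' : Type*} [AddCommGroup V] [AddCommGroup V'] [Module ℂ V] [Module ℂ V']
    (f : V →ₗ[ℂ] V') (φ : List (Finset (Fin n)) → V) (l : List (Finset (Fin n))) :
    barDiff (fun w => f (φ w)) l = f (barDiff φ l) := by
  rw [barDiff, barDiff, map_sub, barStar_map]
  congr 1
  cases l with
  | nil => simp [headAug]
  | cons x l => simp only [headAug]; split_ifs <;> simp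

theorem barDiff_C (φ : List (Finset (Fin n)) → ℂ) :
    barDiff (fun w => (C (φ w) : MvPolynomial (Fin n) ℂ)) = fun l => C (barDiff φ l) := by
  funext l
  exact barDiff_map (Algebra.linearMap ℂ (MvPolynomial (Fin n) ℂ)) φ l

theorem genOp_iterate_isHomogeneous (φ : List (Finset (Fin n)) → ℂ) (p : ℕ)
    (l : List (Finset (Fin n))) : (genOp^[p] (fun w => C (φ w)) l).IsHomogeneous p := by
  induction p generalizing l with
  | zero => exact isHomogeneous_C _ _
  | succ p ih =>
    rw [Function.iterate_succ_apply', genOp]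
    refine IsHomogeneous.sum _ _ _ fun j _ => ?_
    rw [add_comm]
    exact (isHomogeneous_X _ _).mul (ih _)

theorem genOp_iterate_eq_zero
    (φ : List (Finset (Fin n)) → MvPolynomial (Fin n) ℂ) (p : ℕ) (l : List (Finset (Fin n)))
    (h : ∀ a, a.length = p → φ (a ++ l) = 0) : genOp^[p] φ l = 0 := by
  induction p generalizing l with
  | zero => exact h [] rfl
  | succ p ih =>
    rw [Function.iterate_succ_apply', genOp]
    refine Finset.sum_eq_zero fun j _ => ?_
    rw [ih _ fun a ha => ?_, mul_zero]
    have := h (a ++ [{j}]) (by simp [ha])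
    rwa [List.append_assoc] at this

/-- A functional with values in homogeneous polynomials of degree `k` comes, by insertion of `k`
generic vectors, from a scalar functional. -/
theorem exists_genOp_iterate_eq (k : ℕ) (g : List (Finset (Fin n)) → MvPolynomial (Fin n) ℂ)
    (hg : ∀ l, (g l).IsHomogeneous k) :
    ∃ ψ : List (Finset (Fin n)) → ℂ, genOp^[k] (fun w => C (ψ w)) = g ∧
      (∀ s, (∀ l, l.length + k ≠ s → g l = 0) → ∀ l, l.length ≠ s → ψ l = 0) ∧
      ((∀ a b, g (a ++ ∅ :: b) = 0) → ∀ a b, ψ (a ++ ∅ :: b) = 0) := by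
  classical
  induction k generalizing g with
  | zero =>
    refine ⟨fun l => coeff 0 (g l), ?_, ?_, ?_⟩
    · funext l
      have := (totalDegree_zero_iff_isHomogeneous _).2 (hg l)
      exact (totalDegree_eq_zero_iff_eq_C.1 this).symm
    · intro s h l hl
      simp [h l hl]
    · intro h a b
      simp [h a b]
  | succ k ih =>
    -- Euler's identity for homogeneous polynomials inverts the insertion of one generic vector
    let e : List (Finset (Fin n)) → MvPolynomial (Fin n) ℂ := fun w => match w with
      | [] => 0
      | x :: l => if h : ∃ j, x = {j} then C ((k + 1 : ℂ)⁻¹) * pderiv h.choose (g l) else 0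
    have he : ∀ j l, e ({j} :: l) = C ((k + 1 : ℂ)⁻¹) * pderiv j (g l) := by
      intro j l
      have h : ∃ j', ({j} : Finset (Fin n)) = {j'} := ⟨j, rfl⟩
      have hj : h.choose = j := (Finset.singleton_injective h.choose_spec).symm
      change (if h : ∃ j', ({j} : Finset (Fin n)) = {j'} then _ else _) = _
      rw [dif_pos h, hj]
    have hne : (k + 1 : ℂ) ≠ 0 := Nat.cast_add_one_ne_zero k
    have hU : genOp e = g := by
      funext l
      have := (hg l).sum_X_mul_pderiv
      simp only [genOp, he, mul_left_comm (X _), ← Finset.mul_sum, this, nsmul_eq_mul]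
      rw [← mul_assoc, ← map_natCast (C (σ := Fin n) (R := ℂ)), ← map_mul]
      simp [hne]
    have heq : ∀ x l, g l = 0 → e (x :: l) = 0 := by
      intro x l hl
      change (if h : ∃ j', x = {j'} then _ else _) = _
      simp [hl]
    obtain ⟨ψ, h1, h2, h3⟩ := ih e (by
      intro l
      cases l with
      | nil => exact isHomogeneous_zero _ _ _
      | cons x l =>
        by_cases h : ∃ j, x = {j}
        · obtain ⟨j, rfl⟩ := h
          rw [he]
          exact (hg l).pderiv.C_mul _
        · have : e (x :: l) = 0 := dif_neg h
          rw [this]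
          exact isHomogeneous_zero _ _ _)
    refine ⟨ψ, ?_, ?_, ?_⟩
    · rw [Function.iterate_succ_apply', h1, hU]
    · intro s hs
      refine h2 s fun l hl => ?_
      cases l with
      | nil => rfl
      | cons x l => exact heq x l (hs l (by simp at hl; omega))
    · intro hs
      refine h3 fun a b => ?_
      cases a with
      | nil =>
        change (if h : ∃ j', (∅ : Finset (Fin n)) = {j'} then _ else _) = _
        rw [dif_neg]
        rintro ⟨j, hj⟩
        exact Finset.singleton_ne_empty j hj.symm
      | cons x a => exact heq x _ (hs a b)

section Homotopy

/-- The derivative by `u_j` of the equation `u f = 0`. -/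
theorem sum_extMul_pderiv (f : List (Finset (Fin n)) → MvPolynomial (Fin n) ℂ)
    (hfu : ∀ x l, ∑ k, X k * ∑ K, extMul {k} x K • f (K :: l) = 0)
    (j : Fin n) (L : Finset (Fin n)) (l : List (Finset (Fin n))) :
    ∑ K, ∑ k, X k * extMul {k} L K • pderiv j (f (K :: l)) =
      - ∑ K, extMul {j} L K • f (K :: l) := by
  have h := congrArg (pderiv j) (hfu L l)
  have e : ∀ k, pderiv j (X k * ∑ K, extMul {k} L K • f (K :: l)) =
      X k * ∑ K, extMul {k} L K • pderiv j (f (K :: l)) +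
        if k = j then ∑ K, extMul {k} L K • f (K :: l) else 0 := by
    intro k
    rw [Derivation.leibniz, smul_eq_mul, smul_eq_mul, map_sum, pderiv_X, Pi.single_apply, mul_ite,
      mul_one, mul_zero]
    simp only [Derivation.map_smul, Finset.mul_sum]
  rw [map_sum, map_zero] at h
  simp only [e, Finset.sum_add_distrib, Finset.sum_ite_eq', Finset.mem_univ, if_true] at h
  rw [Finset.sum_comm, eq_neg_iff_add_eq_zero, ← h]
  simp only [Finset.mul_sum]

/-- The term `∂_j u ∂/∂u_j` of the homotopy, which gives the degree in the exterior variables by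
Euler's identity. -/
theorem sum_extCtr_pderiv (f : List (Finset (Fin n)) → MvPolynomial (Fin n) ℂ)
    (hfu : ∀ x l, ∑ k, X k * ∑ K, extMul {k} x K • f (K :: l) = 0)
    (x : Finset (Fin n)) (l : List (Finset (Fin n))) :
    ∑ k, ∑ j, ∑ K, (∑ L, extCtr j x L * extMul {k} L K) • (X k * pderiv j (f (K :: l))) =
      - ((x.card : ℂ) • f (x :: l)) := by
  have : ∀ j, ∑ k, ∑ K, (∑ L, extCtr j x L * extMul {k} L K) •
      (X k * pderiv j (f (K :: l))) =
      ∑ L, extCtr j x L • ∑ K, ∑ k, X k * extMul {k} L K • pderiv j (f (K :: l)) := by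
    intro j
    simp only [Finset.sum_smul, Finset.smul_sum, mul_smul_comm, smul_smul]
    rw [Finset.sum_comm]
    rw [Finset.sum_comm (s := Finset.univ) (t := Finset.univ) (f := fun L K => ∑ k,
      (extCtr j x L * extMul {k} L K) • (X k * pderiv j (f (K :: l))))]
    exact Finset.sum_congr rfl fun K _ => Finset.sum_comm
  rw [Finset.sum_comm]
  simp only [this, sum_extMul_pderiv f hfu, smul_neg, Finset.sum_neg_distrib, Finset.smul_sum, smul_smul]
  congr 1
  have e5 : ∑ j, ∑ L, ∑ K, (extCtr j x L * extMul {j} L K) • f (K :: l) =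
      ∑ K, (∑ j, ∑ L, extCtr j x L * extMul {j} L K) • f (K :: l) := by
    simp only [Finset.sum_smul]
    rw [Finset.sum_comm (s := Finset.univ) (t := Finset.univ) (f := fun K j => ∑ L,
      (extCtr j x L * extMul {j} L K) • f (K :: l))]
    exact Finset.sum_congr rfl fun j _ => Finset.sum_comm
  rw [e5]
  simp [sum_extCtr_extMul]

/-- On homogeneous polynomials of degree `p` with values in linear functionals of degree `|x|`, the
contraction `∑_j ∂/∂u_j ⊗ ∂_j` inverts multiplication by `u` up to the factor `p + |x|`. -/
theorem koszul_homotopy (p : ℕ) (f : List (Finset (Fin n)) → MvPolynomial (Fin n) ℂ)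
    (hfh : ∀ l, (f l).IsHomogeneous p)
    (hfu : ∀ x l, ∑ k, X k * ∑ K, extMul {k} x K • f (K :: l) = 0)
    (x : Finset (Fin n)) (l : List (Finset (Fin n))) :
    ∑ k, X k * ∑ L, extMul {k} x L • ∑ j, ∑ K, extCtr j L K • pderiv j (f (K :: l)) =
      ((p + x.card : ℕ) : ℂ) • f (x :: l) := by
  have e1 : ∑ k, X k * ∑ L, extMul {k} x L • ∑ j, ∑ K, extCtr j L K • pderiv j (f (K :: l)) =
      ∑ k, ∑ j, ∑ K, (∑ L, extMul {k} x L * extCtr j L K) •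
        (X k * pderiv j (f (K :: l))) := by
    refine Finset.sum_congr rfl fun k _ => ?_
    simp only [Finset.smul_sum, Finset.mul_sum, Finset.sum_smul, smul_smul, mul_smul_comm]
    rw [Finset.sum_comm]
    refine Finset.sum_congr rfl fun j _ => ?_
    rw [Finset.sum_comm]
  have e2 : ∀ k j K, (∑ L, extMul {k} x L * extCtr j L K) =
      (if j = k ∧ x = K then 1 else 0) - ∑ L, extCtr j x L * extMul {k} L K :=
    fun k j K => eq_sub_of_add_eq (extMul_extCtr j k x K)
  rw [e1]
  simp only [e2, sub_smul, Finset.sum_sub_distrib]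
  have e3 : ∑ k, ∑ j, ∑ K, (if j = k ∧ x = K then (1 : ℂ) else 0) •
      (X k * pderiv j (f (K :: l))) = (p : ℂ) • f (x :: l) := by
    simp only [ite_and, ite_smul, one_smul, zero_smul]
    rw [Nat.cast_smul_eq_nsmul, ← (hfh (x :: l)).sum_X_mul_pderiv]
    refine Finset.sum_congr rfl fun k _ => ?_
    rw [Finset.sum_eq_single k (by intro b _ hb; simp [hb]) (by simp)]
    simp
  have e4 := sum_extCtr_pderiv f hfu x l
  rw [e3, e4, Nat.cast_add]
  module

end Homotopy

/-- The Koszul homotopy. A cocycle that vanishes on words beginning with `p + 1` equal generic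
vectors is cohomologous to one that vanishes on words beginning with `p` of them. -/
theorem exists_koszul_step (s p : ℕ) (hp : 1 ≤ p) (hps : p < s) (φ : List (Finset (Fin n)) → ℂ)
    (hφ : ∀ l, barDiff φ l = 0) (hs : ∀ l, l.length ≠ s → φ l = 0)
    (hn : ∀ a b, φ (a ++ ∅ :: b) = 0) (hU : genOp^[p + 1] (fun w => C (φ w)) = fun _ => 0) :
    ∃ ψ : List (Finset (Fin n)) → ℂ, (∀ l, l.length + 1 ≠ s → ψ l = 0) ∧
      (∀ a b, ψ (a ++ ∅ :: b) = 0) ∧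
      genOp^[p] (fun w => C (φ w - barDiff ψ w)) = fun _ => 0 := by
  set f := genOp^[p] (fun w => C (φ w)) with hf
  have hfh : ∀ l, (f l).IsHomogeneous p := genOp_iterate_isHomogeneous φ p
  have hfn : ∀ a b, f (a ++ ∅ :: b) = 0 := fun a b =>
    genOp_iterate_eq_zero _ p _ fun c _ => by
      rw [← List.append_assoc, hn, C_0]
  have hfs : ∀ l, l.length + p ≠ s → f l = 0 := fun l hl =>
    genOp_iterate_eq_zero _ p _ fun c hc => by
      rw [hs _ (by simp; omega), C_0]
  -- The cocycle equation with `p + 1` generic vectors in front says that `f` is closed for the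
  -- Koszul differential.
  have hfu : ∀ x l, ∑ k, X k * ∑ K, extMul {k} x K • f (K :: l) = 0 := by
    intro x l
    have h1 := genOp_iterate_barDiff p (fun w => C (φ w))
    rw [barDiff_C, hU] at h1
    have h2 : (fun l => C (barDiff φ l)) =
        fun _ : List (Finset (Fin n)) => (0 : MvPolynomial (Fin n) ℂ) := by
      funext l; simp [hφ]
    rw [h2, genOp_iterate_zero] at h1
    have h3 := congrFun h1 (x :: l)
    have h4 : barStar (fun _ : List (Finset (Fin n)) => (0 : MvPolynomial (Fin n) ℂ)) (x :: l) = 0 :=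
      barStar_zero _
    rw [h4, add_zero] at h3
    exact h3.symm
  -- The homotopy: the contraction of `f`, divided by the factor from `koszul_homotopy`. It is applied
  -- to the letter `u ∧ x` of length `|x| + 1`, whence the shift by one in `c`.
  let c : Finset (Fin n) → ℂ := fun x => ((p + x.card - 1 : ℕ) : ℂ)⁻¹
  let g : List (Finset (Fin n)) → MvPolynomial (Fin n) ℂ := fun w => match w with
    | [] => 0
    | x :: l => c x • ∑ j, ∑ K, extCtr j x K • pderiv j (f (K :: l))
  have hg : ∀ l, (g l).IsHomogeneous (p - 1) := by
    intro l
    cases l with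
    | nil => exact isHomogeneous_zero _ _ _
    | cons x l =>
      change (c x • _ : MvPolynomial (Fin n) ℂ).IsHomogeneous _
      rw [smul_eq_C_mul]
      refine IsHomogeneous.C_mul (IsHomogeneous.sum _ _ _ fun j _ => IsHomogeneous.sum _ _ _
        fun K _ => ?_) _
      rw [smul_eq_C_mul]
      exact ((hfh _).pderiv).C_mul _
  have hgc : ∀ x l, g (x :: l) = c x • ∑ j, ∑ K, extCtr j x K • pderiv j (f (K :: l)) :=
    fun _ _ => rfl
  obtain ⟨ψ, h1, h2, h3⟩ := exists_genOp_iterate_eq (p - 1) g hg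
  -- the generic vector itself contracts to a unit, on which `f` vanishes
  have hgu : ∀ j l, g ({j} :: l) = 0 := by
    intro j l
    rw [hgc]
    refine smul_eq_zero_of_right _ (Finset.sum_eq_zero fun i _ => Finset.sum_eq_zero fun K _ => ?_)
    by_cases h : extCtr i {j} K = 0
    · simp [h]
    · have := extCtr_ne_zero h
      rw [Finset.card_singleton] at this
      obtain rfl : K = ∅ := Finset.card_eq_zero.1 (by omega)
      have := hfn [] l
      rw [List.nil_append] at this
      simp [this]
  have hgf : ∀ x l, ∑ k, X k * ∑ L, extMul {k} x L • g (L :: l) = f (x :: l) := by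
    intro x l
    have hpx : ((p + x.card : ℕ) : ℂ) ≠ 0 := by
      rw [Nat.cast_ne_zero]; omega
    have hc : ∀ k L, extMul {k} x L • g (L :: l) = ((p + x.card : ℕ) : ℂ)⁻¹ • extMul {k} x L •
        ∑ j, ∑ K, extCtr j L K • pderiv j (f (K :: l)) := by
      intro k L
      by_cases h : extMul {k} x L = 0
      · simp [h]
      · have hcL : c L = ((p + x.card : ℕ) : ℂ)⁻¹ := by
          simp only [c]
          rw [card_of_extMul_ne_zero h, Finset.card_singleton]
          congr 2
          omega
        rw [hgc, hcL, smul_comm]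
    have hT := koszul_homotopy p f hfh hfu x l
    have : ∑ k, X k * ∑ L, extMul {k} x L • g (L :: l) = ((p + x.card : ℕ) : ℂ)⁻¹ •
        ∑ k, X k * ∑ L, extMul {k} x L • ∑ j, ∑ K, extCtr j L K • pderiv j (f (K :: l)) := by
      simp only [hc, ← Finset.smul_sum, mul_smul_comm]
    rw [this, hT, smul_smul, inv_mul_cancel₀ hpx, one_smul]
  refine ⟨ψ, fun l hl => h2 (s - 1) (fun w hw => ?_) l (by omega), h3 fun a b => ?_, ?_⟩
  · cases w with
    | nil => rfl
    | cons x w =>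
      rw [hgc]
      have : ∀ K : Finset (Fin n), f (K :: w) = 0 := fun K => hfs _ (by simp at hw ⊢; omega)
      simp [this]
  · cases a with
    | nil =>
      rw [List.nil_append, hgc]
      refine smul_eq_zero_of_right _ (Finset.sum_eq_zero fun i _ => Finset.sum_eq_zero
        fun K _ => ?_)
      by_cases h : extCtr i ∅ K = 0
      · simp [h]
      · exact absurd (extCtr_ne_zero h) (by simp)
    | cons x a =>
      rw [List.cons_append, hgc]
      have : ∀ K : Finset (Fin n), f (K :: (a ++ ∅ :: b)) = 0 := fun K => hfn (K :: a) b
      simp [this]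
  · obtain ⟨q, rfl⟩ : ∃ q, p = q + 1 := ⟨p - 1, by omega⟩
    rw [Nat.add_sub_cancel] at h1
    have e1 : (fun w => (C (φ w - barDiff ψ w) : MvPolynomial (Fin n) ℂ)) =
        fun w => C (φ w) - barDiff (fun w => C (ψ w)) w := by
      rw [barDiff_C]
      funext w
      simp
    have e2 : genOp^[q + 1] (fun w => (C (ψ w) : MvPolynomial (Fin n) ℂ)) = fun _ => 0 := by
      rw [Function.iterate_succ_apply', h1]
      funext l
      simp [genOp, hgu]
    have e3 := genOp_iterate_sub (q + 1) (fun w => (C (φ w) : MvPolynomial (Fin n) ℂ))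
      (fun w => barDiff (fun w => C (ψ w)) w)
    rw [e1, e3]
    have e4 := genOp_iterate_barDiff q (fun w => C (ψ w))
    rw [e2, h1] at e4
    funext l
    have e5 := congrFun e4 l
    have e6 : barStar (fun _ : List (Finset (Fin n)) => (0 : MvPolynomial (Fin n) ℂ)) l = 0 :=
      barStar_zero _
    rw [e6, add_zero] at e5
    change f l - genOp^[q + 1] (barDiff fun w => C (ψ w)) l = 0
    rw [e5]
    cases l with
    | nil =>
      rw [genMul_nil, hfs [] (by simp; omega), sub_zero]
    | cons x l =>
      change f (x :: l) - ∑ k, X k * ∑ L, extMul {k} x L • g (L :: l) = 0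
      rw [hgf, sub_self]

end HKR

/-! ### The Hochschild-Kostant-Rosenberg theorem -/

section HKRTheorem

variable {n : ℕ}

open MvPolynomial

theorem genOp_iterate_eq_sum (s : ℕ) (φ : List (Finset (Fin n)) → MvPolynomial (Fin n) ℂ)
    (l : List (Finset (Fin n))) :
    genOp^[s] φ l = ∑ i : Fin s → Fin n, (∏ k, X (i k)) *
      φ ((List.ofFn fun k => {i k}) ++ l) := by
  induction s generalizing φ with
  | zero => simp
  | succ s ih =>
    rw [Function.iterate_succ_apply, ih, ← (Fin.consEquiv fun _ => Fin n).sum_comp,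
      Fintype.sum_prod_type, Finset.sum_comm]
    refine Finset.sum_congr rfl fun i _ => ?_
    rw [genOp, Finset.mul_sum]
    refine Finset.sum_congr rfl fun j _ => ?_
    rw [Fin.prod_univ_succ]
    simp only [Fin.consEquiv_apply, Fin.cons_zero, Fin.cons_succ, List.ofFn_succ,
      List.cons_append]
    ring

theorem prod_X_eq_monomial (s : ℕ) (i : Fin s → Fin n) :
    ∏ k, (X (i k) : MvPolynomial (Fin n) ℂ) = monomial (∑ k, Finsupp.single (i k) 1) 1 := by
  rw [monomial_sum_one]
  rfl

/-- The coefficients of the value on generic vectors are the symmetrizations over words of generators. -/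
theorem genOp_iterate_nil_eq_zero (s : ℕ) (φ : List (Finset (Fin n)) → ℂ)
    (h : ∀ b : Fin n →₀ ℕ, ∑ i : Fin s → Fin n with ∑ k, Finsupp.single (i k) 1 = b,
      φ (List.ofFn fun k => {i k}) = 0) :
    genOp^[s] (fun w => C (φ w)) [] = 0 := by
  rw [genOp_iterate_eq_sum]
  ext b
  rw [coeff_sum, coeff_zero, ← h b, Finset.sum_filter]
  refine Finset.sum_congr rfl fun i _ => ?_
  rw [prod_X_eq_monomial, List.append_nil, mul_comm, C_mul_monomial, mul_one, coeff_monomial]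

/-- A normalized cocycle that vanishes on words beginning with a single generator is zero: every
other letter is a product with a generator. -/
theorem eq_zero_of_genOp_eq_zero (φ : List (Finset (Fin n)) → ℂ)
    (hφ : ∀ l, barDiff φ l = 0) (hn : ∀ a b, φ (a ++ ∅ :: b) = 0)
    (hU : genOp (fun w => (C (φ w) : MvPolynomial (Fin n) ℂ)) = fun _ => 0) (x : Finset (Fin n))
    (l : List (Finset (Fin n))) : φ (x :: l) = 0 := by
  have h1 : ∀ j l, φ ({j} :: l) = 0 := by
    intro j l
    have := congrArg (coeff (Finsupp.single j 1)) (congrFun hU l)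
    rw [genOp, coeff_sum, coeff_zero, Finset.sum_eq_single j] at this
    · simpa [mul_comm (X j)] using this
    · intro k _ hk
      rw [mul_comm, coeff_C_mul, coeff_X, if_neg, mul_zero]
      intro h
      exact hk (Finsupp.single_left_injective one_ne_zero h)
    · simp
  have h2 : ∀ j y, ∑ K, extMul {j} y K * φ (K :: l) = 0 := by
    intro j y
    have := hφ ({j} :: y :: l)
    rw [barDiff, headAug, if_neg (Finset.singleton_ne_empty j), sub_zero, barStar, consMul] at this
    simp only [h1, barStar_zero, smul_eq_mul, mul_zero, add_zero] at this
    exact this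
  have h3 : (x.card : ℂ) * φ (x :: l) = 0 := by
    have e : ∑ K, (∑ j, ∑ L, extCtr j x L * extMul {j} L K) * φ (K :: l) =
        ∑ j, ∑ L, extCtr j x L * ∑ K, extMul {j} L K * φ (K :: l) := by
      simp only [Finset.sum_mul, Finset.mul_sum, mul_assoc]
      rw [Finset.sum_comm]
      exact Finset.sum_congr rfl fun j _ => Finset.sum_comm
    simp only [h2, mul_zero, Finset.sum_const_zero, sum_extCtr_extMul] at e
    simpa using e
  rcases mul_eq_zero.1 h3 with h | h
  · obtain rfl : x = ∅ := Finset.card_eq_zero.1 (by exact_mod_cast h)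
    exact hn [] l
  · exact h

/-- The Hochschild-Kostant-Rosenberg theorem for the exterior algebra with trivial coefficients: a
cocycle whose symmetrization on words of generators vanishes is a coboundary. -/
theorem exists_eq_barDiff (s : ℕ) (hs : 1 ≤ s) (φ : List (Finset (Fin n)) → ℂ)
    (hφ : ∀ l, l.length = s + 1 → barDiff φ l = 0)
    (hsym : ∀ b : Fin n →₀ ℕ, ∑ i : Fin s → Fin n with ∑ k, Finsupp.single (i k) 1 = b,
      φ (List.ofFn fun k => {i k}) = 0) :
    ∃ ψ : List (Finset (Fin n)) → ℂ, ∀ l, l.length = s → φ l = barDiff ψ l := by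
  set φ₀ : List (Finset (Fin n)) → ℂ := fun l => if l.length = s then φ l else 0 with hφ₀
  have hs₀ : ∀ l, l.length ≠ s → φ₀ l = 0 := fun l hl => if_neg hl
  have hc₀ : ∀ l, barDiff φ₀ l = 0 := by
    intro l
    by_cases hl : l.length = s + 1
    · have h := barDiff_sub φ₀ φ l
      rw [hφ l hl, sub_zero, barDiff_eq_zero] at h
      · exact h.symm
      · intro w hw
        simp only [hφ₀]
        rw [if_pos (by omega), sub_self]
    · exact barDiff_eq_zero fun w hw => hs₀ w (by omega)
  obtain ⟨ψ₁, hψ₁, hn⟩ := exists_normalized s φ₀ hc₀ hs₀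
  have hcocycle : ∀ ψ : List (Finset (Fin n)) → ℂ, ∀ l,
      barDiff (fun w => φ₀ w - barDiff ψ w) l = 0 := by
    intro ψ l
    have := barDiff_sub φ₀ (barDiff ψ) l
    rw [hc₀, barDiff_barDiff, sub_zero] at this
    exact this
  have hlen : ∀ ψ : List (Finset (Fin n)) → ℂ, (∀ l, l.length + 1 ≠ s → ψ l = 0) →
      ∀ l, l.length ≠ s → φ₀ l - barDiff ψ l = 0 := by
    intro ψ hψ l hl
    rw [hs₀ l hl, barDiff_eq_zero, sub_zero]
    intro w hw
    exact hψ w (by omega)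
  -- Lower the number `s - k` of generic vectors on which the cocycle vanishes: for `k = 0` this is the
  -- hypothesis on the symmetrization, and each step is an application of the Koszul homotopy.
  have H : ∀ k, k + 1 ≤ s → ∃ ψ : List (Finset (Fin n)) → ℂ, (∀ l, l.length + 1 ≠ s → ψ l = 0) ∧
      (∀ a b, φ₀ (a ++ ∅ :: b) - barDiff ψ (a ++ ∅ :: b) = 0) ∧
      genOp^[s - k] (fun w => (C (φ₀ w - barDiff ψ w) : MvPolynomial (Fin n) ℂ)) =
        fun _ => 0 := by
    intro k
    induction k with
    | zero =>
      intro _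
      refine ⟨ψ₁, hψ₁, hn, ?_⟩
      funext l
      rw [Nat.sub_zero]
      by_cases hl : l = []
      · subst hl
        obtain ⟨q, rfl⟩ : ∃ q, s = q + 1 := ⟨s - 1, by omega⟩
        have e1 : (fun w => (C (φ₀ w - barDiff ψ₁ w) : MvPolynomial (Fin n) ℂ)) =
            fun w => C (φ₀ w) - barDiff (fun w => C (ψ₁ w)) w := by
          rw [barDiff_C]
          funext w
          simp
        have e2 : genOp^[q + 1] (fun w => (C (φ₀ w) : MvPolynomial (Fin n) ℂ)) [] = 0 := by
          refine genOp_iterate_nil_eq_zero _ _ fun b => ?_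
          rw [← hsym b]
          exact Finset.sum_congr rfl fun i _ => if_pos (by simp)
        have e3 := congrFun (genOp_iterate_sub (q + 1)
          (fun w => (C (φ₀ w) : MvPolynomial (Fin n) ℂ)) (barDiff fun w => C (ψ₁ w))) []
        rw [e2, genOp_iterate_barDiff] at e3
        rw [e1]
        refine e3.trans ?_
        simp [barStar, genMul_nil]
      · refine genOp_iterate_eq_zero _ _ _ fun a ha => ?_
        rw [hlen ψ₁ hψ₁, C_0]
        have := List.length_pos_iff.2 hl
        simp; omega
    | succ k ih =>
      intro hk
      obtain ⟨ψ, h1, h2, h3⟩ := ih (by omega)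
      obtain ⟨χ, g1, g2, g3⟩ := exists_koszul_step s (s - (k + 1)) (by omega) (by omega)
        (fun w => φ₀ w - barDiff ψ w) (hcocycle ψ) (hlen ψ h1) h2
        (by rw [show s - (k + 1) + 1 = s - k by omega]; exact h3)
      refine ⟨fun w => ψ w + χ w, fun l hl => by simp only [h1 l hl, g1 l hl, add_zero], ?_, ?_⟩
      · intro a b
        rw [barDiff_add, ← sub_sub, h2, barDiff_append_empty χ a b fun a' c _ => g2 a' c]
        simp only [g2, barStar_zero, smul_zero, sub_zero]
      · simp only [barDiff_add, ← sub_sub]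
        exact g3
  obtain ⟨ψ, h1, h2, h3⟩ := H (s - 1) (by omega)
  rw [show s - (s - 1) = 1 by omega] at h3
  refine ⟨ψ, fun l hl => ?_⟩
  cases l with
  | nil => simp at hl; omega
  | cons x l =>
    have := eq_zero_of_genOp_eq_zero _ (hcocycle ψ) h2 h3 x l
    rw [← sub_eq_zero, ← this]
    simp only [hφ₀]
    rw [if_pos hl]

end HKRTheorem

/-! ### Order and weight -/

section Weights

open MvPolynomial

variable {n : ℕ}

/-- All monomials of `p` have order at least `k / 2`. -/
def OrdGE (k : ℕ) (p : coeffRing n) : Prop := ∀ c, coeff c p ≠ 0 → k ≤ 2 * c.degree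

theorem OrdGE.zero (k : ℕ) : OrdGE k (0 : coeffRing n) := fun c h => absurd (coeff_zero c) h

theorem OrdGE.of_zero (p : coeffRing n) : OrdGE 0 p := fun _ _ => Nat.zero_le _

theorem OrdGE.mono {k k' : ℕ} {p : coeffRing n} (h : OrdGE k p) (hk : k' ≤ k) : OrdGE k' p :=
  fun c hc => hk.trans (h c hc)

theorem OrdGE.congr {k : ℕ} {p q : coeffRing n} (h : OrdGE k p) (hpq : p = q) : OrdGE k q :=
  hpq ▸ h

theorem OrdGE.add {k : ℕ} {p q : coeffRing n} (hp : OrdGE k p) (hq : OrdGE k q) :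
    OrdGE k (p + q) := by
  intro c hc
  by_cases h : coeff c p = 0
  · exact hq c fun h' => hc (by rw [coeff_add, h, h', add_zero])
  · exact hp c h

theorem OrdGE.neg {k : ℕ} {p : coeffRing n} (hp : OrdGE k p) : OrdGE k (-p) :=
  fun c hc => hp c fun h => hc (by rw [coeff_neg, h, neg_zero])

theorem OrdGE.sub {k : ℕ} {p q : coeffRing n} (hp : OrdGE k p) (hq : OrdGE k q) :
    OrdGE k (p - q) := sub_eq_add_neg p q ▸ hp.add hq.neg

theorem OrdGE.mul {k k' : ℕ} {p q : coeffRing n} (hp : OrdGE k p) (hq : OrdGE k' q) :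
    OrdGE (k + k') (p * q) := by
  classical
  intro c hc
  rw [coeff_mul] at hc
  obtain ⟨⟨d, e⟩, hde, h⟩ := Finset.exists_ne_zero_of_sum_ne_zero hc
  have hde' : d + e = c := by simpa using hde
  have h1 := hp d (left_ne_zero_of_mul h)
  have h2 := hq e (right_ne_zero_of_mul h)
  have h3 : c.degree = d.degree + e.degree := by rw [← hde', map_add]
  omega

theorem OrdGE.mul_le {k k' m : ℕ} {p q : coeffRing n} (hp : OrdGE k p) (hq : OrdGE k' q)
    (h : m ≤ k + k') : OrdGE m (p * q) := (hp.mul hq).mono h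

theorem OrdGE.sum {ι : Type*} {s : Finset ι} {k : ℕ} {p : ι → coeffRing n}
    (h : ∀ i ∈ s, OrdGE k (p i)) : OrdGE k (∑ i ∈ s, p i) :=
  Finset.sum_induction _ (OrdGE k) (fun _ _ => OrdGE.add) (OrdGE.zero k) h

theorem OrdGE.splitSum {X : Type*} {k : ℕ} {f : List X → List X → coeffRing n} {l : List X}
    (h : ∀ a b, a ++ b = l → OrdGE k (f a b)) : OrdGE k (splitSum f l) :=
  splitSum_induction (OrdGE.zero k) (fun _ _ => OrdGE.add) h

theorem OrdGE.coeff_eq_zero {k : ℕ} {p : coeffRing n} (h : OrdGE k p) {c : Fin n →₀ ℕ}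
    (hc : 2 * c.degree < k) : coeff c p = 0 :=
  by_contra fun h' => absurd (h c h') (by omega)

/-- The functional `Ψ` on words has weight at least `v`, where a monomial of order `k` in its
value on a word of length `s` has weight `2 k + s`. -/
def WtGE {X : Type*} (v : ℕ) (Ψ : List X → coeffRing n) : Prop :=
  -- The subtraction is truncated: nothing is required on words of length at least `v`.
  ∀ l, OrdGE (v - l.length) (Ψ l)

variable {X : Type*}

theorem WtGE.mono {v v' : ℕ} {Ψ : List X → coeffRing n} (h : WtGE v Ψ) (hv : v' ≤ v) :
    WtGE v' Ψ := fun l => (h l).mono (by omega)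

theorem WtGE.cons {v : ℕ} {Ψ : List X → coeffRing n} (h : WtGE v Ψ) (x : X) :
    WtGE (v - 1) (fun w => Ψ (x :: w)) := fun l => (h (x :: l)).mono (by simp; omega)

theorem WtGE.add {v : ℕ} {Ψ Φ : List X → coeffRing n} (h : WtGE v Ψ) (h' : WtGE v Φ) :
    WtGE v (fun w => Ψ w + Φ w) := fun l => (h l).add (h' l)

theorem WtGE.sub {v : ℕ} {Ψ Φ : List X → coeffRing n} (h : WtGE v Ψ) (h' : WtGE v Φ) :
    WtGE v (fun w => Ψ w - Φ w) := fun l => (h l).sub (h' l)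

/-- The identity cochain: the identity in length one and zero in all other lengths. -/
noncomputable def idFam [DecidableEq X] (l : List X) (K : X) : coeffRing n := if l = [K] then 1 else 0

theorem splitSum_right_nil (f : List X → coeffRing n) (g : List X → coeffRing n)
    (hg : ∀ w, w ≠ [] → g w = 0) (l : List X) :
    splitSum (fun a b => f a * g b) l = f l * g [] := by
  rw [splitSum, Finset.sum_range_succ, Finset.sum_eq_zero, zero_add]
  · simp
  · intro i hi
    rw [Finset.mem_range] at hi
    rw [hg, mul_zero]
    intro h
    have := congrArg List.length h
    simp at this
    omega

variable [Fintype X]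

theorem WtGE.push {F : List X → X → coeffRing n} {v : ℕ} {Ψ : List X → coeffRing n}
    (hΨ : WtGE v Ψ) : WtGE v (push F Ψ) := by
  intro l
  induction h : l.length using Nat.strong_induction_on generalizing Ψ l v with
  | _ k ih =>
    cases l with
    | nil => rw [push_nil, ← h]; exact hΨ []
    | cons x l =>
      rw [push_cons]
      refine OrdGE.splitSum fun a b hab => OrdGE.sum fun K _ => ?_
      subst hab h
      exact (OrdGE.of_zero _).mul_le (ih b.length (by grind) (hΨ.cons K) b rfl) (by grind)

/-- Sums over two-part cuts of the identity cochain pick out the first letter. -/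
theorem splitSum_idFam [DecidableEq X] (x : X) (l : List X) (g : X → List X → coeffRing n) :
    splitSum (fun a b => ∑ K, idFam (x :: a) K * g K b) l = g x l := by
  have h : ∀ a b, a ++ b = l → ∑ K, idFam (x :: a) K * g K b = if a = [] then g x b else 0 := by
    intro a b _
    by_cases ha : a = []
    · subst ha
      simp [idFam]
    · simp [idFam, ha]
  rw [splitSum_congr h]
  cases l with
  | nil => simp [splitSum_nil]
  | cons y l => simp [splitSum_cons, splitSum_zero]

theorem push_cons_sub [DecidableEq X] (F : List X → X → coeffRing n) (g : X → List X → coeffRing n)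
    (x : X) (l : List X) :
    splitSum (fun a b => ∑ K, F (x :: a) K * g K b) l =
      g x l + splitSum (fun a b => ∑ K, (F (x :: a) K - idFam (x :: a) K) * g K b) l := by
  simp only [sub_mul, Finset.sum_sub_distrib, splitSum_sub, splitSum_idFam]
  ring

theorem WtGE.push_sub [DecidableEq X] {F : List X → X → coeffRing n} {v : ℕ}
    {Ψ : List X → coeffRing n} (hΨ : WtGE v Ψ)
    (hF : ∀ K, WtGE 2 (fun l => F l K - idFam l K)) :
    WtGE (v + 1) (fun l => AInf.push F Ψ l - Ψ l) := by
  intro l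
  induction l generalizing Ψ v with
  | nil => simpa [push_nil] using OrdGE.zero _
  | cons x l ih =>
    change OrdGE _ (AInf.push F Ψ (x :: l) - Ψ (x :: l))
    rw [push_cons, push_cons_sub, add_sub_right_comm]
    refine ((ih (hΨ.cons x)).mono (by simp; omega)).add ?_
    refine OrdGE.splitSum fun a b hab => OrdGE.sum fun K _ => ?_
    subst hab
    exact (hF K (x :: a)).mul_le ((hΨ.cons K).push b) (by grind)

theorem WtGE.dstar {t : X → coeffRing n} {η : List X → X → coeffRing n} {k v : ℕ}
    {Ψ : List X → coeffRing n} (hη : ∀ K, WtGE (k + 1) (fun l => η l K)) (hΨ : WtGE v Ψ) :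
    WtGE (v + k) (dstar t η Ψ) := by
  intro l
  induction l generalizing Ψ v with
  | nil => exact OrdGE.zero _
  | cons x l ih =>
    rw [AInf.dstar]
    refine OrdGE.add ?_ ?_
    · refine OrdGE.splitSum fun a b hab => OrdGE.sum fun K _ => ?_
      subst hab
      exact (hη K (x :: a)).mul_le (hΨ (K :: b)) (by grind)
    · exact (OrdGE.of_zero _).mul_le (ih (hΨ.cons x)) (by simp; omega)

theorem dstar_sub_left (t : X → coeffRing n) (η η' : List X → X → coeffRing n)
    (Ψ : List X → coeffRing n) (l : List X) :
    dstar t (fun w K => η w K - η' w K) Ψ l = dstar t η Ψ l - dstar t η' Ψ l := by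
  induction l generalizing Ψ with
  | nil => simp [dstar]
  | cons x l ih =>
    simp only [dstar, ih, sub_mul, Finset.sum_sub_distrib, splitSum_sub]
    ring

theorem WtGE.dstar_sub {t : X → coeffRing n} {η η' : List X → X → coeffRing n} {k v : ℕ}
    {Ψ : List X → coeffRing n} (hη : ∀ K, WtGE (k + 1) (fun l => η l K - η' l K))
    (hΨ : WtGE v Ψ) :
    WtGE (v + k) (fun l => AInf.dstar t η Ψ l - AInf.dstar t η' Ψ l) := by
  intro l
  change OrdGE _ (AInf.dstar t η Ψ l - AInf.dstar t η' Ψ l)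
  rw [← dstar_sub_left]
  exact WtGE.dstar (η := fun w K => η w K - η' w K) hη hΨ l

theorem WtGE.defectStar {t : X → coeffRing n} {η F μ : List X → X → coeffRing n} {v w : ℕ}
    {Ψ : List X → coeffRing n} (hF : ∀ l K, (l.map t).prod * F l K = t K * F l K)
    (hE : ∀ K, WtGE v (defect t η F μ K)) (hΨ : WtGE w Ψ) :
    WtGE (w + v - 1) (defectStar t η F μ Ψ) := by
  intro l
  induction h : l.length using Nat.strong_induction_on generalizing Ψ l w with
  | _ k ih =>
    cases l with
    | nil => rw [defectStar_nil]; exact OrdGE.zero _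
    | cons x l =>
      rw [defectStar_cons t η F μ hF]
      refine OrdGE.add ?_ ?_
      · refine OrdGE.splitSum fun a b hab => OrdGE.sum fun K _ => ?_
        subst hab h
        exact (hE K (x :: a)).mul_le ((hΨ.cons K).push b) (by grind)
      · refine OrdGE.splitSum fun a b hab => OrdGE.sum fun K _ => ?_
        subst hab h
        exact (OrdGE.of_zero _).mul_le (ih b.length (by grind) (hΨ.cons K) b rfl) (by grind)

theorem WtGE.push_sub_push {F F' : List X → X → coeffRing n} {u w : ℕ}
    {Φ : List X → coeffRing n} (hF : ∀ K, WtGE u (fun l => F' l K - F l K)) (hΦ : WtGE w Φ) :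
    WtGE (w + u - 1) (fun l => AInf.push F' Φ l - AInf.push F Φ l) := by
  intro l
  induction h : l.length using Nat.strong_induction_on generalizing Φ l w with
  | _ k ih =>
    cases l with
    | nil => simpa [push_nil] using OrdGE.zero _
    | cons x l =>
      change OrdGE _ (AInf.push F' Φ (x :: l) - AInf.push F Φ (x :: l))
      rw [push_cons, push_cons, ← splitSum_sub]
      refine OrdGE.splitSum fun a b hab => ?_
      rw [← Finset.sum_sub_distrib]
      refine OrdGE.sum fun K _ => ?_
      subst hab h
      have e : F' (x :: a) K * AInf.push F' (fun w => Φ (K :: w)) b -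
          F (x :: a) K * AInf.push F (fun w => Φ (K :: w)) b =
          (F' (x :: a) K - F (x :: a) K) * AInf.push F' (fun w => Φ (K :: w)) b +
          F (x :: a) K * (AInf.push F' (fun w => Φ (K :: w)) b -
            AInf.push F (fun w => Φ (K :: w)) b) := by ring
      rw [e]
      exact ((hF K (x :: a)).mul_le ((hΦ.cons K).push b) (by grind)).add
        ((OrdGE.of_zero _).mul_le (ih b.length (by grind) (hΦ.cons K) b rfl) (by grind))

/-! ### Functionals supported on short words -/

theorem push_of_nil {F : List X → X → coeffRing n} {Φ : List X → coeffRing n}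
    (hΦ : ∀ w, w ≠ [] → Φ w = 0) (l : List X) : push F Φ l = Φ l := by
  cases l with
  | nil => rw [push_nil]
  | cons x l =>
    rw [push_cons, hΦ _ (by simp), ← splitSum_zero l]
    refine splitSum_congr fun a b _ => Finset.sum_eq_zero fun K _ => ?_
    have : (fun w => Φ (K :: w)) = fun _ => 0 := funext fun w => hΦ _ (by simp)
    rw [this, push_zero, mul_zero]

theorem dstar_eq_zero_of_nil {t : X → coeffRing n} {η : List X → X → coeffRing n}
    {Φ : List X → coeffRing n} (hΦ : ∀ w, w ≠ [] → Φ w = 0) (l : List X) : dstar t η Φ l = 0 := by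
  cases l with
  | nil => rfl
  | cons x l =>
    have h : ∀ K, (fun w => Φ (K :: w)) = fun _ => 0 := fun K => funext fun w => hΦ _ (by simp)
    rw [dstar, h, dstar_zero]
    simp [hΦ, splitSum_zero]

theorem push_of_single {F : List X → X → coeffRing n} {Φ : List X → coeffRing n}
    (hΦ : ∀ w, w.length ≠ 1 → Φ w = 0) (x : X) (l : List X) :
    push F Φ (x :: l) = ∑ L, F (x :: l) L * Φ [L] := by
  rw [push_cons, splitSum_sum]
  refine Finset.sum_congr rfl fun L _ => ?_
  have h : ∀ w, w ≠ [] → (fun w => Φ (L :: w)) w = 0 := fun w hw =>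
    hΦ _ (by simpa using hw)
  simp only [push_of_nil h]
  exact splitSum_right_nil (fun a => F (x :: a) L) (fun w => Φ (L :: w)) h l

theorem defectStar_of_single {t : X → coeffRing n} {η F μ : List X → X → coeffRing n}
    {Φ : List X → coeffRing n} (hF : ∀ l K, (l.map t).prod * F l K = t K * F l K)
    (hΦ : ∀ w, w.length ≠ 1 → Φ w = 0) (x : X) (l : List X) :
    defectStar t η F μ Φ (x :: l) = ∑ L, defect t η F μ L (x :: l) * Φ [L] := by
  have h : ∀ L w, w ≠ [] → (fun w => Φ (L :: w)) w = 0 := fun L w hw =>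
    hΦ _ (by simpa using hw)
  have h2 : ∀ L b, defectStar t η F μ (fun w => Φ (L :: w)) b = 0 := by
    intro L b
    have e1 : dstar t μ (fun w => Φ (L :: w)) = fun _ => 0 :=
      funext fun w => dstar_eq_zero_of_nil (h L) w
    have e2 : push F (fun w => Φ (L :: w)) = fun w => Φ (L :: w) :=
      funext fun w => push_of_nil (h L) w
    rw [defectStar, e1, e2, dstar_eq_zero_of_nil (h L), push_zero, sub_zero]
  rw [defectStar_cons t η F μ hF]
  simp only [h2, mul_zero, Finset.sum_const_zero, splitSum_zero, add_zero]
  rw [splitSum_sum]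
  refine Finset.sum_congr rfl fun L _ => ?_
  simp only [push_of_nil (h L)]
  exact splitSum_right_nil (fun a => defect t η F μ L (x :: a)) (fun w => Φ (L :: w)) (h L) l

end Weights

/-! ### Leading coefficients of the defect -/

section Leading

open MvPolynomial

variable {n : ℕ}

/-- The exterior algebra as an `A_∞` structure: the binary operation is the (signed) exterior
product and all other operations vanish. -/
noncomputable def mStr : List (Finset (Fin n)) → Finset (Fin n) → coeffRing n
  | [x, y], K => C (extMul x y K)
  | _, _ => 0

theorem mStr_of_length_ne {l : List (Finset (Fin n))} (h : l.length ≠ 2) (K : Finset (Fin n)) :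
    mStr l K = 0 := by
  match l with
  | [] => rfl
  | [_] => rfl
  | [_, _] => simp at h
  | _ :: _ :: _ :: _ => rfl

theorem mStr_pair (x y K : Finset (Fin n)) : mStr [x, y] K = C (extMul x y K) := rfl

theorem wtGE_mStr (K : Finset (Fin n)) : WtGE 2 (fun l => mStr l K) := by
  intro l
  by_cases h : l.length = 2
  · rw [h]
    exact OrdGE.of_zero _
  · change OrdGE _ (mStr l K)
    rw [mStr_of_length_ne h]
    exact OrdGE.zero _

/-- The part of `barStar` that applies the augmentation to the last letter. -/
noncomputable def lastAug : (List (Finset (Fin n)) → ℂ) → List (Finset (Fin n)) → ℂ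
  | _, [] => 0
  | φ, [x] => if x = ∅ then φ [] else 0
  | φ, x :: y :: l => sgnShift ℂ x * lastAug (fun w => φ (x :: w)) (y :: l)

theorem lastAug_append (φ : List (Finset (Fin n)) → ℂ) (l : List (Finset (Fin n)))
    (y : Finset (Fin n)) :
    lastAug φ (l ++ [y]) = (l.map (sgnShift ℂ)).prod * if y = ∅ then φ l else 0 := by
  induction l generalizing φ with
  | nil => simp [lastAug]
  | cons x l ih =>
    have h : lastAug φ (x :: (l ++ [y])) =
        sgnShift ℂ x * lastAug (fun w => φ (x :: w)) (l ++ [y]) := by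
      cases l <;> rfl
    rw [List.cons_append, h, ih, List.map_cons, List.prod_cons, mul_assoc]

theorem sgnShift_eq_C (x : Finset (Fin n)) : sgnShift (coeffRing n) x = C (sgnShift ℂ x) := by
  simp [sgnShift]

theorem coeff_dstar_mStr (c : Fin n →₀ ℕ) (f : List (Finset (Fin n)) → coeffRing n)
    (l : List (Finset (Fin n))) :
    coeff c (dstar (sgnShift (coeffRing n)) mStr f l) =
      barStar (fun w => coeff c (f w)) l - lastAug (fun w => coeff c (f w)) l := by
  induction l generalizing f with
  | nil => simp [dstar, barStar, lastAug]
  | cons x l ih =>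
    rw [dstar, coeff_add, sgnShift_eq_C, coeff_C_mul, ih, barStar]
    cases l with
    | nil =>
      simp [splitSum_nil, mStr, barStar, lastAug, consMul]
    | cons y l =>
      have h : splitSum (fun a b => ∑ K, mStr (x :: a) K * f (K :: b)) (y :: l) =
          ∑ K, C (extMul x y K) * f (K :: l) := by
        rw [splitSum_cons, splitSum_sum]
        have h0 : ∑ K, mStr [x] K * f (K :: y :: l) = 0 :=
          Finset.sum_eq_zero fun K _ => by rw [mStr_of_length_ne (by simp), zero_mul]
        rw [h0, zero_add]
        refine Finset.sum_congr rfl fun K _ => ?_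
        cases l with
        | nil => rw [splitSum_nil, mStr_pair]
        | cons z l =>
          rw [splitSum_cons, mStr_pair]
          rw [splitSum_congr (g := fun _ _ => 0), splitSum_zero, add_zero]
          exact fun a b _ => by rw [mStr_of_length_ne (by simp), zero_mul]
      rw [h, coeff_sum, lastAug, consMul]
      simp only [coeff_C_mul, smul_eq_mul]
      ring


variable {G : Finset (Fin n) → List (Finset (Fin n)) → coeffRing n}

theorem splitSum_append_singleton {X N : Type*} [AddCommMonoid N] {f : List X → List X → N}
    (hf : ∀ a b, b.length ≠ 1 → f a b = 0) (l : List X) (y : X) :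
    splitSum f (l ++ [y]) = f l [y] := by
  induction l generalizing f with
  | nil => rw [List.nil_append, splitSum_cons, splitSum_nil, hf [y] [] (by simp), add_zero]
  | cons x l ih =>
    rw [List.cons_append, splitSum_cons, ih fun a b hb => hf _ _ hb, hf _ _ (by simp), zero_add]

/-- Multiplying the last letter of a word into the value of a family: for weight reasons only
multiplication with the unit contributes. -/
theorem coeff_splitSum_mStr {K : Finset (Fin n)} {c : Fin n →₀ ℕ} (x : Finset (Fin n))
    (l : List (Finset (Fin n))) (y : Finset (Fin n))
    (hG : ∀ L, L.card < K.card → coeff c (G L (x :: l)) = 0) :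
    coeff c (splitSum (fun a b => ∑ L, G L (x :: a) * mStr (L :: b) K) (l ++ [y])) =
      if y = ∅ then (-1) ^ K.card * coeff c (G K (x :: l)) else 0 := by
  rw [splitSum_append_singleton]
  · rw [coeff_sum]
    simp only [mStr_pair, mul_comm _ (C _), coeff_C_mul]
    have h : ∀ L, L ≠ K → extMul L y K * coeff c (G L (x :: l)) = 0 := by
      intro L hL
      by_cases h0 : extMul L y K = 0
      · rw [h0, zero_mul]
      · have h1 := card_of_extMul_ne_zero h0
        rcases Nat.eq_zero_or_pos y.card with hy | hy
        · rw [Finset.card_eq_zero] at hy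
          subst hy
          rw [extMul_empty_right, if_neg hL, zero_mul]
        · rw [hG L (by omega), mul_zero]
    rw [Finset.sum_eq_single K (fun L _ => h L) (by simp)]
    split_ifs with hy
    · rw [hy, extMul_empty_right, if_pos rfl]
    · rw [mul_eq_zero]
      left
      by_contra h0
      have h1 := card_of_extMul_ne_zero h0
      exact hy (Finset.card_eq_zero.1 (by omega))
  · intro a b hb
    exact Finset.sum_eq_zero fun L _ => by rw [mStr_of_length_ne (by simpa using hb), mul_zero]

/-- The analogue of `coeff_splitSum_mStr` for multiplication by the first letter. -/
theorem coeff_sum_mStr {K : Finset (Fin n)} {c : Fin n →₀ ℕ} (x : Finset (Fin n))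
    (l : List (Finset (Fin n))) (hG : ∀ L, L.card < K.card → coeff c (G L l) = 0) :
    coeff c (∑ L, G L l * mStr [x, L] K) = if x = ∅ then coeff c (G K l) else 0 := by
  rw [coeff_sum]
  simp only [mStr_pair, mul_comm _ (C _), coeff_C_mul]
  have h : ∀ L, L ≠ K → extMul x L K * coeff c (G L l) = 0 := by
    intro L hL
    by_cases h0 : extMul x L K = 0
    · rw [h0, zero_mul]
    · have h1 := card_of_extMul_ne_zero h0
      rcases Nat.eq_zero_or_pos x.card with hx | hx
      · rw [Finset.card_eq_zero] at hx
        subst hx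
        rw [extMul_empty_left, if_neg hL, zero_mul]
      · rw [hG L (by omega), mul_zero]
  rw [Finset.sum_eq_single K (fun L _ => h L) (by simp)]
  split_ifs with hx
  · rw [hx, extMul_empty_left, if_pos rfl, one_mul]
  · rw [mul_eq_zero]
    left
    by_contra h0
    have h1 := card_of_extMul_ne_zero h0
    exact hx (Finset.card_eq_zero.1 (by omega))

theorem list_prod_sgnShift (l : List (Finset (Fin n))) :
    (l.map (sgnShift (coeffRing n))).prod = C (l.map (sgnShift ℂ)).prod := by
  rw [map_list_prod, List.map_map]
  exact congrArg List.prod (List.map_congr_left fun x _ => sgnShift_eq_C x)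

theorem mStr_cons_of_length_ne {L K : Finset (Fin n)} {w : List (Finset (Fin n))}
    (h : w.length ≠ 1) : mStr (L :: w) K = 0 := mStr_of_length_ne (by simpa using h) K

variable {η μ F : List (Finset (Fin n)) → Finset (Fin n) → coeffRing n}

local notation "τ" => sgnShift (coeffRing n)

/-- The part of lowest weight of `defectStar`, precomposed to a component of the exterior
product. -/
theorem ordGE_defectStar_mStr_sub {v : ℕ}
    (hF : ∀ l K, (l.map τ).prod * F l K = τ K * F l K)
    (hF2 : ∀ K, WtGE 2 (fun l => F l K - idFam l K))
    (hE : ∀ K, WtGE v (defect τ η F μ K)) (K x : Finset (Fin n)) (l : List (Finset (Fin n)))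
    (hl : l ≠ []) :
    OrdGE (v + 2 - (l.length + 1)) (defectStar τ η F μ (fun w => mStr w K) (x :: l) -
      (splitSum (fun a b => ∑ L, defect τ η F μ L (x :: a) * mStr (L :: b) K) l +
        τ x * ∑ L, defect τ η F μ L l * mStr [x, L] K)) := by
  have hm : ∀ L, WtGE 1 (fun w => mStr (L :: w) K) := fun L => (wtGE_mStr K).cons L
  have h1 : ∀ L b, b ≠ [] → defectStar τ η F μ (fun w => mStr (L :: w) K) b =
      ∑ M, defect τ η F μ M b * mStr [L, M] K := by
    intro L b hb
    obtain ⟨y, b, rfl⟩ := List.exists_cons_of_ne_nil hb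
    exact defectStar_of_single hF (fun w hw => mStr_cons_of_length_ne hw) y b
  rw [defectStar_cons τ η F μ hF]
  have e1 : splitSum (fun a b => ∑ L, τ L * F (x :: a) L *
      defectStar τ η F μ (fun w => mStr (L :: w) K) b) l =
      splitSum (fun a b => ∑ L, F (x :: a) L *
        (τ L * defectStar τ η F μ (fun w => mStr (L :: w) K) b)) l :=
    splitSum_congr fun a b _ => Finset.sum_congr rfl fun L _ => by ring
  rw [e1, push_cons_sub F (fun L b => τ L * defectStar τ η F μ (fun w => mStr (L :: w) K) b),
    h1 x l hl]
  rw [show ∀ p q r p' : coeffRing n, p + (q + r) - (p' + q) = (p - p') + r from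
    fun p q r p' => by ring, ← splitSum_sub]
  refine OrdGE.add (OrdGE.splitSum fun a b hab => ?_) (OrdGE.splitSum fun a b hab => ?_)
  · rw [← Finset.sum_sub_distrib]
    refine OrdGE.sum fun L _ => ?_
    rw [← mul_sub]
    refine (hE L (x :: a)).mul_le ((hm L).push_sub hF2 b) ?_
    subst hab
    grind
  · refine OrdGE.sum fun L _ => (hF2 L (x :: a)).mul_le (k' := v - b.length) ?_ ?_
    · refine (OrdGE.of_zero _).mul_le (WtGE.defectStar hF hE (hm L) b) ?_
      omega
    · subst hab
      grind

/-- The leading coefficients of the defect form a cocycle. -/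
theorem barDiff_coeff_defect {v : ℕ} {K : Finset (Fin n)}
    (hη : ∀ l K, (l.map τ).prod * η l K = - (τ K * η l K))
    (hrel : ∀ K l, dstar τ η (fun w => η w K) l = 0)
    (hrel' : ∀ K l, dstar τ μ (fun w => μ w K) l = 0)
    (hη3 : ∀ K, WtGE 3 (fun l => η l K - mStr l K))
    (hμ3 : ∀ K, WtGE 3 (fun l => μ l K - mStr l K))
    (hF : ∀ l K, (l.map τ).prod * F l K = τ K * F l K)
    (hF2 : ∀ K, WtGE 2 (fun l => F l K - idFam l K))
    (hE : ∀ K, WtGE v (defect τ η F μ K))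
    (hE' : ∀ L, L.card < K.card → WtGE (v + 1) (defect τ η F μ L))
    (hEpar : ∀ l, (l.map τ).prod * defect τ η F μ K l = - (τ K * defect τ η F μ K l))
    {c : Fin n →₀ ℕ} {l : List (Finset (Fin n))} (hl : 2 ≤ l.length)
    (hc : 2 * c.degree + l.length = v + 1) :
    barDiff (fun w => coeff c (defect τ η F μ K w)) l = 0 := by
  obtain ⟨x, l', rfl⟩ := List.exists_cons_of_ne_nil (l := l) (by rintro rfl; simp at hl)
  obtain ⟨l, y, rfl⟩ := List.eq_nil_or_concat' l' |>.resolve_left (by rintro rfl; simp at hl)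
  set E := defect τ η F μ
  simp only [List.length_cons, List.length_append, List.length_nil] at hc hl
  have hord : ∀ {p : coeffRing n} {k : ℕ}, OrdGE k p → v + 2 ≤ k + (l.length + 2) →
      coeff c p = 0 := fun hp hk => hp.coeff_eq_zero (by omega)
  have hlow : ∀ w, w.length = l.length + 1 → ∀ L, L.card < K.card → coeff c (E L w) = 0 :=
    fun w hw L hL => ((hE' L hL) w).coeff_eq_zero (by omega)
  have h0 := defectStar_add_dstar_defect τ η F μ hη hrel hrel' K (x :: (l ++ [y]))
  have h1 : coeff c (defectStar τ η F μ (fun w => μ w K) (x :: (l ++ [y])) -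
      defectStar τ η F μ (fun w => mStr w K) (x :: (l ++ [y]))) = 0 := by
    have e : defectStar τ η F μ (fun w => μ w K - mStr w K) (x :: (l ++ [y])) =
      defectStar τ η F μ (fun w => μ w K) (x :: (l ++ [y])) -
      defectStar τ η F μ (fun w => mStr w K) (x :: (l ++ [y])) := by
      simp only [defectStar, dstar_sub, push_sub]
      ring
    rw [← e]
    exact hord (WtGE.defectStar hF hE (hμ3 K) _) (by simp; omega)
  have h2 := hord (ordGE_defectStar_mStr_sub hF hF2 hE K x (l ++ [y]) (by simp)) (by simp; omega)
  have h3 : coeff c (dstar τ η (E K) (x :: (l ++ [y])) - dstar τ mStr (E K) (x :: (l ++ [y])))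
      = 0 := hord (WtGE.dstar_sub hη3 (hE K) _) (by simp; omega)
  rw [sgnShift_eq_C, coeff_sub, coeff_add, coeff_C_mul,
    coeff_splitSum_mStr x l y (hlow _ (by simp)), coeff_sum_mStr x _ (hlow _ (by simp))] at h2
  rw [coeff_sub, coeff_dstar_mStr, ← List.cons_append, lastAug_append] at h3
  have h4 := congrArg (coeff c) (hEpar (x :: l))
  rw [list_prod_sgnShift, sgnShift_eq_C, coeff_C_mul, coeff_neg, coeff_C_mul] at h4
  have h5 := congrArg (coeff c) h0
  rw [coeff_add, coeff_zero] at h5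
  rw [coeff_sub] at h1
  rw [barDiff, headAug]
  rw [← List.cons_append] at *
  have hK : sgnShift ℂ K = - (-1) ^ K.card := by rw [sgnShift, pow_succ]; ring
  rw [hK] at h4
  have hx : x = ∅ → sgnShift ℂ x = -1 := by rintro rfl; simp [sgnShift]
  split_ifs at h2 h3 ⊢ with h6 h7 h7
  · rw [hx h6] at h2
    linear_combination h5 - h1 - h2 - h3 + h4
  · rw [hx h6] at h2
    linear_combination h5 - h1 - h2 - h3
  · linear_combination h5 - h1 - h2 - h3 + h4
  · linear_combination h5 - h1 - h2 - h3


section Correction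

variable {F' : List (Finset (Fin n)) → Finset (Fin n) → coeffRing n}

/-- Changing `F` in weight `v - 1` changes the defect in weight `v`. -/
theorem wtGE_defect_sub_defect {v : ℕ} (hv : 1 ≤ v) (hη2 : ∀ K, WtGE 2 (fun l => η l K))
    (hμ2 : ∀ K, WtGE 2 (fun l => μ l K)) (hF' : ∀ K, WtGE (v - 1) (fun l => F' l K - F l K))
    (K : Finset (Fin n)) :
    WtGE v (fun l => defect τ η F' μ K l - defect τ η F μ K l) := by
  intro l
  have e : defect τ η F' μ K l - defect τ η F μ K l =
      (push F' (fun w => μ w K) l - push F (fun w => μ w K) l) -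
        dstar τ η (fun w => F' w K - F w K) l := by
    rw [defect, defect, dstar_sub]
    ring
  change OrdGE _ (defect τ η F' μ K l - defect τ η F μ K l)
  rw [e]
  exact ((WtGE.push_sub_push hF' (hμ2 K) l).mono (by omega)).sub
    ((WtGE.dstar (k := 1) hη2 (hF' K) l).mono (by omega))

/-- The part of lowest weight of the change in the product of two values of `F` when `F` changes to
`F'`: one factor is the change, the other a single letter, on which `F` is the identity to lowest
weight. -/
theorem ordGE_push_mStr_sub {v : ℕ} (hF2 : ∀ K, WtGE 2 (fun l => F l K - idFam l K))
    (hF'2 : ∀ K, WtGE 2 (fun l => F' l K - idFam l K))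
    (hF' : ∀ K, WtGE (v - 1) (fun l => F' l K - F l K))
    (K x : Finset (Fin n)) (l : List (Finset (Fin n))) (hl : l ≠ []) :
    OrdGE (v + 1 - (l.length + 1)) (push F' (fun w => mStr w K) (x :: l) -
      push F (fun w => mStr w K) (x :: l) -
      (splitSum (fun a b => ∑ L, (F' (x :: a) L - F (x :: a) L) * mStr (L :: b) K) l +
        ∑ L, (F' l L - F l L) * mStr [x, L] K)) := by
  have hm : ∀ L, WtGE 1 (fun w => mStr (L :: w) K) := fun L => (wtGE_mStr K).cons L
  have h1 : ∀ L b, b ≠ [] → push F' (fun w => mStr (L :: w) K) b -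
      push F (fun w => mStr (L :: w) K) b = ∑ M, (F' b M - F b M) * mStr [L, M] K := by
    intro L b hb
    obtain ⟨y, b, rfl⟩ := List.exists_cons_of_ne_nil hb
    rw [push_of_single (fun w hw => mStr_cons_of_length_ne hw),
      push_of_single (fun w hw => mStr_cons_of_length_ne hw), ← Finset.sum_sub_distrib]
    exact Finset.sum_congr rfl fun M _ => by ring
  have h2 := push_cons_sub F (fun L b => push F' (fun w => mStr (L :: w) K) b -
    push F (fun w => mStr (L :: w) K) b) x l
  rw [h1 x l hl] at h2
  have e : push F' (fun w => mStr w K) (x :: l) - push F (fun w => mStr w K) (x :: l) =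
      splitSum (fun a b => ∑ L, (F' (x :: a) L - F (x :: a) L) *
        push F' (fun w => mStr (L :: w) K) b) l +
      splitSum (fun a b => ∑ L, F (x :: a) L * (push F' (fun w => mStr (L :: w) K) b -
        push F (fun w => mStr (L :: w) K) b)) l := by
    rw [push_cons, push_cons, ← splitSum_sub, ← splitSum_add]
    refine splitSum_congr fun a b _ => ?_
    rw [← Finset.sum_sub_distrib, ← Finset.sum_add_distrib]
    exact Finset.sum_congr rfl fun L _ => by ring
  rw [e, h2, show ∀ p q r p' : coeffRing n, p + (q + r) - (p' + q) = (p - p') + r from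
    fun p q r p' => by ring, ← splitSum_sub]
  refine OrdGE.add (OrdGE.splitSum fun a b hab => ?_) (OrdGE.splitSum fun a b hab => ?_)
  · rw [← Finset.sum_sub_distrib]
    refine OrdGE.sum fun L _ => ?_
    rw [← mul_sub]
    refine (hF' L (x :: a)).mul_le ((hm L).push_sub hF'2 b) ?_
    subst hab
    grind
  · refine OrdGE.sum fun L _ => (hF2 L (x :: a)).mul_le (WtGE.push_sub_push hF' (hm L) b) ?_
    subst hab
    grind

/-- Changing `F` in weight `v - 1` changes the leading coefficients of the defect by a
coboundary. -/
theorem coeff_defect_sub_defect {v : ℕ} (hv : 3 ≤ v) {K : Finset (Fin n)}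
    (hη3 : ∀ K, WtGE 3 (fun l => η l K - mStr l K))
    (hμ3 : ∀ K, WtGE 3 (fun l => μ l K - mStr l K))
    (hF2 : ∀ K, WtGE 2 (fun l => F l K - idFam l K))
    (hF' : ∀ K, WtGE (v - 1) (fun l => F' l K - F l K))
    (hlow : ∀ L, L.card < K.card → ∀ w, F' w L - F w L = 0)
    (hpar : ∀ l, (l.map τ).prod * (F' l K - F l K) = τ K * (F' l K - F l K))
    {c : Fin n →₀ ℕ} {l : List (Finset (Fin n))} (hl : l ≠ []) (hc : 2 * c.degree + l.length = v) :
    coeff c (defect τ η F' μ K l) = coeff c (defect τ η F μ K l) -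
      barDiff (fun w => coeff c (F' w K - F w K)) l := by
  have hF'2 : ∀ K, WtGE 2 (fun l => F' l K - idFam l K) := fun K l =>
    (((hF' K).mono (by omega : 2 ≤ v - 1)).add (hF2 K) l).congr (by ring)
  have e1 : ∀ l, defect τ η F' μ K l - defect τ η F μ K l =
      (push F' (fun w => μ w K - mStr w K) l - push F (fun w => μ w K - mStr w K) l) +
      (push F' (fun w => mStr w K) l - push F (fun w => mStr w K) l) -
        dstar τ η (fun w => F' w K - F w K) l := by
    intro l
    rw [defect, defect, dstar_sub, push_sub, push_sub]
    ring
  have h1 : coeff c (push F' (fun w => μ w K - mStr w K) l -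
      push F (fun w => μ w K - mStr w K) l) = 0 :=
    (WtGE.push_sub_push hF' (hμ3 K) l).coeff_eq_zero (by omega)
  have h2 : coeff c (dstar τ η (fun w => F' w K - F w K) l -
      dstar τ mStr (fun w => F' w K - F w K) l) = 0 :=
    (WtGE.dstar_sub hη3 (hF' K) l).coeff_eq_zero (by omega)
  rw [coeff_sub, coeff_dstar_mStr] at h2
  have h3 := congrArg (coeff c) (e1 l)
  rw [coeff_sub, coeff_sub, coeff_add, h1, coeff_sub] at h3
  obtain ⟨x, l', rfl⟩ := List.exists_cons_of_ne_nil hl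
  rcases List.eq_nil_or_concat' l' with rfl | ⟨l, y, rfl⟩
  · have h4 : ∀ F : List (Finset (Fin n)) → Finset (Fin n) → coeffRing n,
        push F (fun w => mStr w K) [x] = 0 := by
      intro F
      simp [push_cons, splitSum_nil, push_nil, mStr]
    rw [h4, h4] at h3
    simp only [barDiff, barStar, consMul, headAug, lastAug] at h2 h3 ⊢
    simp at h2 h3 ⊢
    linear_combination h3 - h2
  · have h4 := (ordGE_push_mStr_sub hF2 hF'2 hF' K x (l ++ [y]) (by simp)).coeff_eq_zero
      (c := c) (by simp at hc ⊢; omega)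
    rw [coeff_sub, coeff_add, coeff_splitSum_mStr (G := fun L w => F' w L - F w L) x l y
      (fun L hL => by rw [hlow L hL, coeff_zero]), coeff_sum_mStr (G := fun L w => F' w L - F w L)
      x _ (fun L hL => by rw [hlow L hL, coeff_zero]), coeff_sub] at h4
    rw [← List.cons_append, lastAug_append] at h2
    have h5 := congrArg (coeff c) (hpar (x :: l))
    rw [list_prod_sgnShift, sgnShift_eq_C, coeff_C_mul, coeff_C_mul] at h5
    have hK : sgnShift ℂ K = - (-1) ^ K.card := by rw [sgnShift, pow_succ]; ring
    rw [hK] at h5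
    rw [barDiff, headAug]
    rw [← List.cons_append] at *
    split_ifs at h2 h4 ⊢ with h6 h7 h7
    · linear_combination h3 + h4 - h2 + h5
    · linear_combination h3 + h4 - h2
    · linear_combination h3 + h4 - h2 + h5
    · linear_combination h3 + h4 - h2

end Correction

end Leading

/-! ### The grading by `Y` -/

section Degrees

open MvPolynomial

variable {n : ℕ}

/-- The degree of the monomial `r^c`. -/
noncomputable def degMon (n a : ℕ) (c : Fin n →₀ ℕ) : (G n).Y := ∑ j, c j • degR n a j

/-- The degree of the basis element `θ_I`. -/
noncomputable def degExt (I : Finset (Fin n)) : (G n).Y := ∑ j ∈ I, degTheta n j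

/-- The degree of the basis element `θ_I`, shifted by one. -/
noncomputable def sdeg (I : Finset (Fin n)) : (G n).Y := degExt I - (G n).f 1

/-- The shifted degree of a word, the sum of the shifted degrees of its letters. -/
noncomputable def wdeg (l : List (Finset (Fin n))) : (G n).Y := (l.map sdeg).sum

@[simp] theorem wdeg_nil : wdeg ([] : List (Finset (Fin n))) = 0 := rfl

@[simp] theorem wdeg_cons (x : Finset (Fin n)) (l : List (Finset (Fin n))) :
    wdeg (x :: l) = sdeg x + wdeg l := by simp [wdeg]

@[simp] theorem wdeg_append (l l' : List (Finset (Fin n))) :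
    wdeg (l ++ l') = wdeg l + wdeg l' := by simp [wdeg]

theorem sdeg_empty : sdeg (∅ : Finset (Fin n)) = - (G n).f 1 := by simp [sdeg, degExt]

theorem sdeg_union {x y : Finset (Fin n)} (h : Disjoint x y) :
    sdeg (x ∪ y) = sdeg x + sdeg y + (G n).f 1 := by
  rw [sdeg, sdeg, sdeg, degExt, Finset.sum_union h, ← degExt, ← degExt]
  abel

theorem degMon_add (a : ℕ) (c d : Fin n →₀ ℕ) :
    degMon n a (c + d) = degMon n a c + degMon n a d := by
  simp [degMon, add_smul, Finset.sum_add_distrib]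

/-- All monomials of the polynomial `p` have degree `y`. -/
def IsHomog (a : ℕ) (y : (G n).Y) (p : coeffRing n) : Prop := ∀ c, coeff c p ≠ 0 → degMon n a c = y

variable {a : ℕ}

theorem IsHomog.zero (y : (G n).Y) : IsHomog a y 0 := fun c h => absurd (coeff_zero c) h

theorem IsHomog.C (z : ℂ) : IsHomog a (0 : (G n).Y) (C z) := by
  intro c hc
  rw [coeff_C] at hc
  have : c = 0 := by
    by_contra h
    exact hc (if_neg fun h' => h h'.symm)
  simp [this, degMon]

theorem IsHomog.add {y : (G n).Y} {p q : coeffRing n} (hp : IsHomog a y p) (hq : IsHomog a y q) :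
    IsHomog a y (p + q) := by
  intro c hc
  by_cases h : coeff c p = 0
  · exact hq c fun h' => hc (by rw [coeff_add, h, h', add_zero])
  · exact hp c h

theorem IsHomog.neg {y : (G n).Y} {p : coeffRing n} (hp : IsHomog a y p) : IsHomog a y (-p) :=
  fun c hc => hp c fun h => hc (by rw [coeff_neg, h, neg_zero])

theorem IsHomog.sub {y : (G n).Y} {p q : coeffRing n} (hp : IsHomog a y p) (hq : IsHomog a y q) :
    IsHomog a y (p - q) := sub_eq_add_neg p q ▸ hp.add hq.neg

theorem IsHomog.mul {y z u : (G n).Y} {p q : coeffRing n} (hp : IsHomog a y p)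
    (hq : IsHomog a z q) (h : y + z = u) : IsHomog a u (p * q) := by
  intro c hc
  rw [coeff_mul] at hc
  obtain ⟨⟨d, e⟩, hde, h'⟩ := Finset.exists_ne_zero_of_sum_ne_zero hc
  have hde' : d + e = c := by simpa using hde
  rw [← hde', degMon_add, hp d (left_ne_zero_of_mul h'), hq e (right_ne_zero_of_mul h'), h]

theorem IsHomog.sum {ι : Type*} {s : Finset ι} {y : (G n).Y} {p : ι → coeffRing n}
    (h : ∀ i ∈ s, IsHomog a y (p i)) : IsHomog a y (∑ i ∈ s, p i) :=
  Finset.sum_induction _ (IsHomog a y) (fun _ _ => IsHomog.add) (IsHomog.zero y) h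

theorem IsHomog.splitSum {X : Type*} {y : (G n).Y} {f : List X → List X → coeffRing n} {l : List X}
    (h : ∀ u v, u ++ v = l → IsHomog a y (f u v)) : IsHomog a y (splitSum f l) :=
  splitSum_induction (IsHomog.zero y) (fun _ _ => IsHomog.add) h

/-- The functional `Ψ` on words is homogeneous of degree `y`. -/
def IsHomogFun (a : ℕ) (y : (G n).Y) (Ψ : List (Finset (Fin n)) → coeffRing n) : Prop :=
  ∀ l, IsHomog a (wdeg l + y) (Ψ l)

theorem IsHomogFun.cons {y : (G n).Y} {Ψ : List (Finset (Fin n)) → coeffRing n}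
    (h : IsHomogFun a y Ψ) (x : Finset (Fin n)) :
    IsHomogFun a (y + sdeg x) (fun w => Ψ (x :: w)) := by
  intro l
  have := h (x :: l)
  rwa [wdeg_cons, show sdeg x + wdeg l + y = wdeg l + (y + sdeg x) by abel] at this

/-- The family `F` describes a cochain of degree `e + 1`. -/
def IsHomogFam (a : ℕ) (e : ℤ) (F : List (Finset (Fin n)) → Finset (Fin n) → coeffRing n) : Prop :=
  ∀ K, IsHomogFun a (- sdeg K + (G n).f e) (fun l => F l K)

variable {F μ η : List (Finset (Fin n)) → Finset (Fin n) → coeffRing n}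

theorem IsHomogFun.push (hF : IsHomogFam a 0 F) {y : (G n).Y}
    {Ψ : List (Finset (Fin n)) → coeffRing n} (hΨ : IsHomogFun a y Ψ) :
    IsHomogFun a y (push F Ψ) := by
  intro l
  induction h : l.length using Nat.strong_induction_on generalizing Ψ l y with
  | _ k ih =>
    cases l with
    | nil => rw [push_nil]; exact hΨ []
    | cons x l =>
      rw [push_cons]
      refine IsHomog.splitSum fun u v huv => IsHomog.sum fun K _ => ?_
      subst huv h
      refine (hF K (x :: u)).mul (ih v.length (by grind) (hΨ.cons K) v rfl) ?_
      rw [map_zero, wdeg_cons, wdeg_cons, wdeg_append]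
      abel

theorem IsHomogFun.dstar {e : ℤ} (hη : IsHomogFam a e η) {y : (G n).Y}
    {Ψ : List (Finset (Fin n)) → coeffRing n} (hΨ : IsHomogFun a y Ψ) :
    IsHomogFun a (y + (G n).f e) (dstar (sgnShift (coeffRing n)) η Ψ) := by
  intro l
  induction l generalizing Ψ y with
  | nil => exact IsHomog.zero _
  | cons x l ih =>
    rw [AInf.dstar]
    refine IsHomog.add ?_ ?_
    · refine IsHomog.splitSum fun u v huv => IsHomog.sum fun K _ => ?_
      subst huv
      refine (hη K (x :: u)).mul (hΨ (K :: v)) ?_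
      rw [wdeg_cons, wdeg_cons, wdeg_cons, wdeg_append]
      abel
    · rw [sgnShift_eq_C]
      refine (IsHomog.C _).mul (ih (hΨ.cons x)) ?_
      rw [wdeg_cons]
      abel

theorem IsHomogFam.defect (hF : IsHomogFam a 0 F) (hμ : IsHomogFam a 1 μ)
    (hη : IsHomogFam a 1 η) (K : Finset (Fin n)) :
    IsHomogFun a (- sdeg K + (G n).f 1) (defect (sgnShift (coeffRing n)) η F μ K) := by
  intro l
  refine (IsHomogFun.push hF (hμ K) l).sub ?_
  have := IsHomogFun.dstar hη (hF K) l
  rwa [map_zero, add_zero] at this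

theorem isHomogFam_idFam : IsHomogFam a 0 (idFam (n := n)) := by
  intro K l
  change IsHomog _ _ (idFam l K)
  rw [idFam]
  split_ifs with h
  · rw [h, map_zero, wdeg_cons, wdeg_nil, show sdeg K + 0 + (-sdeg K + 0) = (0 : (G n).Y) by abel]
    exact IsHomog.C 1
  · exact IsHomog.zero _

theorem deg_add (j j' : ℤ) (v v' : Fin n → ℤ) : deg n (j + j') (v + v') = deg n j v + deg n j' v' :=
  rfl

theorem deg_zero : deg n 0 0 = 0 := rfl

theorem deg_sub (j j' : ℤ) (v v' : Fin n → ℤ) : deg n (j - j') (v - v') = deg n j v - deg n j' v' :=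
  rfl

theorem f_eq_deg (e : ℤ) : (G n).f e = deg n e 0 := rfl

theorem deg_sum {ι : Type*} (s : Finset ι) (j : ι → ℤ) (v : ι → Fin n → ℤ) :
    ∑ i ∈ s, deg n (j i) (v i) = deg n (∑ i ∈ s, j i) (∑ i ∈ s, v i) := by
  classical
  induction s using Finset.induction_on with
  | empty => simp [deg_zero]
  | insert i s hi ih => simp only [Finset.sum_insert hi, ih, deg_add]

theorem nsmul_deg (k : ℕ) (j : ℤ) (v : Fin n → ℤ) : k • deg n j v = deg n (k • j) (k • v) := rfl

/-- Equality in `Y` is equality up to a multiple `q` of the relation `(2 (1 - n), y_1 + ⋯ + y_n)`. -/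
theorem deg_eq_deg_iff {j j' : ℤ} {v v' : Fin n → ℤ} :
    deg n j v = deg n j' v' ↔ ∃ q : ℤ, j' - j = q * (2 * (1 - n)) ∧ ∀ i, v' i - v i = q := by
  refine (QuotientAddGroup.eq (s := AddSubgroup.zmultiples (relator n 1))).trans ?_
  rw [AddSubgroup.mem_zmultiples_iff]
  refine exists_congr fun q => ?_
  rw [Prod.ext_iff, funext_iff]
  simp [relator, sub_eq_neg_add, eq_comm]

theorem degMon_eq (c : Fin n →₀ ℕ) :
    degMon n a c = deg n ((2 - 2 * a) * c.degree) (fun i => a * c i) := by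
  unfold degMon degR
  simp only [nsmul_deg, deg_sum]
  congr 1
  · rw [Finsupp.degree_eq_sum]
    push_cast
    rw [Finset.mul_sum]
    exact Finset.sum_congr rfl fun i _ => by rw [nsmul_eq_mul]; ring
  · ext i
    rw [Finset.sum_apply, Finset.sum_eq_single i] <;> simp +contextual [mul_comm]

theorem degExt_eq (I : Finset (Fin n)) :
    degExt I = deg n (-I.card) (fun i => if i ∈ I then 1 else 0) := by
  unfold degExt degTheta
  rw [deg_sum]
  congr 1
  · simp
  · ext i
    simp [Pi.single_apply]

/-- The number of letters of the word `l` that contain `i`. -/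
def letterCount (i : Fin n) (l : List (Finset (Fin n))) : ℕ := l.countP (fun x => i ∈ x)

theorem sdeg_eq (I : Finset (Fin n)) :
    sdeg I = deg n (-I.card - 1) (fun i => if i ∈ I then 1 else 0) := by
  rw [sdeg, degExt_eq, f_eq_deg, ← deg_sub, sub_zero]

theorem wdeg_eq (l : List (Finset (Fin n))) :
    wdeg l = deg n (-(∑ i, (letterCount i l : ℤ)) - l.length) (fun i => letterCount i l) := by
  induction l with
  | nil => simp [letterCount, ← deg_zero]; rfl
  | cons x l ih =>
    rw [wdeg_cons, ih, sdeg_eq, ← deg_add]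
    have h : ∀ i, (letterCount i (x :: l) : ℤ) = (if i ∈ x then 1 else 0) + letterCount i l := by
      intro i
      rw [letterCount, List.countP_cons, letterCount]
      simp [add_comm]
    congr 1
    · simp only [h, Finset.sum_add_distrib]
      simp
      ring
    · ext i
      rw [h]
      rfl

/-- The degree condition on a coefficient of a cochain of degree `e + 1`, in terms of integers. -/
theorem exists_of_degMon_eq {e : ℤ} {c : Fin n →₀ ℕ} {K : Finset (Fin n)}
    {l : List (Finset (Fin n))} (h : degMon n a c = wdeg l + (- sdeg K + (G n).f e)) :
    ∃ q : ℤ, (∀ i, (a : ℤ) * c i + (if i ∈ K then 1 else 0) + q = letterCount i l) ∧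
      (l.length : ℤ) - 1 - e = (a - 2) * c.degree + (n - 2) * q := by
  rw [show wdeg l + (- sdeg K + (G n).f e) = wdeg l - sdeg K + (G n).f e by abel, degMon_eq,
    wdeg_eq, sdeg_eq, f_eq_deg, ← deg_sub, ← deg_add, deg_eq_deg_iff] at h
  obtain ⟨q, h1, h2⟩ := h
  simp only [Pi.add_apply, Pi.sub_apply, Pi.zero_apply] at h2
  have h3 : ∀ i, (a : ℤ) * c i + (if i ∈ K then 1 else 0) + q = letterCount i l := fun i => by
    linarith [h2 i]
  refine ⟨q, h3, ?_⟩
  have h4 : ∑ i, (letterCount i l : ℤ) = a * c.degree + K.card + n * q := by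
    rw [← Finset.sum_congr rfl fun i _ => h3 i, Finset.sum_add_distrib, Finset.sum_add_distrib,
      ← Finset.mul_sum, Finsupp.degree_eq_sum]
    simp
  rw [h4] at h1
  linarith

theorem letterCount_le (i : Fin n) (l : List (Finset (Fin n))) : letterCount i l ≤ l.length :=
  List.countP_le_length

theorem σ_degMon (c : Fin n →₀ ℕ) : (G n).σ (degMon n a c) = 0 := by
  rw [degMon_eq]
  change (((2 - 2 * a) * c.degree : ℤ) : ZMod 2) = 0
  rw [show ((2 - 2 * a) * c.degree : ℤ) = 2 * ((1 - a) * c.degree) by ring, Int.cast_mul]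
  have : ((2 : ℤ) : ZMod 2) = 0 := by decide
  rw [this, zero_mul]

theorem σ_degExt (I : Finset (Fin n)) : (G n).σ (degExt I) = I.card := by
  rw [degExt_eq]
  change ((-I.card : ℤ) : ZMod 2) = _
  rw [Int.cast_neg, Int.cast_natCast, ZMod.neg_eq_self_mod_two]

theorem σ_sdeg (I : Finset (Fin n)) : (G n).σ (sdeg I) = (I.card + 1 : ℕ) := by
  rw [sdeg, map_sub, σ_degExt, (G n).σ_f, Int.cast_one, sub_eq_add_neg, ZMod.neg_eq_self_mod_two,
    Nat.cast_add, Nat.cast_one]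

theorem σ_wdeg (l : List (Finset (Fin n))) :
    (G n).σ (wdeg l) = ((l.map (fun x => x.card + 1)).sum : ℕ) := by
  induction l with
  | nil => simp
  | cons x l ih =>
    rw [wdeg_cons, map_add, σ_sdeg, ih, List.map_cons, List.sum_cons]
    push_cast
    ring

theorem prod_sgnShift (R : Type*) [CommRing R] (l : List (Finset (Fin n))) :
    (l.map (sgnShift R)).prod = (-1) ^ (l.map (fun x => x.card + 1)).sum := by
  induction l with
  | nil => simp
  | cons x l ih => simp [ih, pow_add, sgnShift]

theorem neg_one_pow_congr {R : Type*} [CommRing R] {j k : ℕ} (h : (j : ZMod 2) = k) :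
    (-1 : R) ^ j = (-1) ^ k := by
  rw [neg_one_pow_eq_pow_mod_two, (ZMod.natCast_eq_natCast_iff' j k 2).1 h,
    ← neg_one_pow_eq_pow_mod_two]

/-- Homogeneous cochains are compatible with parity. -/
theorem IsHomogFun.prod_sgnShift_mul {e : ℕ} {K : Finset (Fin n)}
    {Ψ : List (Finset (Fin n)) → coeffRing n} (h : IsHomogFun a (- sdeg K + (G n).f e) Ψ)
    (l : List (Finset (Fin n))) :
    (l.map (sgnShift (coeffRing n))).prod * Ψ l = (-1) ^ e * (sgnShift (coeffRing n) K * Ψ l) := by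
  by_cases h0 : Ψ l = 0
  · rw [h0, mul_zero, mul_zero, mul_zero]
  · obtain ⟨c, hc⟩ := MvPolynomial.ne_zero_iff.1 h0
    have h1 := congrArg (G n).σ (h l c hc)
    rw [σ_degMon, map_add, map_add, map_neg, σ_wdeg, σ_sdeg, (G n).σ_f, ZMod.neg_eq_self_mod_two,
      Int.cast_natCast, ← Nat.cast_add, ← Nat.cast_add] at h1
    rw [← mul_assoc]
    congr 1
    rw [prod_sgnShift, sgnShift, ← pow_add]
    apply neg_one_pow_congr
    rw [add_comm e]
    rw [Nat.cast_add] at h1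
    rw [eq_neg_of_add_eq_zero_left h1.symm, ZMod.neg_eq_self_mod_two]

end Degrees

/-! ### Consequences of the grading for single components -/

section DegreeBounds

open MvPolynomial

variable {n a : ℕ}

theorem exists_ne_of_four_le {n : ℕ} (hn : 4 ≤ n) (j : Fin n) : ∃ i, i ≠ j := by
  by_cases h : j = ⟨0, by omega⟩
  · exact ⟨⟨1, by omega⟩, by subst h; simp⟩
  · exact ⟨_, fun h' => h h'.symm⟩

/-- A bound for the order in `r` of the components of a cochain of degree one or two on words of
length `s`. -/
def orderBound (n a s : ℕ) : ℕ := n * (s + a * n * s + 2 * a)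

theorem orderBound_mono {s s' : ℕ} (h : s ≤ s') : orderBound n a s ≤ orderBound n a s' := by
  unfold orderBound
  gcongr

/-- Summing the degree conditions over the generators bounds `a |c|` by `n (s - q)`, where `q` is the
multiple of the relation of `Y` that occurs; combined with the condition on the integral part of the
degree this bounds `-q`, since `a < n`. -/
theorem degree_le_orderBound (ha : 2 ≤ a) (han : a + 1 ≤ n) {e : ℤ} (he1 : e ≤ 1)
    {c : Fin n →₀ ℕ} {K : Finset (Fin n)} {l : List (Finset (Fin n))}
    (h : degMon n a c = wdeg l + (- sdeg K + (G n).f e)) : c.degree ≤ orderBound n a l.length := by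
  obtain ⟨q, h1, h2⟩ := exists_of_degMon_eq h
  have h3 : (a : ℤ) * c.degree ≤ n * (l.length - q) := by
    have : ∀ i ∈ Finset.univ, (a : ℤ) * c i ≤ l.length - q := by
      intro i _
      have h4 := h1 i
      have h5 : (letterCount i l : ℤ) ≤ l.length := by exact_mod_cast letterCount_le i l
      split_ifs at h4 <;> linarith
    have h4 := Finset.sum_le_sum this
    rw [← Finset.mul_sum, Finset.sum_const, Finset.card_univ, Fintype.card_fin] at h4
    rw [Finsupp.degree_eq_sum]
    push_cast
    simpa using h4
  have ha' : (2 : ℤ) ≤ a := by exact_mod_cast ha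
  have han' : (a : ℤ) + 1 ≤ n := by exact_mod_cast han
  have hs : (0 : ℤ) ≤ l.length := by positivity
  have hc : (0 : ℤ) ≤ c.degree := by positivity
  have hq : -q ≤ a * n * l.length + 2 * a := by
    by_cases hq0 : 0 ≤ q
    · have : (0 : ℤ) ≤ a * n * l.length + 2 * a := by positivity
      linarith
    · have h5 : ((a : ℤ) - 2) * (a * c.degree) ≤ (a - 2) * (n * (l.length - q)) :=
        mul_le_mul_of_nonneg_left h3 (by linarith)
      have h6 : (a : ℤ) * (l.length - 1 - e) - a * (n - 2) * q ≤ (a - 2) * (n * (l.length - q)) := by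
        have : (a : ℤ) * ((l.length : ℤ) - 1 - e) = a * ((a - 2) * c.degree + (n - 2) * q) := by
          rw [h2]
        linarith
      have h7 : 2 * ((n : ℤ) - a) * (-q) ≤ (a - 2) * n * l.length + a * (1 + e - l.length) := by
        linarith
      have h8 : (-q) ≤ ((n : ℤ) - a) * (-q) := by nlinarith
      have h9 : (a : ℤ) * (1 + e - l.length) ≤ a * 2 :=
        mul_le_mul_of_nonneg_left (by linarith) (by linarith)
      have h10 : ((a : ℤ) - 2) * n * l.length ≤ a * n * l.length := by
        have : (0 : ℤ) ≤ n * l.length := by positivity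
        nlinarith
      linarith
  have h4 : (c.degree : ℤ) ≤ n * (l.length + a * n * l.length + 2 * a) := by
    have h5 : (n : ℤ) * (l.length - q) ≤ n * (l.length + a * n * l.length + 2 * a) :=
      mul_le_mul_of_nonneg_left (by linarith) (by linarith)
    nlinarith
  unfold orderBound
  exact_mod_cast h4

theorem eq_zero_or_exists_single {c : Fin n →₀ ℕ} (h : c.degree ≤ 1) :
    c = 0 ∨ ∃ j, c = Finsupp.single j 1 := by
  rcases Nat.le_one_iff_eq_zero_or_eq_one.1 h with h | h
  · exact Or.inl ((Finsupp.degree_eq_zero_iff c).1 h)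
  · right
    have hne : c ≠ 0 := by rintro rfl; simp at h
    obtain ⟨j, hj⟩ := Finsupp.ne_iff.1 hne
    have hj' : 1 ≤ c j := Nat.one_le_iff_ne_zero.2 hj
    refine ⟨j, ?_⟩
    have hle : Finsupp.single j 1 ≤ c := by simpa using hj'
    obtain ⟨d, hd⟩ := exists_add_of_le hle
    have : d.degree = 0 := by
      have := congrArg Finsupp.degree hd
      rw [map_add, Finsupp.degree_single] at this
      omega
    rw [hd, (Finsupp.degree_eq_zero_iff d).1 this, add_zero]

/-- Order-zero components of a cochain of degree one on nonempty words. -/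
theorem length_of_degree_eq_zero (hn : 4 ≤ n) {c : Fin n →₀ ℕ} (hc : c = 0)
    {K : Finset (Fin n)} {l : List (Finset (Fin n))} (hl : l ≠ [])
    (h : degMon n a c = wdeg l + (- sdeg K + (G n).f 0)) : l.length = 1 ∨ n ≤ l.length + 1 := by
  obtain ⟨q, h1, h2⟩ := exists_of_degMon_eq h
  subst hc
  simp only [map_zero, Nat.cast_zero, mul_zero, zero_add, sub_zero] at h2
  have hn' : (4 : ℤ) ≤ n := by exact_mod_cast hn
  have hs : 1 ≤ l.length := List.length_pos_iff.2 hl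
  rcases lt_trichotomy q 0 with hq | rfl | hq
  · exfalso
    nlinarith
  · left; omega
  · right
    have : ((n : ℤ) - 2) * 1 ≤ (n - 2) * q := mul_le_mul_of_nonneg_left (by omega) (by linarith)
    omega

/-- Order-one components of a cochain of degree one on nonempty words. -/
theorem length_of_degree_eq_one (hn : 4 ≤ n) (han : a + 1 ≤ n) {j : Fin n}
    {K : Finset (Fin n)} {l : List (Finset (Fin n))} (hl : l ≠ [])
    (h : degMon n a (Finsupp.single j 1) = wdeg l + (- sdeg K + (G n).f 0)) :
    a ≤ l.length + 1 := by
  obtain ⟨q, h1, h2⟩ := exists_of_degMon_eq h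
  rw [Finsupp.degree_single] at h2
  have hn' : (4 : ℤ) ≤ n := by exact_mod_cast hn
  have hs : 1 ≤ l.length := List.length_pos_iff.2 hl
  rcases lt_or_ge q 0 with hq | hq
  · exfalso
    obtain ⟨i, hi⟩ := exists_ne_of_four_le hn j
    have h3 := h1 i
    rw [Finsupp.single_eq_of_ne hi] at h3
    have h4 : q = -1 := by
      split_ifs at h3 <;> omega
    subst h4
    omega
  · have : (0 : ℤ) ≤ (n - 2) * q := mul_nonneg (by linarith) hq
    omega

/-- The length-one components of a cochain of degree two have order at least two. -/
theorem two_le_degree_of_length_eq_one (hn : 4 ≤ n) (ha : 2 ≤ a)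
    {c : Fin n →₀ ℕ} {K : Finset (Fin n)} {l : List (Finset (Fin n))} (hl : l.length = 1)
    (h : degMon n a c = wdeg l + (- sdeg K + (G n).f 1)) : 2 ≤ c.degree := by
  obtain ⟨q, h1, h2⟩ := exists_of_degMon_eq h
  by_contra hc
  have hn' : (4 : ℤ) ≤ n := by exact_mod_cast hn
  have ha' : (2 : ℤ) ≤ a := by exact_mod_cast ha
  rw [hl] at h2
  rcases eq_zero_or_exists_single (c := c) (by omega) with rfl | ⟨j, rfl⟩
  · simp only [map_zero, Nat.cast_zero, mul_zero, zero_add, Nat.cast_one] at h2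
    rcases lt_or_ge q 0 with hq | hq
    · nlinarith
    · nlinarith
  · rw [Finsupp.degree_single] at h2
    rcases lt_or_ge q 0 with hq | hq
    · obtain ⟨i, hi⟩ := exists_ne_of_four_le hn j
      have h3 := h1 i
      rw [Finsupp.single_eq_of_ne hi] at h3
      have h4 : q = -1 := by
        split_ifs at h3 <;> omega
      subst h4
      have h5 := h1 j
      have h6 := letterCount_le j l
      rw [Finsupp.single_eq_same] at h5
      split_ifs at h5 <;> omega
    · have : (0 : ℤ) ≤ (n - 2) * q := mul_nonneg (by linarith) hq
      omega

/-- The words in the generators and the components on which cochains of degree two and weight at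
least three can be nonzero correspond to the terms of the potential. -/
theorem classify_of_degMon_eq (hn : 4 ≤ n) (ha : 2 ≤ a) (han : a + 1 ≤ n)
    {c : Fin n →₀ ℕ} {K : Finset (Fin n)} {l : List (Finset (Fin n))} (hl : l ≠ [])
    (hcard : ∀ x ∈ l, x.card = 1) (hP : 3 ≤ 2 * c.degree + l.length)
    (h : degMon n a c = wdeg l + (- sdeg K + (G n).f 1)) :
    K = ∅ ∧ (c = 0 ∧ l.length = n ∨ c.degree = 1 ∧ l.length = a) := by
  obtain ⟨q, h1, h2⟩ := exists_of_degMon_eq h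
  have hn' : (4 : ℤ) ≤ n := by exact_mod_cast hn
  have ha' : (2 : ℤ) ≤ a := by exact_mod_cast ha
  have han' : (a : ℤ) + 1 ≤ n := by exact_mod_cast han
  have hs : 1 ≤ l.length := List.length_pos_iff.2 hl
  -- Each letter is a single generator, so the letter counts add up to the length.
  have hsum : ∑ i, (letterCount i l : ℤ) = l.length := by
    clear h h1 h2 hP hs hl
    induction l with
    | nil => simp [letterCount]
    | cons x l ih =>
      have h3 : ∀ i, (letterCount i (x :: l) : ℤ) = (if i ∈ x then 1 else 0) + letterCount i l := by
        intro i
        rw [letterCount, List.countP_cons, letterCount]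
        simp [add_comm]
      simp only [h3, Finset.sum_add_distrib, ih fun y hy => hcard y (List.mem_cons_of_mem _ hy)]
      simp [hcard x List.mem_cons_self, add_comm]
  have h4 : (l.length : ℤ) = a * c.degree + K.card + n * q := by
    rw [← hsum, ← Finset.sum_congr rfl fun i _ => h1 i, Finset.sum_add_distrib,
      Finset.sum_add_distrib, ← Finset.mul_sum, Finsupp.degree_eq_sum]
    simp
  have h5 : (K.card : ℤ) = 2 - 2 * c.degree - 2 * q := by linarith
  have hK : (K.card : ℤ) ≤ n := by exact_mod_cast card_finset_fin_le K
  -- A letter count is nonnegative. Where `r_i` does not occur, this bounds `q` from below, and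
  -- `q = -1` forces `θ_i` to occur in the component `K`.
  have hneg : ∀ i, c i = 0 → -1 ≤ q := by
    intro i hi
    have h6 := h1 i
    rw [hi] at h6
    split_ifs at h6 <;> omega
  have hmem : q = -1 → ∀ i, c i = 0 → i ∈ K := by
    intro hq i hi
    have h6 := h1 i
    rw [hi] at h6
    by_contra h7
    rw [if_neg h7] at h6
    omega
  rcases Nat.lt_or_ge c.degree 2 with hc | hc
  · rcases eq_zero_or_exists_single (c := c) (by omega) with rfl | ⟨j, rfl⟩
    · simp only [map_zero, Nat.cast_zero, mul_zero, zero_add, sub_zero] at h2 h4 h5 hP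
      have hq := hneg ⟨0, by omega⟩ rfl
      have hq1 : q ≤ 1 := by omega
      obtain rfl | rfl | rfl : q = -1 ∨ q = 0 ∨ q = 1 := by omega
      · have hKu : K = Finset.univ := Finset.eq_univ_iff_forall.2 fun i => hmem rfl i rfl
        rw [hKu, Finset.card_univ, Fintype.card_fin] at h4
        omega
      · omega
      · exact ⟨Finset.card_eq_zero.1 (by omega), Or.inl ⟨rfl, by omega⟩⟩
    · rw [Finsupp.degree_single] at h2 h4 h5 hP
      obtain ⟨i, hi⟩ := exists_ne_of_four_le hn j
      have hq := hneg i (Finsupp.single_eq_of_ne hi)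
      obtain rfl | rfl : q = -1 ∨ q = 0 := by omega
      · have hsub : Finset.univ.erase j ⊆ K := fun i hi =>
          hmem rfl i (Finsupp.single_eq_of_ne (Finset.ne_of_mem_erase hi))
        have := Finset.card_le_card hsub
        rw [Finset.card_erase_of_mem (Finset.mem_univ j), Finset.card_univ,
          Fintype.card_fin] at this
        omega
      · exact ⟨Finset.card_eq_zero.1 (by omega), Or.inr ⟨Finsupp.degree_single _ _, by omega⟩⟩
  · exfalso
    by_cases hex : ∃ i, c i = 0
    · obtain ⟨i, hi⟩ := hex
      have hq := hneg i hi
      have hq' : q = -1 := by omega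
      have := Finset.card_pos.2 ⟨i, hmem hq' i hi⟩
      omega
    -- If all `r_i` occur, then `|c| ≥ n`, and eliminating `q` makes the length nonpositive.
    · have hcn : (n : ℤ) ≤ c.degree := by
        rw [Finsupp.degree_eq_sum]
        have : ∑ i : Fin n, 1 ≤ ∑ i, c i :=
          Finset.sum_le_sum fun i _ => Nat.one_le_iff_ne_zero.2 fun h => hex ⟨i, h⟩
        simpa using (Nat.cast_le (α := ℤ)).2 this
      have hs' : (1 : ℤ) ≤ l.length := by exact_mod_cast hs
      have h6 : 2 * (l.length : ℤ) = 2 * n - 2 * (n - a) * c.degree - (n - 2) * K.card := by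
        rw [h4]
        have : q = 1 - c.degree - (1 - q - c.degree) := by ring
        have h7 : 2 * q = 2 - 2 * c.degree - K.card := by linarith
        linear_combination (n : ℤ) * h7
      have h8 : (c.degree : ℤ) ≤ (n - a) * c.degree := by nlinarith
      have h9 : (0 : ℤ) ≤ (n - 2) * K.card := mul_nonneg (by linarith) (by positivity)
      linarith

end DegreeBounds

/-! ### The defect of families close to the identity -/

section Approximation

open MvPolynomial

variable {n : ℕ} {X : Type*} [Fintype X]

theorem ordGE_dstar {t : X → coeffRing n} {η : List X → X → coeffRing n} {k N : ℕ}
    (hη : ∀ x K, OrdGE k (η [x] K)) (Ψ : List X → coeffRing n)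
    (hΨ : ∀ l, l.length < N → OrdGE k (Ψ l)) (w : List X) (hw : w.length = N) :
    OrdGE k (dstar t η Ψ w) := by
  induction w generalizing Ψ N with
  | nil => exact OrdGE.zero _
  | cons x l ih =>
    rw [dstar]
    refine OrdGE.add (OrdGE.splitSum fun u v huv => OrdGE.sum fun K _ => ?_) ?_
    · subst huv
      cases u with
      | nil => exact (hη x K).mul_le (OrdGE.of_zero _) (by omega)
      | cons y u =>
        exact (OrdGE.of_zero _).mul_le (hΨ (K :: v) (by simp at hw ⊢; omega)) (by omega)
    · exact (OrdGE.of_zero _).mul_le (ih (N := N - 1) _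
        (fun l' hl' => hΨ _ (by simp; omega)) (by simp at hw; omega)) (by omega)

variable [DecidableEq X] {F : List X → X → coeffRing n}

theorem ordGE_push_sub {k N : ℕ} (hF : ∀ l K, l.length < N → OrdGE k (F l K - idFam l K))
    (Ψ : List X → coeffRing n) (w : List X) (hw : w.length < N) :
    OrdGE k (push F Ψ w - Ψ w) := by
  induction w generalizing Ψ with
  | nil => rw [push_nil, sub_self]; exact OrdGE.zero _
  | cons x l ih =>
    rw [push_cons, push_cons_sub, add_sub_right_comm]
    refine (ih _ (by simp at hw; omega)).add (OrdGE.splitSum fun u v huv => OrdGE.sum fun K _ => ?_)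
    subst huv
    exact (hF (x :: u) K (by simp at hw ⊢; omega)).mul_le (OrdGE.of_zero _) (by omega)

/-- If `F` is the identity up to order `k / 2` on words shorter than `N` and `Ψ` has that order on
single letters, the values of `F` on words of length `N` do not matter up to that order. -/
theorem ordGE_push_sub_of_length_eq {k N : ℕ}
    (hF : ∀ l K, l.length < N → OrdGE k (F l K - idFam l K))
    (Ψ : List X → coeffRing n) (hΨ : ∀ K, OrdGE k (Ψ [K])) (w : List X) (hw : w.length = N) :
    OrdGE k (push F Ψ w - Ψ w) := by
  cases w with
  | nil => rw [push_nil, sub_self]; exact OrdGE.zero _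
  | cons x l =>
    rw [push_cons, push_cons_sub, add_sub_right_comm]
    refine (ordGE_push_sub hF _ l (by simp at hw; omega)).add
      (OrdGE.splitSum fun u v huv => OrdGE.sum fun K _ => ?_)
    subst huv
    cases v with
    | nil =>
      rw [push_nil]
      exact (OrdGE.of_zero _).mul_le (hΨ K) (by omega)
    | cons y v =>
      exact (hF (x :: u) K (by simp at hw ⊢; omega)).mul_le (OrdGE.of_zero _) (by omega)

theorem dstar_idFam (t : X → coeffRing n) (η : List X → X → coeffRing n)
    (hη : ∀ K, η [] K = 0) (K : X) (l : List X) :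
    dstar t η (fun w => idFam w K) l = η l K := by
  cases l with
  | nil => rw [hη]; rfl
  | cons x l =>
    have h1 : dstar t η (fun w => idFam (x :: w) K) l = 0 :=
      dstar_eq_zero_of_nil (fun w hw => by simp [idFam, hw]) l
    rw [dstar, h1, mul_zero, add_zero, splitSum_sum]
    have h2 : ∀ L, splitSum (fun a b => η (x :: a) L * idFam (L :: b) K) l =
        η (x :: l) L * idFam [L] K := fun L =>
      splitSum_right_nil (fun a => η (x :: a) L) (fun b => idFam (L :: b) K)
        (fun w hw => by simp [idFam, hw]) l
    simp only [h2]
    simp [idFam]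

theorem push_idFam (Ψ : List X → coeffRing n) (l : List X) : push idFam Ψ l = Ψ l := by
  induction l generalizing Ψ with
  | nil => rw [push_nil]
  | cons x l ih => rw [push_cons, splitSum_idFam, ih]

theorem defect_idFam (t : X → coeffRing n) (η μ : List X → X → coeffRing n)
    (hη : ∀ K, η [] K = 0) (K : X) (l : List X) :
    defect t η idFam μ K l = μ l K - η l K := by
  rw [defect, push_idFam, dstar_idFam t η hη]

/-- If `F` is the identity up to order `k / 2` on words shorter than `w`, and the differentials of `μ`
and `η` have that order, then the defect on `w` is `μ - η` up to that order. The values of `F` on words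
as long as `w` do not matter, as only the differentials are composed with them. -/
theorem ordGE_defect_sub {t : X → coeffRing n} {η μ : List X → X → coeffRing n} {k N : ℕ}
    (hη0 : ∀ K, η [] K = 0) (hη : ∀ x K, OrdGE k (η [x] K)) (hμ : ∀ x K, OrdGE k (μ [x] K))
    (hF : ∀ l K, l.length < N → OrdGE k (F l K - idFam l K)) (K : X) (w : List X)
    (hw : w.length = N) : OrdGE k (defect t η F μ K w - (μ w K - η w K)) := by
  have h1 := ordGE_push_sub_of_length_eq hF (fun w => μ w K) (fun x => hμ x K) w hw
  have h2 := ordGE_dstar (t := t) hη (fun w => F w K - idFam w K) (fun l hl => hF l K hl) w hw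
  rw [dstar_sub, dstar_idFam t η hη0] at h2
  exact (h1.sub h2).congr (by rw [defect]; ring)

end Approximation

/-! ### Dependence of the defect on short words -/

section Local

open MvPolynomial

variable {n : ℕ} {X : Type*} [Fintype X]

theorem push_congr {F F' : List X → X → coeffRing n} {N : ℕ}
    (h : ∀ l K, l.length ≤ N → F l K = F' l K) (Ψ : List X → coeffRing n) (w : List X)
    (hw : w.length ≤ N) : push F Ψ w = push F' Ψ w := by
  induction hk : w.length using Nat.strong_induction_on generalizing Ψ w with
  | _ k ih =>
    cases w with
    | nil => rw [push_nil, push_nil]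
    | cons x l =>
      rw [push_cons, push_cons]
      refine splitSum_congr fun a b hab => Finset.sum_congr rfl fun K _ => ?_
      subst hab hk
      simp only [List.length_cons, List.length_append] at hw
      rw [h _ _ (by simp; omega), ih b.length (by grind) _ b (by omega) rfl]

theorem dstar_congr {t : X → coeffRing n} {η : List X → X → coeffRing n} {N : ℕ}
    {Ψ Ψ' : List X → coeffRing n} (h : ∀ l, l.length ≤ N → Ψ l = Ψ' l) (w : List X)
    (hw : w.length ≤ N) : dstar t η Ψ w = dstar t η Ψ' w := by
  induction w generalizing Ψ Ψ' N with
  | nil => rfl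
  | cons x l ih =>
    rw [dstar, dstar, ih (N := N - 1) (fun l' hl' => h _ ?_) (by simp at hw; omega)]
    · congr 1
      refine splitSum_congr fun a b hab => Finset.sum_congr rfl fun K _ => ?_
      subst hab
      rw [h _ (by simp at hw ⊢; omega)]
    · simp at hw ⊢
      omega

/-- The defect on words of length at most `N` depends only on the family on such words. -/
theorem defect_congr {t : X → coeffRing n} {η μ F F' : List X → X → coeffRing n} {N : ℕ}
    (h : ∀ l K, l.length ≤ N → F l K = F' l K) (K : X) (w : List X)
    (hw : w.length ≤ N) : defect t η F μ K w = defect t η F' μ K w := by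
  rw [defect, defect, push_congr h _ w hw, dstar_congr (fun l hl => h l K hl) w hw]

end Local

/-! ### The degree of the bar differential -/

section BarDegree

variable {n : ℕ}

theorem barStar_ite_wdeg (ψ : List (Finset (Fin n)) → ℂ) (y : (G n).Y)
    (l : List (Finset (Fin n))) [DecidableEq (G n).Y] :
    barStar (fun w => if wdeg w = y then ψ w else 0) l =
      if wdeg l + (G n).f 1 = y then barStar ψ l else 0 := by
  induction l generalizing ψ y with
  | nil => simp [barStar]
  | cons x l ih =>
    have h1 : (fun w => if wdeg (x :: w) = y then ψ (x :: w) else 0) =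
        fun w => if wdeg w = y - sdeg x then ψ (x :: w) else 0 := by
      ext w
      simp only [wdeg_cons, eq_sub_iff_add_eq']
    have h2 : wdeg l + (G n).f 1 = y - sdeg x ↔ wdeg (x :: l) + (G n).f 1 = y := by
      rw [eq_sub_iff_add_eq', wdeg_cons, add_assoc]
    simp only [barStar, h1]
    rw [ih (fun w => ψ (x :: w)), if_congr h2 rfl rfl]
    have h3 : consMul (fun w => if wdeg w = y then ψ w else 0) x l =
        if wdeg (x :: l) + (G n).f 1 = y then consMul ψ x l else 0 := by
      cases l with
      | nil =>
        simp only [consMul]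
        by_cases hx : x = ∅
        · have e : wdeg [x] + (G n).f 1 = wdeg ([] : List (Finset (Fin n))) := by
            rw [hx, wdeg_cons, sdeg_empty, wdeg_nil]
            abel
          rw [e, if_pos hx, if_pos hx]
        · simp [hx]
      | cons z l =>
        simp only [consMul]
        have e : ∀ (p : Prop) [Decidable p] (f : Finset (Fin n) → ℂ),
            (if p then ∑ K, f K else 0) = ∑ K, if p then f K else 0 := by
          intro p _ f
          split_ifs <;> simp
        rw [e]
        refine Finset.sum_congr rfl fun K _ => ?_
        by_cases h0 : extMul x z K = 0
        · simp [h0]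
        · obtain ⟨hd, rfl⟩ := extMul_ne_zero h0
          have : wdeg (x :: z :: l) + (G n).f 1 = wdeg ((x ∪ z) :: l) := by
            simp only [wdeg_cons, sdeg_union hd]
            abel
          rw [this]
          split_ifs <;> simp
    rw [h3]
    split_ifs <;> simp

/-- The bar differential has degree one. -/
theorem barDiff_ite_wdeg (ψ : List (Finset (Fin n)) → ℂ) (y : (G n).Y)
    (l : List (Finset (Fin n))) [DecidableEq (G n).Y] :
    barDiff (fun w => if wdeg w = y then ψ w else 0) l =
      if wdeg l + (G n).f 1 = y then barDiff ψ l else 0 := by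
  have h : headAug (fun w => if wdeg w = y then ψ w else 0) l =
      if wdeg l + (G n).f 1 = y then headAug ψ l else 0 := by
    cases l with
    | nil => simp [headAug]
    | cons x l =>
      simp only [headAug]
      by_cases hx : x = ∅
      · subst hx
        rw [wdeg_cons, sdeg_empty]
        simp
      · simp [hx]
  rw [barDiff, barDiff, barStar_ite_wdeg, h]
  split_ifs <;> simp

end BarDegree

/-! ### Construction of the homomorphism -/

section Induction

open MvPolynomial

variable {n a : ℕ}

local notation "τ" => sgnShift (coeffRing n)

/-- A non-curved `A_∞` structure of degree two whose product is the exterior product at order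
zero, in terms of its matrix coefficients on words of basis elements. -/
structure IsWordStructure (a : ℕ) (μ : List (Finset (Fin n)) → Finset (Fin n) → coeffRing n) :
    Prop where
  nil : ∀ K, μ [] K = 0
  homog : IsHomogFam a 1 μ
  rel : ∀ K l, dstar τ μ (fun w => μ w K) l = 0
  prod : ∀ x y K, coeff 0 (μ [x, y] K) = extMul x y K

variable {μ η F : List (Finset (Fin n)) → Finset (Fin n) → coeffRing n}

theorem IsWordStructure.ordGE_singleton (h : IsWordStructure a μ) (hn : 4 ≤ n) (ha : 2 ≤ a)
    (x K : Finset (Fin n)) : OrdGE 4 (μ [x] K) := by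
  intro c hc
  have := two_le_degree_of_length_eq_one hn ha (by simp) (h.homog K [x] c hc)
  omega

theorem IsWordStructure.wtGE_sub (h : IsWordStructure a μ) (hn : 4 ≤ n) (ha : 2 ≤ a)
    (K : Finset (Fin n)) : WtGE 3 (fun l => μ l K - mStr l K) := by
  intro l
  change OrdGE _ (μ l K - mStr l K)
  match l with
  | [] => rw [h.nil, mStr_of_length_ne (by simp), sub_self]; exact OrdGE.zero _
  | [x] =>
    rw [mStr_of_length_ne (by simp), sub_zero]
    exact (h.ordGE_singleton hn ha x K).mono (by simp)
  | [x, y] =>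
    intro c hc
    by_cases h0 : c = 0
    · subst h0
      rw [coeff_sub, h.prod, mStr_pair, coeff_zero_C, sub_self] at hc
      exact absurd rfl hc
    · have : c.degree ≠ 0 := fun h1 => h0 ((Finsupp.degree_eq_zero_iff c).1 h1)
      simp
      omega
  | x :: y :: z :: l => exact (OrdGE.of_zero _).mono (by simp)

theorem IsWordStructure.wtGE (h : IsWordStructure a μ) (hn : 4 ≤ n) (ha : 2 ≤ a)
    (K : Finset (Fin n)) : WtGE 2 (fun l => μ l K) := fun l =>
  (((h.wtGE_sub hn ha K).mono (by omega : 2 ≤ 3)).add (wtGE_mStr K) l).congr (by ring)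

/-- The sum of the values of a cochain on all words in the generators of content `b`, which
computes the coefficient of `u^b` in its image under the Hochschild-Kostant-Rosenberg map. -/
noncomputable def symSum (s : ℕ) (b : Fin n →₀ ℕ)
    (μ : List (Finset (Fin n)) → Finset (Fin n) → coeffRing n) (K : Finset (Fin n)) : coeffRing n :=
  ∑ i : Fin s → Fin n with ∑ k, Finsupp.single (i k) 1 = b, μ (List.ofFn fun k => {i k}) K

/-- The monomial `r^c` in the component `K` of a word `l`, placed in the order in which the
induction proceeds: first by twice the order plus the length, then by `|K|`. -/
noncomputable def rank (c : Fin n →₀ ℕ) (l : List (Finset (Fin n))) (K : Finset (Fin n)) : ℕ :=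
  (n + 1) * (2 * c.degree + l.length) + K.card

/-- `F` is a homogeneous family close to the identity that intertwines `η` and `μ` up to terms of
rank at least `W`. The corrections that lead from the identity to `F` have rank less than
`W - (n + 1)`, since a correction has weight one lower than the part of the defect it removes. -/
structure IsStage (a : ℕ) (η μ : List (Finset (Fin n)) → Finset (Fin n) → coeffRing n) (W : ℕ)
    (F : List (Finset (Fin n)) → Finset (Fin n) → coeffRing n) : Prop where
  nil : ∀ K, F [] K = 0
  homog : IsHomogFam a 0 F
  near : ∀ l K c, coeff c (F l K - idFam l K) ≠ 0 →
    2 ≤ 2 * c.degree + l.length ∧ rank c l K + (n + 1) < W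
  defect : ∀ l K c, coeff c (defect τ η F μ K l) ≠ 0 → W ≤ rank c l K

theorem IsWordStructure.isStage_idFam (hn : 4 ≤ n) (ha : 2 ≤ a) (hμ : IsWordStructure a μ)
    (hη : IsWordStructure a η) : IsStage a η μ (3 * (n + 1)) idFam where
  nil K := by simp [idFam]
  homog := isHomogFam_idFam
  near l K c h := absurd (by rw [sub_self, coeff_zero]) h
  defect l K c h := by
    rw [defect_idFam _ _ _ hη.nil, show μ l K - η l K = (μ l K - mStr l K) - (η l K - mStr l K) by
      ring] at h
    have := (hμ.wtGE_sub hn ha K).sub (hη.wtGE_sub hn ha K) l c h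
    unfold rank
    have : 3 ≤ 2 * c.degree + l.length := by omega
    nlinarith

theorem IsWordStructure.defect_nil (hμ : IsWordStructure a μ) (K : Finset (Fin n)) :
    AInf.defect τ η F μ K [] = 0 := by
  rw [AInf.defect, push_nil, hμ.nil, dstar, sub_self]

/-- The symmetrization of the leading coefficients of the defect vanishes, since `μ` and `η`
have the same image under the Hochschild-Kostant-Rosenberg map up to order two. -/
theorem IsStage.symSum_eq_zero (hn : 4 ≤ n) (ha : 2 ≤ a) (han : a + 1 ≤ n)
    (hμ : IsWordStructure a μ) (hη : IsWordStructure a η)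
    (hkr : ∀ s, 1 ≤ s → ∀ b K c, c.degree ≤ 1 → coeff c (symSum s b μ K) = coeff c (symSum s b η K))
    {P : ℕ} (hP : 3 ≤ P) {K : Finset (Fin n)} (hF : IsStage a η μ ((n + 1) * P + K.card) F)
    {c : Fin n →₀ ℕ} {s : ℕ} (hs : 1 ≤ s) (hc : 2 * c.degree + s = P) (b : Fin n →₀ ℕ) :
    ∑ i : Fin s → Fin n with ∑ k, Finsupp.single (i k) 1 = b,
      coeff c (AInf.defect τ η F μ K (List.ofFn fun k => {i k})) = 0 := by
  by_cases h0 : ∃ i : Fin s → Fin n,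
      coeff c (AInf.defect τ η F μ K (List.ofFn fun k => {i k})) ≠ 0
  · obtain ⟨i, hi⟩ := h0
    have hdeg := IsHomogFam.defect hF.homog hμ.homog hη.homog K _ c hi
    obtain ⟨rfl, hcase⟩ := classify_of_degMon_eq hn ha han
      (by rw [← List.length_pos_iff, List.length_ofFn]; omega)
      (by
        intro x hx
        obtain ⟨j, rfl⟩ := List.mem_ofFn.1 hx
        exact Finset.card_singleton _)
      (by rw [List.length_ofFn]; omega) hdeg
    rw [List.length_ofFn] at hcase
    -- In both cases `F` is the identity on words shorter than `s`, up to terms of order larger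
    -- than that of `r^c`.
    have hnear : ∀ l K, l.length < s → OrdGE (2 * (c.degree + 1)) (F l K - idFam l K) := by
      intro l K hl d hd
      obtain ⟨h1, h2⟩ := hF.near l K d hd
      have h3 : 2 * d.degree + l.length + 1 < P := by
        unfold rank at h2
        rw [Finset.card_empty] at h2
        by_contra h3
        have : (n + 1) * P ≤ (n + 1) * (2 * d.degree + l.length + 1) :=
          Nat.mul_le_mul_left _ (by omega)
        rw [mul_add] at this
        omega
      have hl0 : l ≠ [] := by
        rintro rfl
        rw [hF.nil] at hd
        simp [idFam] at hd
      have hl1 := List.length_pos_iff.2 hl0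
      by_contra hlt
      have hdeg' : degMon n a d = wdeg l + (- sdeg K + (G n).f 0) :=
        (hF.homog K l).sub (isHomogFam_idFam K l) d hd
      rcases hcase with ⟨rfl, rfl⟩ | ⟨hc1, rfl⟩
      · simp only [map_zero] at hlt hc
        have hd0 : d = 0 := (Finsupp.degree_eq_zero_iff d).1 (by omega)
        rcases length_of_degree_eq_zero hn hd0 hl0 hdeg' with h4 | h4
        · subst hd0
          simp only [map_zero] at h1
          omega
        · omega
      · rcases eq_zero_or_exists_single (c := d) (by omega) with rfl | ⟨j, rfl⟩
        · rcases length_of_degree_eq_zero hn rfl hl0 hdeg' with h4 | h4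
          · simp only [map_zero] at h1
            omega
          · omega
        · have h4 := length_of_degree_eq_one hn han hl0 hdeg'
          rw [Finsupp.degree_single] at h3
          omega
    have hc1 : c.degree ≤ 1 := by
      rcases hcase with ⟨rfl, -⟩ | ⟨h, -⟩
      · simp
      · omega
    have hsing : ∀ {ν : List (Finset (Fin n)) → Finset (Fin n) → coeffRing n},
        IsWordStructure a ν → ∀ x K, OrdGE (2 * (c.degree + 1)) (ν [x] K) := fun hν x K =>
      (hν.ordGE_singleton hn ha x K).mono (by omega)
    have hE : ∀ i : Fin s → Fin n, coeff c (AInf.defect τ η F μ ∅ (List.ofFn fun k => {i k})) =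
        coeff c (μ (List.ofFn fun k => {i k}) ∅) - coeff c (η (List.ofFn fun k => {i k}) ∅) := by
      intro i
      have h1 := (ordGE_defect_sub (t := τ) hη.nil (hsing hη) (hsing hμ) hnear ∅
        (List.ofFn fun k => {i k}) List.length_ofFn).coeff_eq_zero (c := c) (by omega)
      rw [coeff_sub, coeff_sub] at h1
      exact sub_eq_zero.1 h1
    have h1 := hkr s hs b ∅ c hc1
    rw [symSum, symSum, coeff_sum, coeff_sum] at h1
    simp only [hE, Finset.sum_sub_distrib, h1, sub_self]
  · push Not at h0
    exact Finset.sum_eq_zero fun i _ => h0 i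

theorem exists_coeff_eq (P s : ℕ) (g : (Fin n →₀ ℕ) → ℂ) :
    ∃ p : coeffRing n, ∀ c, coeff c p = if 2 * c.degree + s + 1 = P then g c else 0 := by
  classical
  have hfin : {c : Fin n →₀ ℕ | 2 * c.degree + s + 1 = P}.Finite :=
    (Finsupp.finite_of_degree_le P).subset fun c hc => by
      simp only [Set.mem_ofPred_eq] at hc ⊢
      omega
  refine ⟨∑ c ∈ hfin.toFinset, monomial c (g c), fun c => ?_⟩
  simp only [coeff_sum, coeff_monomial, Finset.sum_ite_eq', Set.Finite.mem_toFinset,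
    Set.mem_ofPred_eq]

theorem IsStage.wtGE_defect {P D : ℕ} (hF : IsStage a η μ ((n + 1) * P + D) F)
    (K : Finset (Fin n)) : WtGE P (AInf.defect τ η F μ K) := by
  intro l c hc
  have h1 := hF.defect l K c hc
  unfold rank at h1
  have hK := card_finset_fin_le K
  by_contra h2
  have : (n + 1) * (2 * c.degree + l.length + 1) ≤ (n + 1) * P := Nat.mul_le_mul_left _ (by omega)
  rw [mul_add] at this
  omega

theorem IsStage.wtGE_defect_succ {P D : ℕ} (hF : IsStage a η μ ((n + 1) * P + D) F)
    {K : Finset (Fin n)} (hK : K.card < D) : WtGE (P + 1) (AInf.defect τ η F μ K) := by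
  intro l c hc
  have h1 := hF.defect l K c hc
  unfold rank at h1
  by_contra h2
  have : (n + 1) * (2 * c.degree + l.length) ≤ (n + 1) * P := Nat.mul_le_mul_left _ (by omega)
  omega

theorem IsStage.wtGE_sub {W : ℕ} (hF : IsStage a η μ W F) (K : Finset (Fin n)) :
    WtGE 2 (fun l => F l K - idFam l K) := by
  intro l c hc
  have := (hF.near l K c hc).1
  omega

/-- The leading coefficients of the defect are the coboundary of a homogeneous family. -/
theorem IsStage.exists_correction (hn : 4 ≤ n) (ha : 2 ≤ a) (han : a + 1 ≤ n)
    (hμ : IsWordStructure a μ) (hη : IsWordStructure a η)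
    (hkr : ∀ s, 1 ≤ s → ∀ b K c, c.degree ≤ 1 → coeff c (symSum s b μ K) = coeff c (symSum s b η K))
    {P D : ℕ} (hP : 3 ≤ P) (hD : D ≤ n) (hF : IsStage a η μ ((n + 1) * P + D) F) :
    ∃ Ψ : List (Finset (Fin n)) → Finset (Fin n) → coeffRing n, IsHomogFam a 0 Ψ ∧
      (∀ l K c, coeff c (Ψ l K) ≠ 0 → 2 * c.degree + l.length + 1 = P ∧ K.card = D ∧ l ≠ []) ∧
      ∀ K l c, K.card = D → l ≠ [] → 2 * c.degree + l.length = P →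
        coeff c (AInf.defect τ η F μ K l) = barDiff (fun w => coeff c (Ψ w K)) l := by
  classical
  -- A primitive for each monomial `r^c` and each component `K` separately.
  have key : ∀ (K : Finset (Fin n)) (c : Fin n →₀ ℕ), ∃ ψ : List (Finset (Fin n)) → ℂ,
      K.card = D → ∀ l, l ≠ [] → 2 * c.degree + l.length = P →
        coeff c (AInf.defect τ η F μ K l) = barDiff ψ l := by
    intro K c
    by_cases h : K.card = D ∧ 2 * c.degree + 1 ≤ P
    · obtain ⟨rfl, hc⟩ := h
      obtain ⟨ψ, hψ⟩ := exists_eq_barDiff (P - 2 * c.degree) (by omega)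
        (fun l => coeff c (AInf.defect τ η F μ K l))
        (fun l hl => barDiff_coeff_defect (v := P) (fun l K => by
            simpa using IsHomogFun.prod_sgnShift_mul (e := 1) (hη.homog K) l)
          hη.rel hμ.rel (hη.wtGE_sub hn ha) (hμ.wtGE_sub hn ha) (fun l K => by
            simpa using IsHomogFun.prod_sgnShift_mul (e := 0) (hF.homog K) l)
          hF.wtGE_sub hF.wtGE_defect (fun L hL => hF.wtGE_defect_succ hL) (fun l => by
            simpa using IsHomogFun.prod_sgnShift_mul (e := 1)
              (IsHomogFam.defect hF.homog hμ.homog hη.homog K) l) (by omega) (by omega))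
        (fun b => hF.symSum_eq_zero hn ha han hμ hη hkr hP (by omega) (by omega) b)
      exact ⟨ψ, fun _ l _ hl => hψ l (by omega)⟩
    · refine ⟨fun _ => 0, fun hK l hl hl' => ?_⟩
      have := List.length_pos_iff.2 hl
      exact absurd ⟨hK, by omega⟩ h
  choose ψ hψ using key
  -- Assemble the primitives, keeping only the words on which the degree is right. This does not
  -- affect the coboundary, as the bar differential is homogeneous.
  have key2 : ∀ l K, ∃ p : coeffRing n, ∀ c, coeff c p = if 2 * c.degree + l.length + 1 = P then
      if K.card = D ∧ l ≠ [] ∧ wdeg l = degMon n a c + sdeg K then ψ K c l else 0 else 0 :=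
    fun l K => exists_coeff_eq P l.length _
  choose Ψ hΨ using key2
  refine ⟨Ψ, fun K l c hc => ?_, fun l K c hc => ?_, fun K l c hK hl hc => ?_⟩
  · rw [hΨ] at hc
    split_ifs at hc with h1 h2
    · rw [h2.2.2, map_zero]
      abel
    · exact absurd rfl hc
    · exact absurd rfl hc
  · rw [hΨ] at hc
    split_ifs at hc with h1 h2
    · exact ⟨h1, h2.1, h2.2.1⟩
    · exact absurd rfl hc
    · exact absurd rfl hc
  · rw [hψ K c hK l hl hc]
    have h1 := hψ K c hK l hl hc
    by_cases hl1 : l.length = 1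
    · obtain ⟨x, rfl⟩ := List.length_eq_one_iff.1 hl1
      simp [barDiff, barStar, consMul, headAug]
    · have h2 : barDiff (fun w => coeff c (Ψ w K)) l =
          barDiff (fun w => if wdeg w = degMon n a c + sdeg K then ψ K c w else 0) l := by
        refine barDiff_congr fun w hw => ?_
        have hw0 : w ≠ [] := by
          rintro rfl
          exact hl1 hw.symm
        rw [hΨ, if_pos (by omega), if_congr (show _ ↔ wdeg w = degMon n a c + sdeg K from
          ⟨fun h => h.2.2, fun h => ⟨hK, hw0, h⟩⟩) rfl rfl]
      rw [h2, barDiff_ite_wdeg]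
      split_ifs with h3
      · rfl
      · rw [← h1]
        by_contra h4
        refine h3 ?_
        rw [IsHomogFam.defect hF.homog hμ.homog hη.homog K l c h4]
        abel

/-- One step of the induction: adding a primitive of the leading coefficients of the defect to `F`
removes the terms of rank `W` from the defect and creates none of lower rank. -/
theorem IsStage.exists_succ (hn : 4 ≤ n) (ha : 2 ≤ a) (han : a + 1 ≤ n)
    (hμ : IsWordStructure a μ) (hη : IsWordStructure a η)
    (hkr : ∀ s, 1 ≤ s → ∀ b K c, c.degree ≤ 1 → coeff c (symSum s b μ K) = coeff c (symSum s b η K))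
    {W : ℕ} (hW : 3 * (n + 1) ≤ W) (hF : IsStage a η μ W F) :
    ∃ F', IsStage a η μ (W + 1) F' ∧
      ∀ l K c, coeff c (F' l K - F l K) ≠ 0 → rank c l K + (n + 1) = W := by
  -- The terms of rank `W` are those of weight `P` with `|K| = D`.
  obtain ⟨P, D, hD, rfl⟩ : ∃ P D, D ≤ n ∧ W = (n + 1) * P + D :=
    ⟨W / (n + 1), W % (n + 1), Nat.lt_succ_iff.1 (Nat.mod_lt _ (by omega)),
      (Nat.div_add_mod _ _).symm⟩
  have hP : 3 ≤ P := by
    by_contra h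
    have : (n + 1) * P ≤ (n + 1) * 2 := Nat.mul_le_mul_left _ (by omega)
    omega
  obtain ⟨Ψ, hΨ1, hΨ2, hΨ3⟩ := hF.exists_correction hn ha han hμ hη hkr hP hD
  have hsub : ∀ l K, F l K + Ψ l K - F l K = Ψ l K := fun l K => by ring
  have hwt : ∀ K, WtGE (P - 1) (fun l => F l K + Ψ l K - F l K) := by
    intro K l c hc
    simp only [hsub] at hc
    have := (hΨ2 l K c hc).1
    omega
  have hhomog : IsHomogFam a 0 (fun l K => F l K + Ψ l K) := fun K l =>
    (hF.homog K l).add (hΨ1 K l)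
  have hrank : ∀ l K c, coeff c (Ψ l K) ≠ 0 → rank c l K + (n + 1) = (n + 1) * P + D := by
    intro l K c hc
    obtain ⟨h1, h2, -⟩ := hΨ2 l K c hc
    rw [rank, ← h1, h2]
    ring
  have hzero : ∀ l K, K.card ≠ D → Ψ l K = 0 := by
    intro l K hK
    ext c
    rw [coeff_zero]
    by_contra h
    exact hK (hΨ2 l K c h).2.1
  refine ⟨fun l K => F l K + Ψ l K, ⟨fun K => ?_, hhomog, fun l K c hc => ?_, fun l K c hc => ?_⟩,
    fun l K c hc => hrank l K c (by rwa [hsub] at hc)⟩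
  · rw [hF.nil, zero_add]
    ext c
    rw [coeff_zero]
    by_contra h
    exact (hΨ2 [] K c h).2.2 rfl
  · by_cases h : coeff c (Ψ l K) = 0
    · rw [add_sub_right_comm, coeff_add, h, add_zero] at hc
      have := hF.near l K c hc
      exact ⟨this.1, by omega⟩
    · have h1 := hrank l K c h
      have h2 := (hΨ2 l K c h).1
      exact ⟨by omega, by omega⟩
  · have hl : l ≠ [] := by
      rintro rfl
      rw [hμ.defect_nil, coeff_zero] at hc
      exact hc rfl
    have h1 := (wtGE_defect_sub_defect (by omega) (hη.wtGE hn ha) (hμ.wtGE hn ha) hwt K).add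
      (hF.wtGE_defect K) l
    simp only [sub_add_cancel] at h1
    have h2 := h1 c hc
    by_contra hlt
    unfold rank at hlt
    have h3 : 2 * c.degree + l.length = P := by
      by_contra h3
      have : (n + 1) * (P + 1) ≤ (n + 1) * (2 * c.degree + l.length) :=
        Nat.mul_le_mul_left _ (by omega)
      rw [mul_add] at this
      omega
    rw [h3] at hlt
    rw [coeff_defect_sub_defect (F := F) hP (hη.wtGE_sub hn ha) (hμ.wtGE_sub hn ha) hF.wtGE_sub hwt
      (fun L hL w => by rw [hsub, hzero w L (by omega)])
      (fun l => by
        simpa [hsub] using IsHomogFun.prod_sgnShift_mul (e := 0) (hΨ1 K) l) hl h3] at hc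
    simp only [hsub] at hc
    rcases Nat.lt_or_ge K.card D with hK | hK
    · have h4 : (fun w => coeff c (Ψ w K)) = fun _ => 0 :=
        funext fun w => by rw [hzero w K (by omega), coeff_zero]
      rw [h4, barDiff_eq_zero fun _ _ => rfl, sub_zero] at hc
      have h5 := hF.defect l K c hc
      rw [rank, h3] at h5
      omega
    · rw [hΨ3 K l c (by omega) hl h3, sub_self] at hc
      exact hc rfl

/-- A coherent sequence of better and better approximations to a homomorphism. -/
theorem exists_stages (hn : 4 ≤ n) (ha : 2 ≤ a) (han : a + 1 ≤ n)
    (hμ : IsWordStructure a μ) (hη : IsWordStructure a η)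
    (hkr : ∀ s, 1 ≤ s → ∀ b K c, c.degree ≤ 1 →
      coeff c (symSum s b μ K) = coeff c (symSum s b η K)) :
    ∃ S : ℕ → List (Finset (Fin n)) → Finset (Fin n) → coeffRing n,
      (∀ k, IsStage a η μ (3 * (n + 1) + k) (S k)) ∧
      ∀ k l K c, coeff c (S (k + 1) l K - S k l K) ≠ 0 →
        rank c l K + (n + 1) = 3 * (n + 1) + k := by
  have step : ∀ (k : ℕ) (F : {F // IsStage a η μ (3 * (n + 1) + k) F}),
      ∃ F' : {F // IsStage a η μ (3 * (n + 1) + (k + 1)) F},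
        ∀ l K c, coeff c (F'.1 l K - F.1 l K) ≠ 0 → rank c l K + (n + 1) = 3 * (n + 1) + k := by
    intro k F
    obtain ⟨F', h1, h2⟩ := F.2.exists_succ hn ha han hμ hη hkr (by omega)
    exact ⟨⟨F', h1⟩, h2⟩
  choose f hf using step
  let S : (k : ℕ) → {F // IsStage a η μ (3 * (n + 1) + k) F} := fun k =>
    Nat.rec ⟨idFam, hμ.isStage_idFam hn ha hη⟩ f k
  exact ⟨fun k => (S k).1, fun k => (S k).2, fun k => hf k (S k)⟩

/-- Two structures with the same image under the Hochschild-Kostant-Rosenberg map up to order two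
are related by a homogeneous family close to the identity. -/
theorem exists_defect_eq_zero (hn : 4 ≤ n) (ha : 2 ≤ a) (han : a + 1 ≤ n)
    (hμ : IsWordStructure a μ) (hη : IsWordStructure a η)
    (hkr : ∀ s, 1 ≤ s → ∀ b K c, c.degree ≤ 1 →
      coeff c (symSum s b μ K) = coeff c (symSum s b η K)) :
    ∃ F : List (Finset (Fin n)) → Finset (Fin n) → coeffRing n, (∀ K, F [] K = 0) ∧
      IsHomogFam a 0 F ∧ (∀ K, WtGE 2 (fun l => F l K - idFam l K)) ∧
      ∀ K l, defect τ η F μ K l = 0 := by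
  obtain ⟨S, hS, hsucc⟩ := exists_stages hn ha han hμ hη hkr
  -- All monomials in a homogeneous component on a word of length `s` have rank below `N s`.
  let N : ℕ → ℕ := fun s => (n + 1) * (2 * orderBound n a s + s + 1)
  have hN : ∀ {e : ℤ}, e ≤ 1 → ∀ {l : List (Finset (Fin n))} {K : Finset (Fin n)}
      {p : coeffRing n}, IsHomog a (wdeg l + (- sdeg K + (G n).f e)) p → ∀ c, coeff c p ≠ 0 →
      rank c l K < N l.length := by
    intro e he l K p hp c hc
    have h1 := degree_le_orderBound ha han he (hp c hc)
    have h2 := card_finset_fin_le K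
    have h3 : (n + 1) * (2 * c.degree + l.length) ≤ (n + 1) * (2 * orderBound n a l.length +
      l.length) := Nat.mul_le_mul_left _ (by omega)
    change rank c l K < (n + 1) * (2 * orderBound n a l.length + l.length + 1)
    rw [Nat.mul_succ, rank]
    omega
  have hmono : ∀ {s s' : ℕ}, s ≤ s' → N s ≤ N s' := by
    intro s s' h
    have := orderBound_mono (n := n) (a := a) h
    exact Nat.mul_le_mul_left _ (by omega)
  have hstable : ∀ l K k, N l.length ≤ k → S k l K = S (N l.length) l K := by
    intro l K k hk
    induction k, hk using Nat.le_induction with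
    | base => rfl
    | succ k hk ih =>
      rw [← ih, ← sub_eq_zero]
      ext c
      rw [coeff_zero]
      by_contra h
      have h1 := hsucc k l K c h
      have h2 := hN (e := 0) (by omega) (((hS (k + 1)).homog K l).sub ((hS k).homog K l)) c h
      omega
  refine ⟨fun l => S (N l.length) l, fun K => (hS _).nil K, fun K l => (hS _).homog K l,
    fun K l => (hS _).wtGE_sub K l, fun K l => ?_⟩
  have h1 : defect τ η (fun l => S (N l.length) l) μ K l = defect τ η (S (N l.length)) μ K l :=
    defect_congr (fun w K hw => (hstable w K _ (hmono hw)).symm) K l le_rfl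
  rw [h1]
  ext c
  rw [coeff_zero]
  by_contra h
  have h2 := (hS (N l.length)).defect l K c h
  have h3 := hN le_rfl (IsHomogFam.defect (hS _).homog hμ.homog hη.homog K l) c h
  omega

end Induction

/-! ### Multilinear maps in terms of words -/

section WordEval

variable {X R M : Type*} [Fintype X] [CommRing R] [AddCommGroup M] [Module R M]
  (e : Module.Basis X R M)

/-- The multilinear extension of a functional on words in the elements of a basis to lists of
elements of the module. -/
noncomputable def wordEval : (List X → R) → List M → R
  | Ψ, [] => Ψ []
  | Ψ, m :: ms => ∑ I, e.repr m I * wordEval (fun w => Ψ (I :: w)) ms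

theorem wordEval_mul_left (r : R) (Ψ : List X → R) (l : List M) :
    wordEval e (fun w => r * Ψ w) l = r * wordEval e Ψ l := by
  induction l generalizing Ψ with
  | nil => rfl
  | cons m l ih => simp only [wordEval, ih, Finset.mul_sum, mul_left_comm]

theorem wordEval_mul_right (r : R) (Ψ : List X → R) (l : List M) :
    wordEval e (fun w => Ψ w * r) l = wordEval e Ψ l * r := by
  simp only [mul_comm _ r, wordEval_mul_left]

theorem wordEval_add (Ψ Ψ' : List X → R) (l : List M) :
    wordEval e (fun w => Ψ w + Ψ' w) l = wordEval e Ψ l + wordEval e Ψ' l := by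
  induction l generalizing Ψ Ψ' with
  | nil => rfl
  | cons m l ih => simp only [wordEval, ih, mul_add, Finset.sum_add_distrib]

theorem wordEval_zero (l : List M) : wordEval e (fun _ => 0) l = 0 := by
  simpa using wordEval_mul_left e 0 (fun _ => 0) l

theorem wordEval_sum {ι : Type*} (s : Finset ι) (Ψ : ι → List X → R) (l : List M) :
    wordEval e (fun w => ∑ i ∈ s, Ψ i w) l = ∑ i ∈ s, wordEval e (Ψ i) l := by
  classical
  induction s using Finset.induction_on with
  | empty => simp [wordEval_zero]
  | insert i s hi ih => simp [Finset.sum_insert hi, wordEval_add, ih]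

theorem wordEval_append (Ψ : List X → R) (l l' : List M) :
    wordEval e Ψ (l ++ l') = wordEval e (fun w => wordEval e (fun w' => Ψ (w ++ w')) l') l := by
  induction l generalizing Ψ with
  | nil => rfl
  | cons m l ih => simp only [List.cons_append, wordEval, ih]

theorem wordEval_splitSum (f : List X → List X → R) (l : List M) :
    wordEval e (fun w => splitSum f w) l =
      splitSum (fun u v => wordEval e (fun w => wordEval e (f w) v) u) l := by
  induction l generalizing f with
  | nil => simp [wordEval, splitSum_nil]
  | cons m l ih =>
    rw [splitSum_cons]
    simp only [wordEval, splitSum_cons, wordEval_add, ih, mul_add, Finset.sum_add_distrib,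
      splitSum_sum, mul_splitSum]

theorem wordEval_map (Ψ : List X → R) (l : List X) : wordEval e Ψ (l.map e) = Ψ l := by
  classical
  induction l generalizing Ψ with
  | nil => rfl
  | cons x l ih =>
    simp only [List.map_cons, wordEval, ih, Module.Basis.repr_self, Finsupp.single_apply, ite_mul,
      one_mul, zero_mul]
    rw [Finset.sum_ite_eq Finset.univ x, if_pos (Finset.mem_univ x)]

variable {N : Type*} [AddCommGroup N] [Module R N]

/-- The value of a family of multilinear maps on the entries of a list. -/
def listApply (φ : (s : ℕ) → MultilinearMap R (fun _ : Fin s => M) N) (l : List M) : N :=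
  φ l.length fun k => l[k]

theorem apply_eq_listApply (φ : (s : ℕ) → MultilinearMap R (fun _ : Fin s => M) N) {s : ℕ}
    (v : Fin s → M) (l : List M) (hl : l.length = s) (hv : ∀ (k : ℕ) (hk : k < s),
      v ⟨k, hk⟩ = l[k]) : φ s v = listApply φ l := by
  subst hl
  exact congrArg _ (funext fun k => hv k k.2)

/-- Insertion of an element into the first slot of a family of multilinear maps. -/
def curryFamily (φ : (s : ℕ) → MultilinearMap R (fun _ : Fin s => M) N) (m : M) (s : ℕ) :
    MultilinearMap R (fun _ : Fin s => M) N := (φ (s + 1)).curryLeft m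

theorem listApply_cons (φ : (s : ℕ) → MultilinearMap R (fun _ : Fin s => M) N) (m : M)
    (l : List M) : listApply φ (m :: l) = listApply (curryFamily φ m) l := by
  rw [listApply, listApply, curryFamily, MultilinearMap.curryLeft_apply]
  refine congrArg _ (funext fun k => ?_)
  refine Fin.cases ?_ (fun k => ?_) k <;> simp

theorem curryFamily_apply_eq_sum (φ : (s : ℕ) → MultilinearMap R (fun _ : Fin s => M) N) (m : M)
    {s : ℕ} (v : Fin s → M) :
    curryFamily φ m s v = ∑ I, e.repr m I • curryFamily φ (e I) s v := by
  unfold curryFamily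
  conv_lhs => rw [← e.sum_repr m, map_sum]
  simp

theorem listApply_eq_wordEval (φ : (s : ℕ) → MultilinearMap R (fun _ : Fin s => M) R)
    (l : List M) : listApply φ l = wordEval e (fun w => listApply φ (w.map e)) l := by
  induction l generalizing φ with
  | nil => rfl
  | cons m l ih =>
    rw [listApply_cons, listApply, curryFamily_apply_eq_sum e, wordEval]
    refine Finset.sum_congr rfl fun I _ => ?_
    rw [smul_eq_mul, ← listApply, ih]
    simp only [List.map_cons, listApply_cons]

end WordEval

/-! ### Composites over all cuts into blocks -/

section Compositions

variable {X R M : Type*} [CommRing R] [AddCommGroup M] [Module R M]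

/-- Compositions sorted by their first block. -/
theorem sum_composition_succ {N : Type*} [AddCommMonoid N] (s : ℕ) (g : List ℕ → N) :
    ∑ c : Composition (s + 1), g c.blocks =
      ∑ j ∈ Finset.range (s + 1), ∑ c : Composition (s - j), g ((j + 1) :: c.blocks) := by
  rw [Finset.sum_range, ← Fintype.sum_sigma']
  symm
  refine Fintype.sum_bijective (fun p : Σ j : Fin (s + 1), Composition (s - j) =>
    (⟨(p.1 + 1) :: p.2.blocks, ?_, ?_⟩ : Composition (s + 1))) ⟨?_, ?_⟩ _ _ fun p => rfl
  · intro i hi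
    rcases List.mem_cons.1 hi with rfl | hi
    · omega
    · exact p.2.blocks_pos hi
  · have := p.1.2
    rw [List.sum_cons, p.2.blocks_sum]
    omega
  · rintro ⟨j, c⟩ ⟨j', c'⟩ h
    have h1 := congrArg Composition.blocks h
    simp only [List.cons.injEq, add_left_inj] at h1
    obtain ⟨h1, h2⟩ := h1
    obtain rfl := Fin.ext h1
    obtain rfl := Composition.ext h2
    rfl
  · intro c
    obtain ⟨b, bs, hb⟩ := List.exists_cons_of_ne_nil (l := c.blocks) (by
      intro h
      have := c.blocks_sum
      rw [h] at this
      simp at this)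
    have h1 : 0 < b := c.blocks_pos (by rw [hb]; exact List.mem_cons_self)
    have h2 := c.blocks_sum
    rw [hb, List.sum_cons] at h2
    refine ⟨⟨⟨b - 1, by omega⟩, ⟨bs, fun hi => c.blocks_pos (by
      rw [hb]; exact List.mem_cons_of_mem _ hi), by simp only; omega⟩⟩, ?_⟩
    apply Composition.ext
    simp only
    rw [hb, Nat.sub_add_cancel h1]


variable {N : Type*} [AddCommGroup N] [Module R N]

/-- The composite of a family of multilinear maps with a cochain, along the cut of the inputs into
consecutive blocks of prescribed lengths. -/
def blocksApply (F : (s : ℕ) → MultilinearMap R (fun _ : Fin s => M) M) :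
    ((s : ℕ) → MultilinearMap R (fun _ : Fin s => M) N) → List ℕ → (ℕ → M) → N
  | Φ, [], _ => Φ 0 ![]
  | Φ, b :: bs, a => blocksApply F (curryFamily Φ (F b fun l => a l)) bs fun k => a (b + k)

theorem blocksApply_eq (F : (s : ℕ) → MultilinearMap R (fun _ : Fin s => M) M)
    (Φ : (s : ℕ) → MultilinearMap R (fun _ : Fin s => M) N) (bs : List ℕ) (a : ℕ → M) :
    blocksApply F Φ bs a =
      Φ bs.length (fun k => F (bs.get k) fun l => a ((bs.take k).sum + l)) := by
  induction bs generalizing Φ a with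
  | nil => exact congrArg (Φ 0) (Subsingleton.elim _ _)
  | cons b bs ih =>
    rw [blocksApply, ih, curryFamily, MultilinearMap.curryLeft_apply]
    refine congrArg _ (funext fun k => ?_)
    refine Fin.cases ?_ (fun k => ?_) k
    · simp
      rfl
    · simp [add_assoc]

/-- The sum of the composites over all ways of cutting the inputs into nonempty blocks. -/
def compSum (F : (s : ℕ) → MultilinearMap R (fun _ : Fin s => M) M)
    (Φ : (s : ℕ) → MultilinearMap R (fun _ : Fin s => M) N) (s : ℕ) (a : ℕ → M) : N :=
  ∑ c : Composition s, blocksApply F Φ c.blocks a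

theorem compSum_succ (F : (s : ℕ) → MultilinearMap R (fun _ : Fin s => M) M)
    (Φ : (s : ℕ) → MultilinearMap R (fun _ : Fin s => M) N) (s : ℕ) (a : ℕ → M) :
    compSum F Φ (s + 1) a = ∑ j ∈ Finset.range (s + 1),
      compSum F (curryFamily Φ (F (j + 1) fun l => a l)) (s - j) fun k => a (j + 1 + k) := by
  rw [compSum, sum_composition_succ s (fun bs => blocksApply F Φ bs a)]
  rfl

variable [Fintype X] (e : Module.Basis X R M)

theorem compSum_curryFamily (F : (s : ℕ) → MultilinearMap R (fun _ : Fin s => M) M)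
    (Φ : (s : ℕ) → MultilinearMap R (fun _ : Fin s => M) N) (m : M) (s : ℕ) (a : ℕ → M) :
    compSum F (curryFamily Φ m) s a =
      ∑ I, e.repr m I • compSum F (curryFamily Φ (e I)) s a := by
  simp only [compSum, blocksApply_eq, Finset.smul_sum]
  rw [Finset.sum_comm]
  exact Finset.sum_congr rfl fun c _ => curryFamily_apply_eq_sum e Φ m _

/-- The matrix coefficients of a cochain on words of basis elements. -/
noncomputable def coeffs (φ : (s : ℕ) → MultilinearMap R (fun _ : Fin s => M) M) (l : List X)
    (K : X) : R := e.repr (listApply φ (l.map e)) K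

theorem repr_listApply (φ : (s : ℕ) → MultilinearMap R (fun _ : Fin s => M) M) (l : List M)
    (K : X) : e.repr (listApply φ l) K = wordEval e (fun w => coeffs e φ w K) l :=
  listApply_eq_wordEval e (fun s => (e.coord K).compMultilinearMap (φ s)) l

/-- The recursion for `push`, for arbitrary elements in place of basis elements. -/
theorem wordEval_push_cons (F : List X → X → R) (Ψ : List X → R) (m : M) (l : List M) :
    wordEval e (push F Ψ) (m :: l) = splitSum (fun u v => ∑ K,
      wordEval e (fun w => F w K) (m :: u) * wordEval e (push F fun w => Ψ (K :: w)) v) l := by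
  simp only [wordEval, push_cons, wordEval_splitSum, wordEval_sum, wordEval_mul_left,
    wordEval_mul_right, splitSum_sum, mul_splitSum, Finset.mul_sum, Finset.sum_mul, mul_assoc]
  rw [Finset.sum_comm]

theorem take_range_map {N : Type*} (a : ℕ → N) {s i : ℕ} (h : i ≤ s) :
    ((List.range s).map a).take i = (List.range i).map a := by
  refine List.ext_getElem (by simp [h]) fun k h1 h2 => by simp

theorem drop_range_map {N : Type*} (a : ℕ → N) (s i : ℕ) :
    ((List.range s).map a).drop i = (List.range (s - i)).map fun k => a (i + k) := by
  refine List.ext_getElem (by simp) fun k h1 h2 => by simp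

theorem splitSum_range_map {N N' : Type*} [AddCommMonoid N'] (f : List N → List N → N')
    (a : ℕ → N) (s : ℕ) : splitSum f ((List.range s).map a) = ∑ i ∈ Finset.range (s + 1),
      f ((List.range i).map a) ((List.range (s - i)).map fun k => a (i + k)) := by
  rw [splitSum, List.length_map, List.length_range]
  refine Finset.sum_congr rfl fun i hi => ?_
  rw [take_range_map a (Nat.lt_succ_iff.1 (Finset.mem_range.1 hi)), drop_range_map]

theorem range_succ_map {N : Type*} (a : ℕ → N) (s : ℕ) :
    (List.range (s + 1)).map a = a 0 :: (List.range s).map fun k => a (k + 1) := by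
  rw [List.range_succ_eq_map, List.map_cons, List.map_map]
  rfl

theorem apply_eq_listApply_range {N : Type*} [AddCommGroup N] [Module R N]
    (φ : (s : ℕ) → MultilinearMap R (fun _ : Fin s => M) N) (s : ℕ) (a : ℕ → M) :
    φ s (fun k => a k) = listApply φ ((List.range s).map a) :=
  apply_eq_listApply φ _ _ (by simp) fun k hk => by simp

/-- The sum over all cuts into nonempty blocks is given by the map `push` of bar constructions. -/
theorem compSum_eq_wordEval (F : (s : ℕ) → MultilinearMap R (fun _ : Fin s => M) M)
    (Φ : (s : ℕ) → MultilinearMap R (fun _ : Fin s => M) R) (s : ℕ) (a : ℕ → M) :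
    compSum F Φ s a = wordEval e (push (coeffs e F) fun w => listApply Φ (w.map e))
      ((List.range s).map a) := by
  induction s using Nat.strong_induction_on generalizing Φ a with
  | _ s ih =>
    cases s with
    | zero =>
      have h : ∀ c : Composition 0, c.blocks = [] := fun c =>
        List.eq_nil_of_length_eq_zero (Nat.le_zero.1 c.length_le)
      simp only [compSum, h, blocksApply, Finset.sum_const, Finset.card_univ, List.range_zero,
        List.map_nil, wordEval, push_nil, listApply]
      rw [composition_card, pow_zero, one_smul]
      exact congrArg (Φ 0) (Subsingleton.elim _ _)
    | succ s =>
      rw [compSum_succ, range_succ_map, wordEval_push_cons, splitSum_range_map]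
      refine Finset.sum_congr rfl fun j hj => ?_
      rw [compSum_curryFamily e]
      refine Finset.sum_congr rfl fun K _ => ?_
      rw [ih (s - j) (by omega), smul_eq_mul, apply_eq_listApply_range, repr_listApply,
        range_succ_map]
      simp only [List.map_cons, listApply_cons]
      congr 3
      funext k
      congr 1
      omega

end Compositions

/-! ### The Gerstenhaber product in terms of words -/

section GerstenhaberProduct

/-- The Gerstenhaber product as a sum over all subwords. -/
theorem dstar_eq_splitSum {X R : Type*} [CommRing R] [Fintype X] (t : X → R) (η : List X → X → R)
    (hη : ∀ K, η [] K = 0) (Ψ : List X → R) (l : List X) :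
    dstar t η Ψ l = splitSum (fun u w => (u.map t).prod *
      splitSum (fun b v => ∑ K, η b K * Ψ (u ++ K :: v)) w) l := by
  induction l generalizing Ψ with
  | nil => simp [dstar, splitSum_nil, hη]
  | cons x l ih =>
    rw [dstar, splitSum_cons, ih]
    congr 1
    · rw [splitSum_cons]
      simp [hη]
    · rw [mul_splitSum]
      simp [mul_assoc]

theorem range_append_cons_getElem {N : Type*} (a : ℕ → N) (i j k : ℕ) (x : N) (m : ℕ)
    (hm : m < i + k + 1) :
    ((List.range i).map a ++ x :: (List.range k).map fun l => a (i + (j + l)))[m]'(by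
      simp; omega) = if m < i then a m else if m = i then x else a (m + j - 1) := by
  rw [List.getElem_append]
  split_ifs with h1 h2 h3 h4 h5
  · simp
  · simp at h1; omega
  · simp at h1; omega
  · simp at h1; omega
  · simp [h5]
  · simp at h1
    rw [List.getElem_cons]
    have : m - i ≠ 0 := by omega
    simp [this]
    congr 1
    omega

variable {X R M : Type} [CommRing R] [AddCommGroup M] [Module R M]

/-- The Gerstenhaber product as a double sum over the cuts of the list of inputs. -/
theorem gerstenhaber_eq_splitSum (D : GradingDatum) (φ ψ : Cochain R M) (s : ℕ) (y : ℕ → D.Y)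
    (a : ℕ → M) :
    gerstenhaber D φ ψ s y a = splitSum (fun u w => sgn (u.map fun z => D.σ z.1 + 1).sum •
      splitSum (fun b v => listApply φ (u.map Prod.snd ++ listApply ψ (b.map Prod.snd) ::
        v.map Prod.snd)) w) ((List.range s).map fun k => (y k, a k)) := by
  unfold gerstenhaber
  rw [Finset.Nat.sum_antidiagonal_eq_sum_range_succ_mk, splitSum_range_map]
  refine Finset.sum_congr rfl fun i _ => ?_
  rw [Finset.Nat.sum_antidiagonal_eq_sum_range_succ_mk, splitSum_range_map, Finset.smul_sum]
  refine Finset.sum_congr rfl fun j _ => ?_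
  have h1 : ∑ k ∈ Finset.range i, (D.σ (y k) + 1) =
      (((List.range i).map fun k => (y k, a k)).map fun z => D.σ z.1 + 1).sum := by
    rw [List.map_map]
    rfl
  rw [h1]
  congr 1
  refine apply_eq_listApply φ _ _ (by simp; omega) fun m hm => ?_
  simp only [List.map_map, Function.comp_def]
  rw [range_append_cons_getElem (fun k => a k) i j (s - i - j) _ m hm, replaceBlock,
    apply_eq_listApply_range ψ j (fun l => a (i + l))]

variable [Fintype X] (e : Module.Basis X R M)

theorem wordEval_listApply_append_cons (φ ψ : Cochain R M) (u b v : List M) (K : X) :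
    e.repr (listApply φ (u ++ listApply ψ b :: v)) K =
      wordEval e (fun u' => wordEval e (fun b' => wordEval e (fun v' =>
        ∑ L, coeffs e ψ b' L * coeffs e φ (u' ++ L :: v') K) v) b) u := by
  rw [repr_listApply, wordEval_append]
  congr 1
  funext u'
  simp only [wordEval, repr_listApply, wordEval_sum, wordEval_mul_left, wordEval_mul_right]

/-- The coordinates of a Gerstenhaber product, if the letters act on homogeneous elements by the
sign of the shifted degree. -/
theorem repr_gerstenhaber (D : GradingDatum) (φ ψ : Cochain R M) (hψ : ψ 0 = 0) (t : X → R)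
    (s : ℕ) (y : ℕ → D.Y) (a : ℕ → M)
    (ht : ∀ k I, t I * e.repr (a k) I = (sgn (D.σ (y k) + 1) : R) * e.repr (a k) I) (K : X) :
    e.repr (gerstenhaber D φ ψ s y a) K =
      wordEval e (dstar t (coeffs e ψ) fun w => coeffs e φ w K) ((List.range s).map a) := by
  have hψ0 : ∀ K, coeffs e ψ [] K = 0 := by
    intro K
    change e.repr (ψ 0 _) K = 0
    rw [hψ]
    simp
  have h1 : dstar t (coeffs e ψ) (fun w => coeffs e φ w K) = _ :=
    funext fun l => dstar_eq_splitSum t (coeffs e ψ) hψ0 _ l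
  have hsgn : ∀ z z' : ZMod 2, sgn (z + z') = sgn z * sgn z' := by decide
  have hu : ∀ (u : List (D.Y × M)) (Ψ : List X → R), (∀ z ∈ u, ∀ I, t I * e.repr z.2 I =
      (sgn (D.σ z.1 + 1) : R) * e.repr z.2 I) →
      wordEval e (fun w => (w.map t).prod * Ψ w) (u.map Prod.snd) =
        (sgn (u.map fun z => D.σ z.1 + 1).sum : R) * wordEval e Ψ (u.map Prod.snd) := by
    intro u Ψ hu
    induction u generalizing Ψ with
    | nil => simp [wordEval, sgn]
    | cons z u ih =>
      simp only [List.map_cons, wordEval, List.prod_cons, List.sum_cons, hsgn (D.σ z.1 + 1),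
        Int.cast_mul,
        Finset.mul_sum]
      refine Finset.sum_congr rfl fun I _ => ?_
      simp only [mul_assoc, wordEval_mul_left]
      rw [ih _ fun z hz => hu z (List.mem_cons_of_mem _ hz)]
      linear_combination (sgn (u.map fun z => D.σ z.1 + 1).sum : R) *
        wordEval e (fun w => Ψ (I :: w)) (u.map Prod.snd) * hu z List.mem_cons_self I
  have h2 : (List.range s).map a = ((List.range s).map fun k => (y k, a k)).map Prod.snd := by
    rw [List.map_map]
    rfl
  have h3 : ∀ z ∈ (List.range s).map fun k => (y k, a k), ∀ I, t I * e.repr z.2 I =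
      (sgn (D.σ z.1 + 1) : R) * e.repr z.2 I := by
    intro z hz
    obtain ⟨k, -, rfl⟩ := List.mem_map.1 hz
    exact ht k
  rw [gerstenhaber_eq_splitSum, h1, h2]
  generalize (List.range s).map (fun k => (y k, a k)) = z at h3 ⊢
  rw [wordEval_splitSum]
  have hmap : ∀ {A B N : Type} [AddCommMonoid N] (f : List B → List B → N) (p : A → B)
      (l : List A), splitSum f (l.map p) = splitSum (fun u v => f (u.map p) (v.map p)) l := by
    intro A B N _ f p l
    simp [splitSum, List.map_take, List.map_drop]
  have hrepr : ∀ {A : Type} (f : List A → List A → M) (l : List A),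
      e.repr (splitSum f l) K = splitSum (fun u v => e.repr (f u v) K) l := by
    intro A f l
    simp [splitSum, Finsupp.finsetSum_apply]
  rw [hmap, hrepr]
  refine splitSum_congr fun u w huw => ?_
  simp only [wordEval_mul_left]
  rw [hu u _ fun z hz => h3 z (by rw [← huw]; exact List.mem_append_left _ hz), map_zsmul,
    Finsupp.smul_apply, zsmul_eq_mul, hrepr]
  congr 1
  simp only [wordEval_splitSum]
  have hsum : ∀ (f : List X → List (D.Y × M) → List (D.Y × M) → R),
      wordEval e (fun u' => splitSum (fun b v => f u' b v) w) (u.map Prod.snd) =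
        splitSum (fun b v => wordEval e (fun u' => f u' b v) (u.map Prod.snd)) w := by
    intro f
    exact wordEval_sum e _ _ _
  simp only [hmap]
  rw [hsum]
  refine splitSum_congr fun b v _ => ?_
  rw [wordEval_listApply_append_cons]

/-- The coordinates of the left-hand side of the equation of an `A_∞` homomorphism. -/
theorem repr_pushforward (F μ : Cochain R M) (s : ℕ) (a : ℕ → M) (K : X) :
    e.repr (∑ c : Composition s, μ c.length (fun k =>
        F (c.blocksFun k) (fun l => a (c.sizeUpTo k + l)))) K =
      wordEval e (push (coeffs e F) fun w => coeffs e μ w K) ((List.range s).map a) := by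
  have h1 := compSum_eq_wordEval e F (fun s => (e.coord K).compMultilinearMap (μ s)) s a
  refine Eq.trans ?_ h1
  rw [map_sum, Finsupp.finsetSum_apply, compSum]
  refine Finset.sum_congr rfl fun c _ => ?_
  rw [blocksApply_eq]
  rfl

/-- Identities between matrix coefficients imply that a cochain is an `A_∞` homomorphism. -/
theorem isPushforward_of_defect_eq_zero (D : GradingDatum) (gr : D.Y → AddSubgroup M)
    {F η μ : Cochain R M} (hη : η 0 = 0) (t : X → R)
    (ht : ∀ y x, x ∈ gr y → ∀ I, t I * e.repr x I = (sgn (D.σ y + 1) : R) * e.repr x I)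
    (h : ∀ K l, defect t (coeffs e η) (coeffs e F) (coeffs e μ) K l = 0) :
    IsPushforward D gr F η μ := by
  intro s y v hv
  refine e.repr.injective (Finsupp.ext fun K => ?_)
  rw [repr_gerstenhaber e D F η hη t s y v (fun k I => ht _ _ (hv k) I) K, repr_pushforward]
  congr 1
  exact funext fun l => sub_eq_zero.1 (h K l)

end GerstenhaberProduct

/-! ### Degree and order in coordinates -/

section Grading

open MvPolynomial

variable {n a : ℕ}

/-- The `R`-basis of `A ⊗ R` by the ordered monomials `θ_I`. -/
noncomputable def extBasisR (n : ℕ) :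
    Module.Basis (Finset (Fin n)) (coeffRing n) (extAlgR n) :=
  Algebra.TensorProduct.basis (coeffRing n) (extBasis n)

theorem extBasisR_apply (I : Finset (Fin n)) : extBasisR n I = 1 ⊗ₜ extBasis n I :=
  Algebra.TensorProduct.basis_apply _ I

theorem extBasisR_repr_tmul (p : coeffRing n) (x : extAlg n) (I : Finset (Fin n)) :
    (extBasisR n).repr (p ⊗ₜ x) I = p * C ((extBasis n).repr x I) := by
  rw [extBasisR, Algebra.TensorProduct.basis_repr_tmul]
  rfl

theorem degExt_of_repr_prod_ne_zero (l : List (Fin n)) {I : Finset (Fin n)}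
    (h : (extBasis n).repr (l.map (θ n)).prod I ≠ 0) : degExt I = (l.map (degTheta n)).sum := by
  induction l generalizing I with
  | nil =>
    rw [List.map_nil, List.prod_nil, ← extBasis_empty, Module.Basis.repr_self,
      Finsupp.single_apply] at h
    have : ∅ = I := by
      by_contra h'
      exact h (if_neg h')
    simp [← this, degExt]
  | cons j l ih =>
    rw [List.map_cons, List.prod_cons, ← extBasis_singleton, repr_mul_right] at h
    obtain ⟨J, -, hJ⟩ := Finset.exists_ne_zero_of_sum_ne_zero h
    obtain ⟨h1, rfl⟩ := repr_mul_ne_zero (right_ne_zero_of_mul hJ)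
    rw [List.map_cons, List.sum_cons, ← ih (left_ne_zero_of_mul hJ), degExt,
      Finset.sum_union h1, Finset.sum_singleton, degExt]

/-- Homogeneity in terms of coordinates. -/
theorem mem_grading_iff {y : (G n).Y} {x : extAlgR n} :
    x ∈ grading n a y ↔ ∀ I, IsHomog a (y - degExt I) ((extBasisR n).repr x I) := by
  constructor
  · intro hx
    change x ∈ Submodule.span ℂ _ at hx
    induction hx using Submodule.span_induction with
    | mem x hx =>
      obtain ⟨c, l, hy, rfl⟩ := hx
      intro I d hd
      rw [extBasisR_repr_tmul, mul_comm, coeff_C_mul, coeff_monomial] at hd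
      have h1 : c = d := by
        by_contra h
        exact right_ne_zero_of_mul hd (if_neg h)
      rw [← hy, degExt_of_repr_prod_ne_zero l (left_ne_zero_of_mul hd), add_sub_cancel_right, h1]
      rfl
    | zero =>
      intro I
      rw [map_zero]
      exact IsHomog.zero _
    | add x x' _ _ hx hx' =>
      intro I
      rw [map_add]
      exact (hx I).add (hx' I)
    | smul z x _ hx =>
      intro I
      have h1 : z • x = (C z : coeffRing n) • x := by
        rw [← algebraMap_eq, algebraMap_smul]
      rw [h1, map_smul]
      exact (IsHomog.C z).mul (hx I) (zero_add _)
  · intro hx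
    rw [← (extBasisR n).sum_repr x]
    refine AddSubgroup.sum_mem _ fun I _ => ?_
    rw [← ((extBasisR n).repr x I).support_sum_monomial_coeff, Finset.sum_smul]
    refine AddSubgroup.sum_mem _ fun c hc => ?_
    have h1 := hx I c (mem_support_iff.1 hc)
    change _ ∈ Submodule.span ℂ _
    have h2 : monomial c (coeff c ((extBasisR n).repr x I)) • extBasisR n I =
        coeff c ((extBasisR n).repr x I) • (monomial c (1 : ℂ) ⊗ₜ
          ((I.sort (· ≤ ·)).map (θ n)).prod : extAlgR n) := by
      rw [extBasisR_apply, extBasis_apply, TensorProduct.smul_tmul', TensorProduct.smul_tmul',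
        smul_monomial, smul_eq_mul, smul_eq_mul, mul_one, mul_one]
    rw [h2]
    refine Submodule.smul_mem _ _ (Submodule.subset_span ⟨c, I.sort (· ≤ ·), ?_, rfl⟩)
    change degMon n a c + _ = y
    have h3 : ((I.sort (· ≤ ·)).map (degTheta n)).sum = degExt I := by
      rw [degExt, Finset.sum, ← Multiset.sum_coe, ← Multiset.map_coe, Finset.sort_eq]
    rw [h1, h3, sub_add_cancel]

theorem extBasisR_mem_grading (I : Finset (Fin n)) : extBasisR n I ∈ grading n a (degExt I) := by
  rw [mem_grading_iff]
  intro J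
  rw [Module.Basis.repr_self, Finsupp.single_apply]
  split_ifs with h
  · rw [h, sub_self]
    exact IsHomog.C 1
  · exact IsHomog.zero _

/-- Order in terms of coordinates. -/
theorem le_degree_of_mem_bigO {k : ℕ} {x : extAlgR n} (hx : x ∈ bigO n k) (I : Finset (Fin n))
    {c : Fin n →₀ ℕ} (hc : coeff c ((extBasisR n).repr x I) ≠ 0) : k ≤ c.degree := by
  have h : ∀ I, (extBasisR n).repr x I ∈ idealOfVars (Fin n) ℂ ^ k := by
    refine Submodule.smul_induction_on hx (fun p hp m _ I => ?_) fun x x' hx hx' I => ?_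
    · rw [map_smul]
      exact Ideal.mul_mem_right _ _ hp
    · rw [map_add]
      exact Ideal.add_mem _ (hx I) (hx' I)
  exact (mem_pow_idealOfVars_iff k _).1 (h I) c (mem_support_iff.2 hc)

theorem sgn_cast {R : Type*} [CommRing R] (k : ℕ) : (sgn (k : ZMod 2) : R) = (-1) ^ k := by
  have h : ∀ z : ZMod 2, z = 0 ∨ z = 1 := by decide
  rcases h k with h | h
  · rw [h, neg_one_pow_congr (k := 0) (by rw [h, Nat.cast_zero])]
    simp [sgn]
  · rw [h, neg_one_pow_congr (k := 1) (by rw [h, Nat.cast_one])]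
    simp [sgn]

/-- The sign of the shifted degree of a homogeneous element is that of every basis element that
occurs in it. -/
theorem sgnShift_mul_repr {y : (G n).Y} {x : extAlgR n} (hx : x ∈ grading n a y)
    (I : Finset (Fin n)) : sgnShift (coeffRing n) I * (extBasisR n).repr x I =
      (sgn ((G n).σ y + 1) : coeffRing n) * (extBasisR n).repr x I := by
  by_cases h0 : (extBasisR n).repr x I = 0
  · rw [h0, mul_zero, mul_zero]
  · obtain ⟨c, hc⟩ := MvPolynomial.ne_zero_iff.1 h0
    have h1 := congrArg (G n).σ (mem_grading_iff.1 hx I c hc)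
    rw [σ_degMon, map_sub, σ_degExt] at h1
    rw [sub_eq_zero.1 h1.symm, ← Nat.cast_one, ← Nat.cast_add, sgn_cast, sgnShift]

end Grading

/-! ### Matrix coefficients of algebras of the given type -/

section WordsOfCochains

open MvPolynomial

variable {n a : ℕ}

theorem wdeg_eq_sum (l : List (Finset (Fin n))) :
    wdeg l = (l.map degExt).sum - (G n).f l.length := by
  induction l with
  | nil => simp
  | cons x l ih =>
    rw [wdeg_cons, ih, List.map_cons, List.sum_cons, List.length_cons, Nat.cast_succ, map_add, sdeg]
    abel

/-- A cochain of degree `d` has a homogeneous family of matrix coefficients, the shift by one coming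
from the shifted degrees of letters. -/
theorem isHomogFam_coeffs {d : ℤ} {φ : Cochain (coeffRing n) (extAlgR n)}
    (hφ : HasDegree (G n) (grading n a) d φ) : IsHomogFam a (d - 1) (coeffs (extBasisR n) φ) := by
  intro K l
  have h := hφ l.length (fun k => degExt l[k]) (fun k => extBasisR n l[k])
    fun k => extBasisR_mem_grading _
  have h1 : φ l.length (fun k => extBasisR n l[k]) = listApply φ (l.map (extBasisR n)) :=
    apply_eq_listApply φ _ _ (by simp) fun k hk => by simp
  rw [h1, mem_grading_iff] at h
  have h2 := h K
  have h3 : ∑ k : Fin l.length, degExt l[k] = (l.map degExt).sum := by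
    rw [← List.sum_ofFn]
    congr 1
    refine List.ext_getElem (by simp) fun k h1 h2 => by simp
  have h4 : wdeg l + (-sdeg K + (G n).f (d - 1)) =
      ∑ k : Fin l.length, degExt l[k] + (G n).f (d - l.length) - degExt K := by
    rw [h3, wdeg_eq_sum, sdeg, map_sub, map_sub]
    abel
  rw [h4]
  exact h2

/-- The matrix coefficients of an `A_∞` algebra of the given type. -/
theorem IsTypeA.isWordStructure {μ : Cochain (coeffRing n) (extAlgR n)} (hμ : IsTypeA n a μ) :
    IsWordStructure a (coeffs (extBasisR n) μ) where
  nil K := by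
    change (extBasisR n).repr (μ 0 _) K = 0
    rw [hμ.ainf.noncurved]
    simp
  homog := isHomogFam_coeffs hμ.ainf.degree
  rel K l := by
    let y : ℕ → (G n).Y := fun k => degExt (l.getD k ∅)
    let v : ℕ → extAlgR n := fun k => extBasisR n (l.getD k ∅)
    have hv : ∀ k, v k ∈ grading n a (y k) := fun k => extBasisR_mem_grading _
    have h := hμ.ainf.relation l.length y v hv
    have h1 := repr_gerstenhaber (extBasisR n) (G n) μ μ hμ.ainf.noncurved
      (sgnShift (coeffRing n)) l.length y v (fun k I => sgnShift_mul_repr (hv k) I) K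
    have h2 : (List.range l.length).map v = l.map (extBasisR n) := by
      refine List.ext_getElem (by simp) fun k h1 h2 => ?_
      simp at h1
      simp [v, h1]
    rw [h, h2, wordEval_map] at h1
    simpa using h1.symm
  prod x y K := by
    have h := hμ.product (degExt x) (extBasisR n x) (extBasisR n y) (extBasisR_mem_grading x)
    have h1 : coeff 0 ((extBasisR n).repr (sgn ((G n).σ (degExt x)) •
        μ 2 ![extBasisR n x, extBasisR n y] - extBasisR n y * extBasisR n x) K) = 0 := by
      by_contra h0
      have := le_degree_of_mem_bigO h K h0
      simp at this
    have h2 : μ 2 ![extBasisR n x, extBasisR n y] = listApply μ [extBasisR n x, extBasisR n y] :=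
      apply_eq_listApply μ _ _ rfl fun k hk => by
        interval_cases k <;> rfl
    rw [h2, map_sub, map_zsmul, Finsupp.sub_apply, Finsupp.smul_apply, zsmul_eq_mul, σ_degExt,
      sgn_cast, extBasisR_apply, extBasisR_apply, Algebra.TensorProduct.tmul_mul_tmul, mul_one,
      extBasisR_repr_tmul, one_mul, coeff_sub, coeff_zero_C] at h1
    have h3 : ((-1 : coeffRing n)) ^ x.card = C ((-1) ^ x.card) := by simp
    rw [h3, coeff_C_mul, ← extBasisR_apply, ← extBasisR_apply] at h1
    change coeff 0 ((extBasisR n).repr (listApply μ [extBasisR n x, extBasisR n y]) K) = _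
    rw [extMul]
    linear_combination (-1) ^ x.card * h1 - coeff 0 ((extBasisR n).repr (listApply μ
      [extBasisR n x, extBasisR n y]) K) * neg_one_pow_mul_self (R := ℂ) x.card

/-- Algebras of the same type have the same image under the Hochschild-Kostant-Rosenberg map up to
order two. -/
theorem IsTypeA.coeff_symSum_eq {μ η : Cochain (coeffRing n) (extAlgR n)} (hμ : IsTypeA n a μ)
    (hη : IsTypeA n a η) (s : ℕ) (b : Fin n →₀ ℕ) (K : Finset (Fin n)) (c : Fin n →₀ ℕ)
    (hc : c.degree ≤ 1) : coeff c (symSum s b (coeffs (extBasisR n) μ) K) =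
      coeff c (symSum s b (coeffs (extBasisR n) η) K) := by
  by_cases hs : s = b.degree
  · subst hs
    have h1 : ∀ φ : Cochain (coeffRing n) (extAlgR n), (extBasisR n).repr
        (MvPowerSeries.coeff b (hkr n φ)) K = symSum b.degree b (coeffs (extBasisR n) φ) K := by
      intro φ
      change (extBasisR n).repr (hkr n φ b) K = _
      rw [hkr, symSum, map_sum, Finsupp.finsetSum_apply]
      refine Finset.sum_congr rfl fun i _ => ?_
      rw [coeffs, apply_eq_listApply φ (fun k => 1 ⊗ₜ θ n (i k))
        ((List.ofFn fun k => {i k}).map (extBasisR n)) (by simp) fun k hk => ?_]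
      simp [extBasisR_apply, extBasis_singleton]
    have h2 := Submodule.sub_mem _ (hμ.hkr_eq b) (hη.hkr_eq b)
    rw [map_sub, map_sub, sub_sub_sub_cancel_right] at h2
    rw [← sub_eq_zero, ← coeff_sub, ← h1, ← h1, ← Finsupp.sub_apply, ← map_sub]
    by_contra h0
    have := le_degree_of_mem_bigO h2 K h0
    omega
  · have h1 : (Finset.univ.filter fun i : Fin s → Fin n =>
        ∑ k, Finsupp.single (i k) 1 = b) = ∅ := by
      refine Finset.filter_eq_empty_iff.2 fun i _ h => hs ?_
      rw [← h, map_sum]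
      simp
    rw [symSum, symSum, h1, Finset.sum_empty, Finset.sum_empty]

end WordsOfCochains

/-! ### Cochains with given matrix coefficients -/

section CochainsOfWords

variable {X R M : Type} [Fintype X] [CommRing R] [AddCommGroup M] [Module R M]
  (e : Module.Basis X R M)

/-- The cochain with given matrix coefficients on words of basis elements. -/
noncomputable def wordCochain (F : List X → X → R) : Cochain R M := fun s => ∑ w : Fin s → X,
  ((MultilinearMap.mkPiAlgebra R (Fin s) R).compLinearMap fun k => e.coord (w k)).smulRight
    (∑ K, F (List.ofFn w) K • e K)

theorem repr_wordCochain (F : List X → X → R) (s : ℕ) (v : Fin s → M) (K : X) :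
    e.repr (wordCochain e F s v) K =
      ∑ w : Fin s → X, (∏ k, e.repr (v k) (w k)) * F (List.ofFn w) K := by
  classical
  rw [wordCochain, sum_apply, map_sum, Finsupp.finsetSum_apply]
  refine Finset.sum_congr rfl fun w _ => ?_
  simp [Finsupp.single_apply]

theorem coeffs_wordCochain (F : List X → X → R) : coeffs e (wordCochain e F) = F := by
  classical
  funext l K
  have h1 : wordCochain e F l.length (fun k => e l[k]) =
      listApply (wordCochain e F) (l.map e) :=
    apply_eq_listApply _ _ _ (by simp) fun k hk => by simp
  rw [coeffs, ← h1, repr_wordCochain, Finset.sum_eq_single fun k => l[k]]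
  · simp
  · intro w _ hw
    obtain ⟨k, hk⟩ := Function.ne_iff.1 hw
    rw [Finset.prod_eq_zero (Finset.mem_univ k), zero_mul]
    rw [Module.Basis.repr_self, Finsupp.single_apply, if_neg (Ne.symm hk)]
  · simp

end CochainsOfWords

/-! ### Formal diffeomorphisms with given matrix coefficients -/

section FormalDiffeomorphism

open MvPolynomial

variable {n a : ℕ} {F : List (Finset (Fin n)) → Finset (Fin n) → coeffRing n}

theorem IsHomog.prod {ι : Type*} (s : Finset ι) (y : ι → (G n).Y) (p : ι → coeffRing n)
    (h : ∀ i ∈ s, IsHomog a (y i) (p i)) : IsHomog a (∑ i ∈ s, y i) (∏ i ∈ s, p i) := by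
  classical
  induction s using Finset.induction_on with
  | empty => exact IsHomog.C 1
  | insert i s hi ih =>
    rw [Finset.sum_insert hi, Finset.prod_insert hi]
    exact (h i (Finset.mem_insert_self i s)).mul
      (ih fun j hj => h j (Finset.mem_insert_of_mem hj)) rfl

theorem IsHomogFam.hasDegree_wordCochain (hF : IsHomogFam a 0 F) :
    HasDegree (G n) (grading n a) 1 (wordCochain (extBasisR n) F) := by
  intro s y v hv
  rw [mem_grading_iff]
  intro K
  rw [repr_wordCochain]
  refine IsHomog.sum fun w _ => ?_
  refine (IsHomog.prod Finset.univ _ _ fun k _ => mem_grading_iff.1 (hv k) (w k)).mul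
    (hF K (List.ofFn w)) ?_
  rw [wdeg_eq_sum, List.length_ofFn, List.map_ofFn, List.sum_ofFn, sdeg, Finset.sum_sub_distrib,
    map_sub, map_zero]
  simp only [Function.comp_apply]
  abel

theorem bijective_of_pow_sub_one_eq_zero {R M : Type*} [CommRing R] [AddCommGroup M] [Module R M]
    {T : Module.End R M} {m : ℕ} (h : (T - 1) ^ m = 0) : Function.Bijective T := by
  have h1 := IsNilpotent.isUnit_one_add (r := T - 1) ⟨m, h⟩
  rw [add_sub_cancel] at h1
  exact (Module.End.isUnit_iff T).1 h1

/-- Homogeneous endomorphisms of positive order are nilpotent. -/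
theorem exists_pow_eq_zero_of_isHomog (ha : 2 ≤ a) (han : a + 1 ≤ n)
    (N : Module.End (coeffRing n) (extAlgR n))
    (h1 : ∀ I K, IsHomog a (wdeg [I] + (- sdeg K + (G n).f 0))
      ((extBasisR n).repr (N (extBasisR n I)) K))
    (h2 : ∀ I K, OrdGE 2 ((extBasisR n).repr (N (extBasisR n I)) K)) : ∃ m, N ^ m = 0 := by
  have key : ∀ m I K, IsHomog a (wdeg [I] + (- sdeg K + (G n).f 0))
      ((extBasisR n).repr ((N ^ m) (extBasisR n I)) K) ∧
      OrdGE (2 * m) ((extBasisR n).repr ((N ^ m) (extBasisR n I)) K) := by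
    intro m
    induction m with
    | zero =>
      intro I K
      refine ⟨?_, OrdGE.of_zero _⟩
      rw [pow_zero, Module.End.one_apply, Module.Basis.repr_self, Finsupp.single_apply]
      split_ifs with h
      · rw [h, wdeg_cons, wdeg_nil, map_zero,
          show sdeg K + 0 + (-sdeg K + 0) = (0 : (G n).Y) by abel]
        exact IsHomog.C 1
      · exact IsHomog.zero _
    | succ m ih =>
      intro I K
      have h : (extBasisR n).repr ((N ^ (m + 1)) (extBasisR n I)) K =
          ∑ L, (extBasisR n).repr (N (extBasisR n I)) L *
            (extBasisR n).repr ((N ^ m) (extBasisR n L)) K := by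
        rw [pow_succ, Module.End.mul_apply]
        conv_lhs => rw [← (extBasisR n).sum_repr (N (extBasisR n I))]
        rw [map_sum, map_sum, Finsupp.finsetSum_apply]
        refine Finset.sum_congr rfl fun L _ => ?_
        rw [map_smul, map_smul, Finsupp.smul_apply, smul_eq_mul]
      rw [h]
      refine ⟨IsHomog.sum fun L _ => (h1 I L).mul (ih L K).1 ?_,
        OrdGE.sum fun L _ => (h2 I L).mul_le (ih L K).2 (by omega)⟩
      simp only [wdeg_cons, wdeg_nil, map_zero]
      abel
  -- The order of the `m`-th power is at least `m`, and bounded independently of `m` by homogeneity.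
  refine ⟨orderBound n a 1 + 1, (extBasisR n).ext fun I => (extBasisR n).repr.injective ?_⟩
  ext K c
  rw [LinearMap.zero_apply, map_zero, Finsupp.zero_apply, coeff_zero]
  by_contra h
  have h3 := degree_le_orderBound ha han (by omega) ((key _ I K).1 c h)
  have h4 := (key _ I K).2 c h
  rw [List.length_singleton] at h3
  omega

/-- The cochain described by a homogeneous family close to the identity is a formal
diffeomorphism. -/
theorem isFormalDiffeo_wordCochain (ha : 2 ≤ a) (han : a + 1 ≤ n) (hF0 : ∀ K, F [] K = 0)
    (hF : IsHomogFam a 0 F) (hF2 : ∀ K, WtGE 2 (fun l => F l K - idFam l K)) :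
    IsFormalDiffeo (G n) (grading n a) (maxIdeal n) (wordCochain (extBasisR n) F) := by
  let T : Module.End (coeffRing n) (extAlgR n) :=
    (extBasisR n).constr (coeffRing n) fun I => ∑ K, F [I] K • extBasisR n K
  have hT : ∀ x, wordCochain (extBasisR n) F 1 (fun _ => x) = T x := by
    intro x
    refine (extBasisR n).repr.injective (Finsupp.ext fun K => ?_)
    rw [apply_eq_listApply (s := 1) (wordCochain (extBasisR n) F) (fun _ => x) [x] rfl
      (fun k hk => by simp), repr_listApply, coeffs_wordCochain, Module.Basis.constr_apply_fintype]
    simp [wordEval, Finsupp.finsetSum_apply, Finsupp.single_apply]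
  have hN : ∀ I K, (extBasisR n).repr ((T - 1) (extBasisR n I)) K = F [I] K - idFam [I] K := by
    intro I K
    rw [LinearMap.sub_apply, Module.Basis.constr_basis, Module.End.one_apply, map_sub,
      Module.Basis.repr_self, Finsupp.sub_apply]
    simp [Finsupp.finsetSum_apply, Finsupp.single_apply, idFam]
  have hN2 : ∀ I K, OrdGE 2 ((extBasisR n).repr ((T - 1) (extBasisR n I)) K) := by
    intro I K c hc
    rw [hN] at hc
    have := hF2 K [I] c hc
    rw [List.length_singleton] at this
    omega
  refine ⟨hF.hasDegree_wordCochain, ?_, fun x => ?_, ?_⟩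
  · ext v
    refine (extBasisR n).repr.injective (Finsupp.ext fun K => ?_)
    rw [repr_wordCochain]
    simp [hF0]
  · rw [hT, show T x - x = (T - 1) x from rfl, ← (extBasisR n).sum_repr x, map_sum]
    refine Submodule.sum_mem _ fun I _ => ?_
    rw [map_smul, ← (extBasisR n).sum_repr ((T - 1) (extBasisR n I))]
    refine Submodule.smul_mem _ _ (Submodule.sum_mem _ fun K _ =>
      Submodule.smul_mem_smul ?_ Submodule.mem_top)
    change _ ∈ idealOfVars (Fin n) ℂ
    rw [← pow_one (idealOfVars (Fin n) ℂ), mem_pow_idealOfVars_iff]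
    intro c hc
    have := hN2 I K c (mem_support_iff.1 hc)
    omega
  · simp only [hT]
    obtain ⟨m, hm⟩ := exists_pow_eq_zero_of_isHomog ha han (T - 1) (fun I K => by
      rw [hN]
      exact (hF K [I]).sub (isHomogFam_idFam K [I])) hN2
    exact bijective_of_pow_sub_one_eq_zero hm

theorem isPushforward_wordCochain {μ η : Cochain (coeffRing n) (extAlgR n)} (hη : η 0 = 0)
    (h : ∀ K l, defect (sgnShift (coeffRing n)) (coeffs (extBasisR n) η) F
      (coeffs (extBasisR n) μ) K l = 0) :
    IsPushforward (G n) (grading n a) (wordCochain (extBasisR n) F) η μ := by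
  refine isPushforward_of_defect_eq_zero (extBasisR n) (G n) _ hη (sgnShift (coeffRing n))
    (fun y x hx I => sgnShift_mul_repr hx I) fun K l => ?_
  have h1 := coeffs_wordCochain (extBasisR n) F
  generalize coeffs (extBasisR n) (wordCochain (extBasisR n) F) = F' at h1 ⊢
  rw [h1]
  exact h K l

end FormalDiffeomorphism

end AInf

theorem mainTheorem10 (n a : ℕ) (hn : 4 ≤ n) (ha : 2 ≤ a) (han : a + 1 ≤ n)
    (μ η : AInf.Cochain (AInf.coeffRing n) (AInf.extAlgR n))
    (hμ : AInf.IsTypeA n a μ) (hη : AInf.IsTypeA n a η) :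
    ∃ F : AInf.Cochain (AInf.coeffRing n) (AInf.extAlgR n),
      AInf.IsFormalDiffeo (AInf.G n) (AInf.grading n a) (AInf.maxIdeal n) F ∧
      AInf.IsPushforward (AInf.G n) (AInf.grading n a) F η μ := by
  obtain ⟨F, hF0, hF, hF2, hE⟩ := AInf.exists_defect_eq_zero hn ha han hμ.isWordStructure
    hη.isWordStructure fun s _ b K c hc => hμ.coeff_symSum_eq hη s b K c hc
  exact ⟨AInf.wordCochain (AInf.extBasisR n) F,
    AInf.isFormalDiffeo_wordCochain ha han hF0 hF hF2,
    AInf.isPushforward_wordCochain hη.ainf.noncurved hE⟩
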